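/- **Setting.** Let $\mathbb N=\{0,1,2,\dots\}$ in indices of chaoses, $(\mathfrak e_1,\mathfrak e_2)$ the canonical basis of $\mathbb R^2$, and let $\rho:\mathbb R^2\to\mathbb R$ be smooth, compactly supported, even, with $\int\rho=1$ and $\|\rho\|_{L^2}=1$; $\hat\rho(p)=\frac1{2\pi}\int\rho(x)e^{-\iota p\cdot x}dx$. For $\tau>0$ put $\nu_\tau=(1\vee\log\tau)^{-2/3}$, $R_\tau=\mathrm{diag}(\nu_\tau,1)$, $\Theta_\tau(p)=(2\pi\hat\rho(\tau^{-1/2}R_\tau^{1/2}p))^2$ and $\Xi^\tau_n(dp_{1:n})=\prod_{i=1}^n\Theta_\tau(p_i)\,dp_{1:n}$ on $(\mathbb R^2)^n$. Write $|\sqrt{R_\tau}p_{1:n}|^2=\sum_i(\nu_\tau(\mathfrak e_1\cdot p_i)^2+(\mathfrak e_2\cdot p_i)^2)$ and $p_{[I]}=\sum_{i\in I}p_i$. The Fock space $\Gamma L^2_\tau$ consists of the sequences $\Phi=(\Phi_n)_{n\ge0}$ of symmetric kernels, identified with their Fourier transforms $\hat\Phi_n\in L^2(\Xi^\tau_n)$,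 with $\|\Phi\|_\tau:=\|\Phi\|_{\Gamma H^0_\tau}<\infty$, where for $\gamma\in\mathbb R$ $$\|\Phi\|_{\Gamma H^\gamma_\tau}^2=\sum_n n!\int\big(1+\tfrac12|\sqrt{R_\tau}p_{1:n}|^2\big)^\gamma|\hat\Phi_n(p_{1:n})|^2\,\Xi^\tau_n(dp_{1:n}).$$ $\mathbf T^\tau$ is the set of $\Phi\in\Gamma L^2_\tau$ with finitely many non-zero components, each with compactly supported Fourier transform; $\Gamma L^2_{\tau,n}$ is the set of those $\Phi$ of which only the $n$-th component is non-zero. $\mathcal N$ is multiplication of the $n$-th component by $n$, and $(-\nu_\tau\mathcal L_0^{\mathfrak e_1})^{1/2}$ is the Fourier multiplier $(\frac{\nu_\tau}2\sum_i(\mathfrak e_1\cdot p_i)^2)^{1/2}$. For $m\ge1$ let $\mathcal A^{\tau,m}=\sum_{j=0}^{m-1}\mathcal A^{\tau,m}_{m-2j-1}$, where $\mathcal A^{\tau,m}_a$, $a=m-2j-1$, maps the $n$-th chaos to the $(n+a)$-th, vanishes if $j+1>n$, and otherwise is given by $$\mathcal F(\mathcal A^{\tau,1}_0\psi)(p_{1:n})=-\iota\,\tau^{1/2}\nu_\tau^{1/2}\Big(\sum_{i=1}^n(\mathfrak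 e_1\cdot p_i)(\Theta_\tau(p_i)-1)\Big)\hat\psi(p_{1:n})$$ and, for $m\ge2$, $$\mathcal F(\mathcal A^{\tau,m}_a\psi)(p_{1:n+a})=-\iota\frac{\tau^{1-\frac m2}\nu_\tau^{\frac{1+m}4}}{(2\pi)^{m-1}}\frac{n!}{(n+a)!(j+1)!}\sum_{|I|=m-j}(\mathfrak e_1\cdot p_{[I]})\int_{r_{[1:j+1]}=p_{[I]}}\Xi^\tau_{j+1}(dr_{1:j+1})\,\hat\psi(r_{1:j+1},p_{\{1,\dots,n+a\}\setminus I}),$$ the sum being over $I\subset\{1,\dots,n+a\}$ and the integral over the hyperplane being with respect to $\prod_{i\le j+1}\Theta_\tau(r_i)\,dr_1\cdots dr_j$ with $r_{j+1}=p_{[I]}-r_{[1:j]}$. **(i)** For every $\alpha\in(0,1)$ there is a constant $C=C(\alpha,\rho)>0$ such that for all $\tau>0$, all $m\ge1$ with $m\ne2$, all $n\in\mathbb N$, all $\chi\in[0,1]$ and all $\Phi\in\Gamma L^2_{\tau,n}$ with $\mathrm{Supp}(\hat\Phi)\subset\{p_{1:n}:|\sqrt{R_\tau}p_{1:n}|^2\le\tau\chi\}$,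 the integrals defining $\mathcal A^{\tau,m}\Phi$ converge absolutely for almost all momenta and $$\|\sqrt{m!}\,\mathcal A^{\tau,m}\Phi\|_{\Gamma H^{-1}_\tau}\le C\big(n^3m^3+\chi\,4^nm^n\big)\,\|(-\nu_\tau\mathcal L_0^{\mathfrak e_1})^{1/2}\Phi\|_\tau^{\alpha}\,\|\Phi\|_{\Gamma H^1_\tau}^{1-\alpha}.$$ **(ii)** Let $F\in\mathcal C^\infty(\mathbb R)$ be such that for some $\kappa\in[0,1/4)$ one has $|F^{(n)}(y)|\le\exp(\exp(o(n)))\exp(\kappa y^2)$ for all $n\ge0$ and $y\in\mathbb R$, where $o(n)/n\to0$ as $n\to\infty$. Let $c_m(F)=m!\int F\,H_m\,d\pi_1$, with $\pi_1$ the standard Gaussian law and $H_m(x)=\frac{(-1)^m}{m!}e^{x^2/2}\frac{d^m}{dx^m}e^{-x^2/2}$. For every $c>0$ and $\alpha\in(0,1)$ there is a constant $C=C(c,\alpha,F,\rho)>0$ such that for all $\tau>0$ and all $\Phi\in\mathbf T^\tau$ with $\mathrm{Supp}(\hat\Phi_n)\subset\{p_{1:n}:|\sqrt{R_\tau}p_{1:n}|^2\le\tau\chi_n\}$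 for every $n\ge1$, where $\chi_n=\exp(-\exp(cn))$, the integrals defining the $\mathcal A^{\tau,m}\Phi$ converge absolutely for almost all momenta, the series $\mathcal A^\tau\Phi=\sum_{m\ge1}c_m(F)\mathcal A^{\tau,m}\Phi$ converges in $\Gamma L^2_\tau$, and $\mathcal A^{\tau,\ne2}:=\mathcal A^\tau-c_2(F)\mathcal A^{\tau,2}$ satisfies $$\|\mathcal A^{\tau,\ne2}\Phi\|_{\Gamma H^{-1}_\tau}\le C\,\|\mathcal N^{3/\alpha}(-\nu_\tau\mathcal L_0^{\mathfrak e_1})^{1/2}\Phi\|_\tau^{\alpha}\,\|\Phi\|_{\Gamma H^1_\tau}^{1-\alpha}.$$ -/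

import Mathlib

open MeasureTheory ProbabilityTheory Filter Topology
open scoped ENNReal Nat

noncomputable section

namespace SBE

/-! ### Momenta, mollifier, regularised measures -/

/-- The plane `ℝ²` with its Euclidean norm. -/
abbrev Plane : Type := EuclideanSpace ℝ (Fin 2)

/-- A mollifier on the plane: smooth, compactly supported, even, of mass one and of `L²`-norm one. -/
structure IsMollifier (ρ : Plane → ℝ) : Prop where
  smooth : ContDiff ℝ (⊤ : ℕ∞) ρ
  compactSupport : HasCompactSupport ρ
  even : ∀ x, ρ (-x) = ρ x
  mass : ∫ x, ρ x = 1
  l2norm : ∫ x, ρ x ^ 2 = 1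

/-- `ν_τ = (1 ∨ log τ)^{-2/3}`. -/
def nu (τ : ℝ) : ℝ := (max 1 (Real.log τ)) ^ (-(2 / 3 : ℝ))

/-- `√R_τ p = (√ν_τ p₁, p₂)`. -/
def sqrtR (τ : ℝ) (p : Plane) : Plane := !₂[Real.sqrt (nu τ) * p 0, p 1]

/-- The Fourier transform `ρ̂(p) = (2π)⁻¹ ∫ ρ(x) e^{-i p·x} dx` on the plane. -/
def rhoHat (ρ : Plane → ℝ) (p : Plane) : ℂ :=
  (1 / (2 * Real.pi) : ℝ) * ∫ x : Plane, (ρ x : ℂ) * Complex.exp (-Complex.I * (inner ℝ p x : ℝ))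

/-- `Θ_τ(p) = (2π ρ̂(τ^{-1/2} √R_τ p))²`. Since `ρ` is real and even, `ρ̂` is real, so that
its square is its squared modulus. -/
def Theta (ρ : Plane → ℝ) (τ : ℝ) (p : Plane) : ℝ :=
  (2 * Real.pi * ‖rhoHat ρ ((Real.sqrt τ)⁻¹ • sqrtR τ p)‖) ^ 2

/-- `Ξ_n^τ(dp_{1:n}) = ∏ᵢ Θ_τ(pᵢ) dp_{1:n}`. -/
def Xi (ρ : Plane → ℝ) (τ : ℝ) (n : ℕ) : Measure (Fin n → Plane) :=
  volume.withDensity fun p => ENNReal.ofReal (∏ i, Theta ρ τ (p i))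

/-- `|𝔢_i · p_{1:n}|²`, for `i = 0, 1` (the two coordinate directions). -/
def dirSq (i : Fin 2) {n : ℕ} (p : Fin n → Plane) : ℝ := ∑ l, (p l i) ^ 2

/-- `|√R_τ p_{1:n}|²`. -/
def anisoSq (τ : ℝ) {n : ℕ} (p : Fin n → Plane) : ℝ := ∑ l, ‖sqrtR τ (p l)‖ ^ 2

/-! ### Fock space, on the Fourier side

An element of `L²_τ(ℝ^{2n})`, the completion of the Schwartz space under
`(∫ |f̂|² dΞ_n^τ)^{1/2}`, is the same as its Fourier transform, an element of `L²(Ξ_n^τ)`.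
A sequence `f = (f_n)_n` of kernels is represented by the sequence of the Fourier transforms `f̂_n`.
-/

/-- Sequences `(f̂_n)_n` of functions of `n` momenta. -/
abbrev FockSeq : Type := (n : ℕ) → (Fin n → Plane) → ℂ

/-- The norm of `Γ H^γ_τ`:
`‖f‖² = ∑_n n! ∫ (1 + ½ |√R_τ p|²)^γ |f̂_n(p)|² Ξ_n^τ(dp)`, with values in `[0, ∞]`. -/
def fockNorm (ρ : Plane → ℝ) (τ γ : ℝ) (Φ : FockSeq) : ℝ≥0∞ :=
  (∑' n : ℕ, (n ! : ℝ≥0∞) *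
    ∫⁻ p, ENNReal.ofReal ((1 + 1 / 2 * anisoSq τ p) ^ γ) * ‖Φ n p‖ₑ ^ 2 ∂(Xi ρ τ n)) ^ (1 / 2 : ℝ)

/-- `Φ` is (a representative of) an element of the Fock space `Γ L²_τ`: the kernels are
measurable, symmetric under permutations of the variables, and the norm is finite. -/
structure IsFock (ρ : Plane → ℝ) (τ : ℝ) (Φ : FockSeq) : Prop where
  measurable : ∀ n, Measurable (Φ n)
  symm : ∀ n (σ : Equiv.Perm (Fin n)) (p : Fin n → Plane), Φ n (p ∘ σ) = Φ n p
  norm_lt_top : fockNorm ρ τ 0 Φ < ⊤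

/-- The `n`-th Fourier kernel of `Φ` is supported in `S`. For a closed `S` this is the inclusion
of the support of `Φ̂_n`, as an element of `L²(Ξ_n^τ)`, in `S`. -/
def FourierSuppIn (ρ : Plane → ℝ) (τ : ℝ) (Φ : FockSeq) (n : ℕ) (S : Set (Fin n → Plane)) : Prop :=
  ∀ᵐ p ∂(Xi ρ τ n), p ∉ S → Φ n p = 0

/-- The set `𝐓^τ` of elements of the Fock space with finitely many non-zero components, all of
which have compactly supported Fourier transform. -/
structure IsTest (ρ : Plane → ℝ) (τ : ℝ) (Φ : FockSeq) : Prop where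
  fock : IsFock ρ τ Φ
  finite : ∃ N : ℕ, ∀ n, N ≤ n → Φ n = 0
  compactSupport : ∀ n, ∃ K : Set (Fin n → Plane), IsCompact K ∧ FourierSuppIn ρ τ Φ n K

/-! ### Diagonal operators -/

/-- The kernels of a diagonal operator. -/
abbrev DiagKer : Type := (n : ℕ) → (Fin n → Plane) → ℝ

/-- The diagonal operator with Fourier multiplier `d`. -/
def diagOp (d : DiagKer) (Φ : FockSeq) : FockSeq := fun n p => (d n p : ℂ) * Φ n p

/-- The kernel `-½ |𝔢₁ · p|²` of `L₀^{𝔢₁}`. -/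
def L0e1Ker : DiagKer := fun _ p => -(1 / 2) * dirSq 0 p

/-- The operator `(-ν_τ L₀^{𝔢₁})^{1/2}`. -/
def anisoHalf (τ : ℝ) : FockSeq → FockSeq :=
  diagOp fun n p => Real.sqrt (-(nu τ * L0e1Ker n p))

/-- The power `𝒩^s` of the number operator. -/
def numberPow (s : ℝ) : FockSeq → FockSeq := diagOp fun n _ => (n : ℝ) ^ s

/-! ### The antisymmetric part of the generator -/

/-- `p_{[I]} = ∑_{i ∈ I} p_i`. -/
def sumOn {k : ℕ} (I : Finset (Fin k)) (p : Fin k → Plane) : Plane := ∑ i ∈ I, p i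

/-- Completes `r_1, …, r_j` by `r_{j+1} = s - r_1 - ⋯ - r_j`: the parametrisation by `r_{1:j}`
of the momenta `r_{1:j+1}` with total momentum `s`. -/
def closeSum {j : ℕ} (s : Plane) (r : Fin j → Plane) : Fin (j + 1) → Plane :=
  Fin.snoc (α := fun _ => Plane) r (s - ∑ i, r i)

/-- The momenta `(r_{1:j+1}, p_{1:k ∖ I})`, the elements of the complement of `I` in increasing
order. It is used when `n = j + 1 + |Iᶜ|`, in which case the value `0` does not occur. -/
def assemble {j k : ℕ} (n : ℕ) (I : Finset (Fin k)) (r : Fin (j + 1) → Plane)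
    (p : Fin k → Plane) : Fin n → Plane := fun i =>
  if h : (i : ℕ) < j + 1 then r ⟨i, h⟩
  else if h' : (i : ℕ) - (j + 1) < Iᶜ.card then p (Iᶜ.orderEmbOfFin rfl ⟨(i : ℕ) - (j + 1), h'⟩)
  else 0

/-- The integrand of `∫_{r_{[1:j+1]} = p_{[I]}} Ξ_{j+1}^τ(dr_{1:j+1}) ψ̂(r_{1:j+1}, p_{1:k ∖ I})`
in the free variables `r_{1:j}`. -/
def collideIntegrand (ρ : Plane → ℝ) (τ : ℝ) (j : ℕ) {n k : ℕ} (ψ : (Fin n → Plane) → ℂ)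
    (I : Finset (Fin k)) (p : Fin k → Plane) (r : Fin j → Plane) : ℂ :=
  ((∏ i, Theta ρ τ (closeSum (sumOn I p) r i) : ℝ) : ℂ) *
    ψ (assemble n I (closeSum (sumOn I p) r) p)

/-- For `m ≥ 2`, `0 ≤ j ≤ m - 1`, the operator `𝒜^{τ,m}_a`, `a = m - 2j - 1`, from the `n`-th to
the `k`-th chaos, `k = n + a`. It is `0` if `j + 1 > n` (or if `k ≠ n + a`). -/
def genComp (ρ : Plane → ℝ) (τ : ℝ) (m j n k : ℕ) (ψ : (Fin n → Plane) → ℂ) :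
    (Fin k → Plane) → ℂ := fun p =>
  if j + 1 ≤ n ∧ n + m = k + 2 * j + 1 then
    -Complex.I *
      ((τ ^ (1 - (m : ℝ) / 2) * nu τ ^ ((1 + (m : ℝ)) / 4) / (2 * Real.pi) ^ (m - 1) *
        ((n ! : ℝ) / ((k ! : ℝ) * ((j + 1) ! : ℝ))) : ℝ) : ℂ) *
      ∑ I ∈ Finset.powersetCard (m - j) (Finset.univ : Finset (Fin k)),
        ((sumOn I p 0 : ℝ) : ℂ) * ∫ r : Fin j → Plane, collideIntegrand ρ τ j ψ I p r
  else 0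

/-- The operator `𝒜^{τ,1} = 𝒜^{τ,1}_0` on the `n`-th chaos. -/
def genOne (ρ : Plane → ℝ) (τ : ℝ) {n : ℕ} (ψ : (Fin n → Plane) → ℂ) : (Fin n → Plane) → ℂ :=
  fun p => -Complex.I *
    ((τ ^ (1 / 2 : ℝ) * nu τ ^ (1 / 2 : ℝ) * ∑ i, p i 0 * (Theta ρ τ (p i) - 1) : ℝ) : ℂ) * ψ p

/-- `𝒜^{τ,m} = ∑_{j=0}^{m-1} 𝒜^{τ,m}_{m-2j-1}`. The `j`-th summand of the `k`-th component comes
from the chaos `n = k - a = k + 2j + 1 - m`. -/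
def genA (ρ : Plane → ℝ) (τ : ℝ) (m : ℕ) (Φ : FockSeq) : FockSeq := fun k p =>
  if m = 1 then genOne ρ τ (Φ k) p
  else ∑ j ∈ Finset.range m, genComp ρ τ m j (k + 2 * j + 1 - m) k (Φ (k + 2 * j + 1 - m)) p

/-- The integrals that define `𝒜^{τ,m} Φ` converge absolutely, for almost all momenta. -/
def GenConverges (ρ : Plane → ℝ) (τ : ℝ) (m : ℕ) (Φ : FockSeq) : Prop :=
  ∀ n k j : ℕ, j < m → j + 1 ≤ n → n + m = k + 2 * j + 1 →
    ∀ᵐ p ∂(Xi ρ τ k), ∀ I ∈ Finset.powersetCard (m - j) (Finset.univ : Finset (Fin k)),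
      Integrable (collideIntegrand ρ τ j (Φ n) I p)

/-! ### The nonlinearity -/

/-- `F` is smooth and there are `κ ∈ [0, 1/4)` and `o(n)` with `o(n) / n → 0` such that
`|F⁽ⁿ⁾(y)| ≤ exp(exp(o(n))) exp(κ y²)` for all `n ≥ 0` and `y`. -/
def GrowthAssumption (F : ℝ → ℝ) : Prop :=
  ContDiff ℝ (⊤ : ℕ∞) F ∧
    ∃ κ : ℝ, 0 ≤ κ ∧ κ < 1 / 4 ∧
      ∃ o : ℕ → ℝ, Tendsto (fun n : ℕ => o n / n) atTop (𝓝 0) ∧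
        ∀ (n : ℕ) (y : ℝ),
          |iteratedDeriv n F y| ≤ Real.exp (Real.exp (o n)) * Real.exp (κ * y ^ 2)

/-- `H_m(x) = ((-1)^m / m!) e^{x²/2} (d/dx)^m e^{-x²/2}`: the probabilists' Hermite polynomial
divided by `m!`. -/
def hermiteH (m : ℕ) (x : ℝ) : ℝ := Polynomial.aeval x (Polynomial.hermite m) / (m ! : ℝ)

/-- `c_m(F) = m! ⟨F, H_m⟩` in `L²` of the standard Gaussian measure, so that
`F = ∑_m c_m(F) H_m`. -/
def hermiteCoeff (F : ℝ → ℝ) (m : ℕ) : ℝ := (m ! : ℝ) * ∫ y, F y * hermiteH m y ∂(gaussianReal 0 1)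

/-- `𝒜^τ Φ = ∑_{m ≥ 1} c_m(F) 𝒜^{τ,m} Φ`, component by component. For `Φ` with finitely many
non-zero components, each component of the sum has only finitely many non-zero terms.
(`𝒜^{τ,0} = 0` with the conventions above.) -/
def genTotal (ρ : Plane → ℝ) (τ : ℝ) (F : ℝ → ℝ) (Φ : FockSeq) : FockSeq := fun k p =>
  ∑' m : ℕ, (hermiteCoeff F m : ℂ) * genA ρ τ m Φ k p

/-- `𝒜^{τ,≠2} = 𝒜^τ - c_2(F) 𝒜^{τ,2}`. -/
def genNeTwo (ρ : Plane → ℝ) (τ : ℝ) (F : ℝ → ℝ) (Φ : FockSeq) : FockSeq :=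
  genTotal ρ τ F Φ - (hermiteCoeff F 2 : ℂ) • genA ρ τ 2 Φ

/-- `χ_n = exp(-exp(c n))`. -/
def chiSeq (c : ℝ) (n : ℕ) : ℝ := Real.exp (-Real.exp (c * n))

end SBE

end

open SBE

/-!
The operator `𝒜^{τ,m}_a`, `a = m - 2j - 1`, replaces `j + 1` of the `n` incoming momenta by `m - j`
outgoing ones, of indices `I`, with the same total momentum, the other momenta being spectators.

**A fixed set `I`.** By the Cauchy-Schwarz inequality on the fibres of fixed total momentum, the
square of a collision integral is estimated by integrating weights separately over the incoming and
over the outgoing momenta; the remaining integral over the outgoing configurations is one over the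
incoming configurations (`lintegral_collInt_sq_le`). Each of the `m - 1` free momenta costs the
mass `massTheta τ` of `Θ_τ`, and the powers of `τ` and `ν_τ` in front of `𝒜^{τ,m}` compensate these
masses up to one factor `τ` (`genFactor_sq_mul`). That factor is gained from the energies. For
`|I| ≥ 3` the resolvent `(1 + ½ |√R_τ p|²)⁻¹` is shared between two outgoing momenta, each of which
yields `τ^{-1/2}`. For `|I| = 2` it is interpolated between an outgoing and an incoming momentum,
with the exponent `α`. For `|I| = 1` the energies of two incoming momenta yield the integrable
singularity `|p₁|^{-α} |p₂|^{-(1-α)}`. In the last two cases at least two, respectively three,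
momenta have to collide, which excludes precisely `m = 2` once `m ≥ 2`.

**The number of sets `I`.** The support condition makes incoming momenta and spectators small. If
`j ≥ 2`, the smallness of the colliding momenta yields a factor `χ`, which pays for the number of
sets (`collision_le_of_many`). If `j < 2`, then either at most one outgoing momentum besides the
spectators is small, and at most `n` sets contribute, or two outgoing momenta in `I` are small, which
again yields a factor `χ` (`sq_sum_powersetCard_le`, `collision_le_of_pair`). For `m = 1` the
estimate is a pointwise one, as `Θ_τ(p) - 1` is Lipschitz in `τ^{-1/2} √R_τ p`. The right-hand side
is the energy interpolated between `ν_τ |𝔢₁ · p|²` and `1 + ½ |√R_τ p|²`, to which Hölder's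
inequality applies (`tsum_interpEnergy_le`).

**The sum over `m`.** Integration by parts gives `c_m(F⁽ⁱ⁾) = c_{m+i}(F)`, so that Bessel's
inequality for `F⁽ⁱ⁾` bounds `∑ c_m² (m+1)^i / m!` by `(i+1)^i (‖F‖² + ‖F⁽ⁱ⁾‖²)`. This grows at most
like `exp (exp (o(i)))` up to lower orders and is beaten by `χ_n = exp (-exp (c n))`
(`summable_chiSeq_mul_hermiteMoment`). Hence the bounds of the terms of the series are summable, and
the series is estimated by the triangle inequality (`fockSq_le_of_enorm_le_tsum`). Its convergence
in `ΓL²` follows in the same way from an estimate which need not be uniform in `τ` and `Φ`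
(`exists_fockSq_genA_crude`).
-/

open SBE

namespace SBE

/-! ### The spectral density of the mollifier -/

/-- The spectral density `(2π |ρ̂|)²` of the mollifier at unit scale, so that
`Θ_τ(p) = mollSq ρ (τ^{-1/2} √R_τ p)`. -/
noncomputable def mollSq (ρ : Plane → ℝ) (q : Plane) : ℝ := (2 * Real.pi * ‖rhoHat ρ q‖) ^ 2

lemma Theta_eq_mollSq (ρ : Plane → ℝ) (τ : ℝ) (p : Plane) :
    Theta ρ τ p = mollSq ρ ((Real.sqrt τ)⁻¹ • sqrtR τ p) := rfl

lemma mollSq_nonneg (ρ : Plane → ℝ) (q : Plane) : 0 ≤ mollSq ρ q := sq_nonneg _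

lemma Theta_nonneg (ρ : Plane → ℝ) (τ : ℝ) (p : Plane) : 0 ≤ Theta ρ τ p := sq_nonneg _

/-- In Mathlib's normalisation of the Fourier transform, the spectral density is the squared
modulus of a Schwartz function. -/
lemma IsMollifier.exists_schwartz {ρ : Plane → ℝ} (hρ : IsMollifier ρ) :
    ∃ g : SchwartzMap Plane ℂ, (∀ q, mollSq ρ q = ‖g ((2 * Real.pi)⁻¹ • q)‖ ^ 2) ∧
      ‖g 0‖ = 1 ∧ ∫ q, ‖g q‖ ^ 2 = 1 := by
  have hc : HasCompactSupport (fun x => (ρ x : ℂ)) := by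
    have := hρ.compactSupport.comp_left (g := fun x : ℝ => (x : ℂ)) Complex.ofReal_zero
    exact this
  have hs : ContDiff ℝ (⊤ : ℕ∞) (fun x => (ρ x : ℂ)) :=
    Complex.ofRealCLM.contDiff.comp hρ.smooth
  set f : SchwartzMap Plane ℂ := hc.toSchwartzMap hs with hf
  have hfx : ∀ x, f x = (ρ x : ℂ) := fun x => rfl
  have key : ∀ w : Plane, FourierTransform.fourier f w
      = ∫ v : Plane, Complex.exp (↑(-2 * Real.pi * inner ℝ v w) * Complex.I) • (ρ v : ℂ) := by
    intro w
    rw [SchwartzMap.fourier_coe, Real.fourier_eq']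
    rfl
  refine ⟨FourierTransform.fourier f, ?_, ?_, ?_⟩
  · intro q
    have h2π : (0 : ℝ) < 2 * Real.pi := by positivity
    rw [key, mollSq, rhoHat, norm_mul, Complex.norm_real, Real.norm_of_nonneg (by positivity),
      ← mul_assoc, mul_one_div_cancel h2π.ne', one_mul]
    congr 2
    refine integral_congr_ae (Eventually.of_forall fun x => ?_)
    simp only [smul_eq_mul]
    rw [mul_comm, inner_smul_right, real_inner_comm]
    congr 2
    have : -2 * Real.pi * ((2 * Real.pi)⁻¹ * inner ℝ x q) = -inner ℝ x q := by
      field_simp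
    rw [this]
    push_cast
    ring
  · rw [key]
    simp only [inner_zero_right, mul_zero, Complex.ofReal_zero, zero_mul, Complex.exp_zero,
      one_smul]
    rw [integral_complex_ofReal, hρ.mass]
    simp
  · rw [SchwartzMap.integral_norm_sq_fourier]
    simp only [hfx, Complex.norm_real, Real.norm_eq_abs, sq_abs]
    exact hρ.l2norm

lemma IsMollifier.continuous_mollSq {ρ : Plane → ℝ} (hρ : IsMollifier ρ) :
    Continuous (mollSq ρ) := by
  obtain ⟨g, hg, -, -⟩ := hρ.exists_schwartz
  have : mollSq ρ = fun q => ‖g ((2 * Real.pi)⁻¹ • q)‖ ^ 2 := funext hg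
  rw [this]
  have := g.continuous
  fun_prop

lemma IsMollifier.exists_mollSq_le {ρ : Plane → ℝ} (hρ : IsMollifier ρ) :
    ∃ B : ℝ, 1 ≤ B ∧ ∀ q, mollSq ρ q ≤ B := by
  obtain ⟨g, hg, -, -⟩ := hρ.exists_schwartz
  obtain ⟨C, hC⟩ := g.decay 0 0
  simp only [pow_zero, one_mul, norm_iteratedFDeriv_zero] at hC
  refine ⟨max 1 (C ^ 2), le_max_left _ _, fun q => ?_⟩
  rw [hg]
  exact le_max_of_le_right (pow_le_pow_left₀ (norm_nonneg _) (hC.2 _) 2)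

/-- The spectral density is `1` at the origin and Lipschitz there. -/
lemma IsMollifier.exists_abs_mollSq_sub_one_le {ρ : Plane → ℝ} (hρ : IsMollifier ρ) :
    ∃ K : ℝ, 0 ≤ K ∧ ∀ q, |mollSq ρ q - 1| ≤ K * ‖q‖ := by
  obtain ⟨g, hg, hg0, -⟩ := hρ.exists_schwartz
  obtain ⟨C, hC⟩ := g.decay 0 0
  obtain ⟨D, hD⟩ := g.decay 0 1
  simp only [pow_zero, one_mul, norm_iteratedFDeriv_zero] at hC
  simp only [pow_zero, one_mul, norm_iteratedFDeriv_one] at hD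
  refine ⟨(C + 1) * (D * (2 * Real.pi)⁻¹), ?_, fun q => ?_⟩
  · have := hC.1; have := hD.1; positivity
  have hlip : ‖g ((2 * Real.pi)⁻¹ • q) - g 0‖ ≤ D * ‖(2 * Real.pi)⁻¹ • q - 0‖ :=
    Convex.norm_image_sub_le_of_norm_fderiv_le (s := Set.univ) (𝕜 := ℝ)
      (fun x _ => g.differentiableAt) (fun x _ => hD.2 x) convex_univ trivial trivial
  rw [sub_zero, norm_smul, Real.norm_of_nonneg (by positivity)] at hlip
  set a := g ((2 * Real.pi)⁻¹ • q)
  have h1 : |‖a‖ - 1| ≤ D * ((2 * Real.pi)⁻¹ * ‖q‖) := by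
    rw [← hg0]; exact (abs_norm_sub_norm_le _ _).trans hlip
  have h2 : |‖a‖ + 1| ≤ C + 1 := by
    rw [abs_of_nonneg (by positivity)]
    linarith [hC.2 ((2 * Real.pi)⁻¹ • q)]
  rw [hg, show ‖a‖ ^ 2 - 1 = (‖a‖ + 1) * (‖a‖ - 1) by ring, abs_mul, mul_assoc, mul_assoc]
  exact mul_le_mul h2 h1 (abs_nonneg _) ((abs_nonneg _).trans h2)

/-- Integration over the plane in Cartesian coordinates. -/
lemma lintegral_plane (f : Plane → ℝ≥0∞) (hf : Measurable f) :
    ∫⁻ p, f p = ∫⁻ x : ℝ, ∫⁻ y : ℝ, f (!₂[x, y]) := by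
  have h1 := (PiLp.volume_preserving_toLp (Fin 2)).lintegral_comp hf
  have hf' : Measurable fun v : Fin 2 → ℝ => f (WithLp.toLp 2 v) :=
    hf.comp (PiLp.volume_preserving_toLp (Fin 2)).measurable
  have h2 := ((volume_preserving_finTwoArrow ℝ).symm).lintegral_comp hf'
  rw [← h1, ← h2, Measure.volume_eq_prod, lintegral_prod]
  · rfl
  · exact (hf'.comp (MeasurableEquiv.measurable _)).aemeasurable

lemma lintegral_mul_left {a : ℝ} (ha : 0 < a) (f : ℝ → ℝ≥0∞) (hf : Measurable f) :
    ∫⁻ x, f (a * x) = ENNReal.ofReal a⁻¹ * ∫⁻ x, f x := by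
  have h := lintegral_map (μ := volume) hf (measurable_const_mul a)
  rw [← h, Real.map_volume_mul_left ha.ne', lintegral_smul_measure, abs_of_pos (inv_pos.2 ha)]
  rfl

lemma nu_pos (τ : ℝ) : 0 < nu τ :=
  Real.rpow_pos_of_pos (lt_of_lt_of_le one_pos (le_max_left _ _)) _

/-- The change of variables `q = τ^{-1/2} √R_τ p`. -/
lemma lintegral_rescale {τ : ℝ} (hτ : 0 < τ) (f : Plane → ℝ≥0∞) (hf : Measurable f) :
    ∫⁻ p, f ((Real.sqrt τ)⁻¹ • sqrtR τ p)
      = ENNReal.ofReal (τ * (Real.sqrt (nu τ))⁻¹) * ∫⁻ q, f q := by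
  have hs : 0 < Real.sqrt τ := Real.sqrt_pos.2 hτ
  have hn : 0 < Real.sqrt (nu τ) := Real.sqrt_pos.2 (nu_pos τ)
  have e : ∀ x y : ℝ, (Real.sqrt τ)⁻¹ • sqrtR τ (!₂[x, y])
      = (!₂[((Real.sqrt τ)⁻¹ * Real.sqrt (nu τ)) * x, (Real.sqrt τ)⁻¹ * y]) := by
    intro x y
    ext i
    fin_cases i <;> simp [sqrtR, mul_assoc]
  have hm : Measurable fun p : Plane => (Real.sqrt τ)⁻¹ • sqrtR τ p := by
    unfold sqrtR
    fun_prop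
  have hpair : Measurable fun z : ℝ × ℝ => f (!₂[z.1, z.2]) := by
    apply hf.comp
    fun_prop
  rw [lintegral_plane (fun p => f ((Real.sqrt τ)⁻¹ • sqrtR τ p)) (hf.comp hm),
    lintegral_plane f hf]
  simp_rw [e]
  have h1 : ∀ x : ℝ, ∫⁻ y : ℝ, f (!₂[x, (Real.sqrt τ)⁻¹ * y])
      = ENNReal.ofReal (Real.sqrt τ) * ∫⁻ y : ℝ, f (!₂[x, y]) := by
    intro x
    have := lintegral_mul_left (inv_pos.2 hs) (fun y => f (!₂[x, y]))
      (hpair.comp (measurable_const.prodMk measurable_id))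
    rwa [inv_inv] at this
  simp_rw [h1]
  rw [lintegral_const_mul' _ _ ENNReal.ofReal_ne_top,
    lintegral_mul_left (mul_pos (inv_pos.2 hs) hn) (fun x => ∫⁻ y : ℝ, f (!₂[x, y]))
      hpair.lintegral_prod_right', ← mul_assoc, ← ENNReal.ofReal_mul hs.le]
  congr 2
  rw [mul_inv, inv_inv, ← mul_assoc, Real.mul_self_sqrt hτ.le]

/-- The mass of `Θ_τ`, that is `4π² τ ν_τ^{-1/2}`. -/
noncomputable def massTheta (τ : ℝ) : ℝ := 4 * Real.pi ^ 2 * (τ * (Real.sqrt (nu τ))⁻¹)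

lemma massTheta_pos {τ : ℝ} (hτ : 0 < τ) : 0 < massTheta τ := by
  have := Real.sqrt_pos.2 (nu_pos τ)
  unfold massTheta
  positivity

lemma lintegral_mollSq {ρ : Plane → ℝ} (hρ : IsMollifier ρ) :
    ∫⁻ q, ENNReal.ofReal (mollSq ρ q) = ENNReal.ofReal (4 * Real.pi ^ 2) := by
  obtain ⟨g, hg, -, hg2⟩ := hρ.exists_schwartz
  have hint : Integrable fun q => ‖g q‖ ^ 2 := by
    by_contra h
    rw [integral_undef h] at hg2
    exact zero_ne_one hg2
  have h2π : (0 : ℝ) < (2 * Real.pi)⁻¹ := by positivity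
  simp_rw [hg]
  rw [← ofReal_integral_eq_lintegral_ofReal (hint.comp_smul h2π.ne')
    (Eventually.of_forall fun _ => by positivity),
    Measure.integral_comp_smul volume (fun q => ‖g q‖ ^ 2), hg2]
  congr 1
  rw [show Module.finrank ℝ Plane = 2 by simp [Plane], abs_of_pos (by positivity)]
  rw [inv_pow, inv_inv]
  ring

lemma lintegral_Theta {ρ : Plane → ℝ} (hρ : IsMollifier ρ) {τ : ℝ} (hτ : 0 < τ) :
    ∫⁻ p, ENNReal.ofReal (Theta ρ τ p) = ENNReal.ofReal (massTheta τ) := by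
  have := hρ.continuous_mollSq
  simp_rw [Theta_eq_mollSq]
  rw [lintegral_rescale hτ (fun q => ENNReal.ofReal (mollSq ρ q)) (by fun_prop),
    lintegral_mollSq hρ, ← ENNReal.ofReal_mul (by have := Real.sqrt_nonneg (nu τ); positivity)]
  congr 1
  unfold massTheta
  ring

lemma continuous_sqrtR (τ : ℝ) : Continuous (sqrtR τ) := by
  unfold sqrtR
  fun_prop

lemma continuous_Theta {ρ : Plane → ℝ} (hρ : IsMollifier ρ) (τ : ℝ) :
    Continuous (Theta ρ τ) :=
  by
  have := (continuous_sqrtR τ).const_smul (Real.sqrt τ)⁻¹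
  exact hρ.continuous_mollSq.comp this

lemma norm_sqrtR_sq (τ : ℝ) (p : Plane) :
    ‖sqrtR τ p‖ ^ 2 = nu τ * p 0 ^ 2 + p 1 ^ 2 := by
  rw [EuclideanSpace.norm_sq_eq, Fin.sum_univ_two]
  simp [sqrtR, mul_pow, Real.sq_sqrt (nu_pos τ).le]

lemma norm_rescale_sq {τ : ℝ} (hτ : 0 < τ) (p : Plane) :
    ‖(Real.sqrt τ)⁻¹ • sqrtR τ p‖ ^ 2 = τ⁻¹ * ‖sqrtR τ p‖ ^ 2 := by
  rw [norm_smul, mul_pow, norm_inv, inv_pow, Real.norm_of_nonneg (Real.sqrt_nonneg _),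
    Real.sq_sqrt hτ.le]

/-! ### Singular integrals against the spectral density -/

lemma lintegral_abs_rpow {a R : ℝ} (ha : a < 1) (hR : 0 ≤ R) :
    ∫⁻ x in Set.Icc (-R) R, ENNReal.ofReal (|x| ^ (-a))
      = ENNReal.ofReal (2 / (1 - a) * R ^ (1 - a)) := by
  have hint : IntervalIntegrable (fun x : ℝ => x ^ (-a)) volume 0 R :=
    intervalIntegral.intervalIntegrable_rpow' (by linarith)
  have hpos : ∫⁻ x in Set.Ioc 0 R, ENNReal.ofReal (|x| ^ (-a))
      = ENNReal.ofReal (1 / (1 - a) * R ^ (1 - a)) := by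
    have h1 : ∫⁻ x in Set.Ioc 0 R, ENNReal.ofReal (|x| ^ (-a))
        = ∫⁻ x in Set.Ioc 0 R, ENNReal.ofReal (x ^ (-a)) := by
      refine setLIntegral_congr_fun measurableSet_Ioc fun x hx => ?_
      simp only [abs_of_pos hx.1]
    rw [h1, ← ofReal_integral_eq_lintegral_ofReal
      ((intervalIntegrable_iff_integrableOn_Ioc_of_le hR).1 hint)]
    · rw [← intervalIntegral.integral_of_le hR, integral_rpow (Or.inl (by linarith)),
        Real.zero_rpow (by linarith), show -a + 1 = 1 - a by ring]
      congr 1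
      ring
    · exact (ae_restrict_iff' measurableSet_Ioc).2
        (Eventually.of_forall fun x hx => Real.rpow_nonneg hx.1.le _)
  have hneg : ∫⁻ x in Set.Ico (-R) 0, ENNReal.ofReal (|x| ^ (-a))
      = ∫⁻ x in Set.Ioc 0 R, ENNReal.ofReal (|x| ^ (-a)) := by
    have h := (Measure.measurePreserving_neg (volume : Measure ℝ)).setLIntegral_comp_preimage
      (s := Set.Ioc 0 R) measurableSet_Ioc (f := fun x => ENNReal.ofReal (|x| ^ (-a)))
      (by fun_prop)
    rw [← h]
    simp
  have hunion : Set.Icc (-R) R = (Set.Ico (-R) 0 ∪ {0}) ∪ Set.Ioc 0 R := by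
    ext x
    simp only [Set.mem_Icc, Set.mem_union, Set.mem_Ico, Set.mem_singleton_iff, Set.mem_Ioc]
    constructor
    · rintro ⟨h1, h2⟩
      rcases lt_trichotomy x 0 with h | h | h
      · exact Or.inl (Or.inl ⟨h1, h⟩)
      · exact Or.inl (Or.inr h)
      · exact Or.inr ⟨h, h2⟩
    · rintro ((⟨h1, h2⟩ | h) | ⟨h1, h2⟩) <;> constructor <;> linarith
  rw [hunion, lintegral_union measurableSet_Ioc, lintegral_union (measurableSet_singleton 0)]
  · rw [hneg, hpos, Measure.restrict_singleton]
    simp only [Real.volume_singleton, zero_smul, lintegral_zero_measure, add_zero]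
    have h1a : 0 < 1 - a := by linarith
    have : 0 ≤ R ^ (1 - a) := Real.rpow_nonneg hR _
    rw [← ENNReal.ofReal_add (by positivity) (by positivity)]
    congr 1
    ring
  · simp
  · rw [Set.disjoint_left]
    rintro x (hx | hx) hx'
    · exact absurd hx.2 (not_lt.2 hx'.1.le)
    · exact absurd hx'.1 (by rw [Set.mem_singleton_iff.1 hx]; exact lt_irrefl _)

/-- The singularity `|q₁|^{-a} |q₂|^{-b}`, `a, b < 1`, on a disc of the plane. -/
lemma lintegral_disc_le {a b R : ℝ} (ha : a < 1) (hb : b < 1) (hR : 0 ≤ R) :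
    ∫⁻ q : Plane, Set.indicator {q : Plane | ‖q‖ ≤ R}
        (fun q => ENNReal.ofReal (|q 0| ^ (-a) * |q 1| ^ (-b))) q
      ≤ ENNReal.ofReal (2 / (1 - a) * (2 / (1 - b)) * R ^ (2 - a - b)) := by
  have hm : MeasurableSet {q : Plane | ‖q‖ ≤ R} := measurableSet_le (by fun_prop) (by fun_prop)
  rw [lintegral_plane _ ((by fun_prop : Measurable fun q : Plane =>
    ENNReal.ofReal (|q 0| ^ (-a) * |q 1| ^ (-b))).indicator hm)]
  have h1a : 0 < 1 - a := by linarith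
  have h1b : 0 < 1 - b := by linarith
  calc ∫⁻ x : ℝ, ∫⁻ y : ℝ, Set.indicator {q : Plane | ‖q‖ ≤ R}
        (fun q => ENNReal.ofReal (|q 0| ^ (-a) * |q 1| ^ (-b))) (!₂[x, y])
      ≤ ∫⁻ x : ℝ, ∫⁻ y : ℝ,
          Set.indicator (Set.Icc (-R) R) (fun x => ENNReal.ofReal (|x| ^ (-a))) x *
          Set.indicator (Set.Icc (-R) R) (fun y => ENNReal.ofReal (|y| ^ (-b))) y := by
        refine lintegral_mono fun x => lintegral_mono fun y => ?_
        by_cases h : (!₂[x, y] : Plane) ∈ {q : Plane | ‖q‖ ≤ R}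
        · have h' : ‖(!₂[x, y] : Plane)‖ ≤ R := h
          have hx : |x| ≤ R := by
            simpa using (PiLp.norm_apply_le (!₂[x, y] : Plane) 0).trans h'
          have hy : |y| ≤ R := by
            simpa using (PiLp.norm_apply_le (!₂[x, y] : Plane) 1).trans h'
          rw [Set.indicator_of_mem h, Set.indicator_of_mem (s := Set.Icc (-R) R) (abs_le.1 hx),
            Set.indicator_of_mem (s := Set.Icc (-R) R) (abs_le.1 hy),
            ← ENNReal.ofReal_mul (Real.rpow_nonneg (abs_nonneg _) _)]
          simp
        · rw [Set.indicator_of_notMem h]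
          exact zero_le
    _ = (∫⁻ x : ℝ, Set.indicator (Set.Icc (-R) R) (fun x => ENNReal.ofReal (|x| ^ (-a))) x) *
          ∫⁻ y : ℝ, Set.indicator (Set.Icc (-R) R) (fun y => ENNReal.ofReal (|y| ^ (-b))) y := by
        rw [← lintegral_mul_const _ ((by fun_prop : Measurable fun x : ℝ =>
          ENNReal.ofReal (|x| ^ (-a))).indicator measurableSet_Icc)]
        refine lintegral_congr fun x => ?_
        rw [lintegral_const_mul _ ((by fun_prop : Measurable fun x : ℝ =>
          ENNReal.ofReal (|x| ^ (-b))).indicator measurableSet_Icc)]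
    _ = ENNReal.ofReal (2 / (1 - a) * (2 / (1 - b)) * R ^ (2 - a - b)) := by
        rw [lintegral_indicator measurableSet_Icc, lintegral_indicator measurableSet_Icc,
          lintegral_abs_rpow ha hR, lintegral_abs_rpow hb hR,
          ← ENNReal.ofReal_mul (by positivity)]
        congr 1
        rw [show 2 - a - b = (1 - a) + (1 - b) by ring]
        rw [Real.rpow_add_of_nonneg hR h1a.le h1b.le]
        ring

lemma ae_coord_ne_zero : ∀ᵐ p : Plane, ∀ i, p i ≠ 0 := by
  refine ae_all_iff.2 fun i => ?_
  have h := (Measure.quasiMeasurePreserving_eval (fun _ : Fin 2 => (volume : Measure ℝ)) i).comp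
    (PiLp.volume_preserving_ofLp (Fin 2)).quasiMeasurePreserving
  exact h.ae (Measure.ae_ne volume 0)

/-- The set of momenta that are small relative to the cutoff, `|√R_τ p|² ≤ τ χ`. -/
def smallSet (τ χ : ℝ) : Set Plane := {p | ‖sqrtR τ p‖ ^ 2 ≤ τ * χ}

lemma measurableSet_smallSet (τ χ : ℝ) : MeasurableSet (smallSet τ χ) :=
  measurableSet_le (by have := continuous_sqrtR τ; fun_prop) measurable_const

/-- The weight `|√ν_τ p₁|^{-a} |p₂|^{-b}`. -/
noncomputable def singWeight (τ a b : ℝ) (p : Plane) : ℝ :=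
  |sqrtR τ p 0| ^ (-a) * |sqrtR τ p 1| ^ (-b)

lemma measurable_singWeight (τ a b : ℝ) : Measurable (singWeight τ a b) := by
  have h := (continuous_sqrtR τ).measurable
  have h0 : Measurable fun p => sqrtR τ p 0 := by fun_prop
  have h1 : Measurable fun p => sqrtR τ p 1 := by fun_prop
  unfold singWeight
  fun_prop

lemma measurable_ofReal_Theta {ρ : Plane → ℝ} (hρ : IsMollifier ρ) (τ : ℝ) :
    Measurable fun p => ENNReal.ofReal (Theta ρ τ p) :=
  (continuous_Theta hρ τ).measurable.ennreal_ofReal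

/-- A singular weight integrated over the small momenta. -/
lemma lintegral_small_le {ρ : Plane → ℝ} {B : ℝ}
    (hB : ∀ q, mollSq ρ q ≤ B) (hB1 : 1 ≤ B) {τ χ a b : ℝ} (hτ : 0 < τ) (hχ : 0 ≤ χ)
    (ha : a < 1) (hb : b < 1) :
    ∫⁻ p, ENNReal.ofReal (Theta ρ τ p) *
        Set.indicator (smallSet τ χ) (fun p => ENNReal.ofReal (singWeight τ a b p)) p
      ≤ ENNReal.ofReal (B * (2 / (1 - a)) * (2 / (1 - b)) * χ ^ ((2 - a - b) / 2) *
          τ ^ (-((a + b) / 2)) * massTheta τ) := by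
  have h1a : 0 < 1 - a := by linarith
  have h1b : 0 < 1 - b := by linarith
  have hsτ : 0 < Real.sqrt τ := Real.sqrt_pos.2 hτ
  set f : Plane → ℝ≥0∞ := fun q => ENNReal.ofReal (B * τ ^ (-((a + b) / 2))) *
    Set.indicator {q : Plane | ‖q‖ ≤ Real.sqrt χ}
      (fun q => ENNReal.ofReal (|q 0| ^ (-a) * |q 1| ^ (-b))) q with hf
  have hm : MeasurableSet {q : Plane | ‖q‖ ≤ Real.sqrt χ} :=
    measurableSet_le (by fun_prop) (by fun_prop)
  have hfm : Measurable f := ((by fun_prop : Measurable fun q : Plane =>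
    ENNReal.ofReal (|q 0| ^ (-a) * |q 1| ^ (-b))).indicator hm).const_mul _
  have hpt : ∀ p, ENNReal.ofReal (Theta ρ τ p) *
      Set.indicator (smallSet τ χ) (fun p => ENNReal.ofReal (singWeight τ a b p)) p
      ≤ f ((Real.sqrt τ)⁻¹ • sqrtR τ p) := by
    intro p
    by_cases hp : p ∈ smallSet τ χ
    · have hq : (Real.sqrt τ)⁻¹ • sqrtR τ p ∈ {q : Plane | ‖q‖ ≤ Real.sqrt χ} := by
        refine Real.le_sqrt_of_sq_le ?_
        rw [norm_rescale_sq hτ, inv_mul_le_iff₀ hτ]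
        exact hp
      simp only [hf]
      rw [Set.indicator_of_mem hp, Set.indicator_of_mem hq, Theta_eq_mollSq, mul_comm B,
        ENNReal.ofReal_mul (by positivity), mul_right_comm, mul_comm]
      refine mul_le_mul' (le_of_eq ?_) (ENNReal.ofReal_le_ofReal (hB _))
      rw [← ENNReal.ofReal_mul (by positivity)]
      congr 1
      have hs : ∀ c x : ℝ, |((Real.sqrt τ)⁻¹ * x)| ^ (-c) = τ ^ (c / 2) * |x| ^ (-c) := by
        intro c x
        rw [abs_mul, abs_of_pos (inv_pos.2 hsτ), Real.mul_rpow (inv_pos.2 hsτ).le (abs_nonneg _),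
          Real.inv_rpow hsτ.le, Real.rpow_neg hsτ.le, inv_inv, Real.sqrt_eq_rpow,
          ← Real.rpow_mul hτ.le]
        congr 2
        ring
      simp only [PiLp.smul_apply, smul_eq_mul, hs, singWeight]
      have : τ ^ (-((a + b) / 2)) * τ ^ (a / 2) * τ ^ (b / 2) = 1 := by
        rw [← Real.rpow_add hτ, ← Real.rpow_add hτ]
        ring_nf
        exact Real.rpow_zero _
      linear_combination (-(|sqrtR τ p 0| ^ (-a) * |sqrtR τ p 1| ^ (-b))) * this
    · rw [Set.indicator_of_notMem hp, mul_zero]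
      exact zero_le
  refine (lintegral_mono hpt).trans ?_
  rw [lintegral_rescale hτ f hfm, hf, lintegral_const_mul' _ _ ENNReal.ofReal_ne_top]
  refine (mul_le_mul' le_rfl (mul_le_mul' le_rfl
    (lintegral_disc_le ha hb (Real.sqrt_nonneg χ)))).trans ?_
  have hν := Real.sqrt_pos.2 (nu_pos τ)
  rw [← ENNReal.ofReal_mul (by positivity), ← ENNReal.ofReal_mul (by positivity)]
  refine ENNReal.ofReal_le_ofReal ?_
  have h4 : 1 ≤ 4 * Real.pi ^ 2 := by nlinarith [Real.pi_gt_three]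
  have hsq : Real.sqrt χ ^ (2 - a - b) = χ ^ ((2 - a - b) / 2) := by
    rw [Real.sqrt_eq_rpow, ← Real.rpow_mul hχ]
    congr 1
    ring
  rw [hsq, massTheta]
  have : 0 ≤ B * (2 / (1 - a)) * (2 / (1 - b)) * χ ^ ((2 - a - b) / 2) *
          τ ^ (-((a + b) / 2)) * (τ * (Real.sqrt (nu τ))⁻¹) := by positivity
  nlinarith

lemma mul_abs_le_norm_sq_half (τ : ℝ) (p : Plane) :
    |sqrtR τ p 0| * |sqrtR τ p 1| ≤ 1 / 2 * ‖sqrtR τ p‖ ^ 2 := by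
  rw [EuclideanSpace.norm_sq_eq, Fin.sum_univ_two, Real.norm_eq_abs, Real.norm_eq_abs]
  nlinarith [sq_nonneg (|sqrtR τ p 0| - |sqrtR τ p 1|)]

/-- The bounded weight `(1 + ½ |√R_τ p|²)^{-a}` is dominated by a singular weight. -/
lemma one_add_rpow_le_singWeight {τ a : ℝ} (ha : 0 ≤ a) {p : Plane} (hp : ∀ i, p i ≠ 0) :
    (1 + 1 / 2 * ‖sqrtR τ p‖ ^ 2) ^ (-a) ≤ singWeight τ a a p := by
  have h0 : sqrtR τ p 0 ≠ 0 := mul_ne_zero (Real.sqrt_pos.2 (nu_pos τ)).ne' (hp 0)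
  have h1 : sqrtR τ p 1 ≠ 0 := hp 1
  rw [singWeight, ← Real.mul_rpow (abs_nonneg _) (abs_nonneg _)]
  refine Real.rpow_le_rpow_of_nonpos (by positivity) ?_ (by linarith)
  linarith [mul_abs_le_norm_sq_half τ p]

/-- The weight `(1 + ½ |√R_τ p|²)^{-a}`, `0 ≤ a < 1`, integrates to `O(τ^{-a})` times the mass. -/
lemma lintegral_weight_le {ρ : Plane → ℝ} (hρ : IsMollifier ρ) {B : ℝ}
    (hB : ∀ q, mollSq ρ q ≤ B) (hB1 : 1 ≤ B) {τ a : ℝ} (hτ : 0 < τ) (ha0 : 0 ≤ a) (ha : a < 1) :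
    ∫⁻ p, ENNReal.ofReal (Theta ρ τ p) *
        ENNReal.ofReal ((1 + 1 / 2 * ‖sqrtR τ p‖ ^ 2) ^ (-a))
      ≤ ENNReal.ofReal ((B * (2 / (1 - a)) * (2 / (1 - a)) + 2) * τ ^ (-a) * massTheta τ) := by
  have h1a : 0 < 1 - a := by linarith
  have hM := massTheta_pos hτ
  have hmT := measurable_ofReal_Theta hρ τ
  calc ∫⁻ p, ENNReal.ofReal (Theta ρ τ p) *
        ENNReal.ofReal ((1 + 1 / 2 * ‖sqrtR τ p‖ ^ 2) ^ (-a))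
      ≤ ∫⁻ p, (ENNReal.ofReal (Theta ρ τ p) *
          Set.indicator (smallSet τ 1) (fun p => ENNReal.ofReal (singWeight τ a a p)) p +
          ENNReal.ofReal (Theta ρ τ p) * ENNReal.ofReal (2 * τ ^ (-a))) := by
        refine lintegral_mono_ae ?_
        filter_upwards [ae_coord_ne_zero] with p hp
        rw [← mul_add]
        refine mul_le_mul' le_rfl ?_
        by_cases hs : p ∈ smallSet τ 1
        · rw [Set.indicator_of_mem hs]
          exact le_add_right (ENNReal.ofReal_le_ofReal (one_add_rpow_le_singWeight ha0 hp))
        · refine le_add_left (ENNReal.ofReal_le_ofReal ?_)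
          have hs' : τ < ‖sqrtR τ p‖ ^ 2 := by
            simpa [smallSet] using hs
          calc (1 + 1 / 2 * ‖sqrtR τ p‖ ^ 2) ^ (-a) ≤ (1 / 2 * τ) ^ (-a) :=
                Real.rpow_le_rpow_of_nonpos (by positivity) (by linarith) (by linarith)
            _ = 2 ^ a * τ ^ (-a) := by
                rw [Real.mul_rpow (by norm_num) hτ.le, one_div, Real.inv_rpow (by norm_num),
                  Real.rpow_neg (by norm_num), inv_inv]
            _ ≤ 2 * τ ^ (-a) := by
                refine mul_le_mul_of_nonneg_right ?_ (by positivity)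
                calc (2 : ℝ) ^ a ≤ 2 ^ (1 : ℝ) :=
                      Real.rpow_le_rpow_of_exponent_le (by norm_num) ha.le
                  _ = 2 := Real.rpow_one 2
    _ ≤ ENNReal.ofReal (B * (2 / (1 - a)) * (2 / (1 - a)) * 1 ^ ((2 - a - a) / 2) *
          τ ^ (-((a + a) / 2)) * massTheta τ) +
          ENNReal.ofReal (massTheta τ) * ENNReal.ofReal (2 * τ ^ (-a)) := by
        rw [lintegral_add_right _ (hmT.mul_const _), lintegral_mul_const _ hmT,
          lintegral_Theta hρ hτ]
        gcongr
        exact lintegral_small_le hB hB1 hτ zero_le_one ha ha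
    _ = _ := by
        rw [← ENNReal.ofReal_mul hM.le, ← ENNReal.ofReal_add (by positivity) (by positivity)]
        congr 1
        rw [Real.one_rpow, show (a + a) / 2 = a by ring]
        ring

/-! ### Integration over configurations of momenta -/

lemma lintegral_pi_prod {j : ℕ} (f : Fin j → Plane → ℝ≥0∞) (hf : ∀ i, Measurable (f i)) :
    ∫⁻ r : Fin j → Plane, ∏ i, f i (r i) = ∏ i, ∫⁻ x, f i x := by
  induction j with
  | zero => simp [volume_pi]
  | succ j ih =>
    have h := ((volume_preserving_piFinSuccAbove (fun _ : Fin (j + 1) => Plane) 0).symm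
      ).lintegral_comp (f := fun r => ∏ i, f i (r i))
      (Finset.measurable_prod _ fun i _ => (hf i).comp (measurable_pi_apply i))
    rw [← h, Measure.volume_eq_prod, lintegral_prod]
    · have e : ∀ (x : Plane) (r : Fin j → Plane),
          ∏ i, f i ((MeasurableEquiv.piFinSuccAbove (fun _ : Fin (j + 1) => Plane) 0).symm
            (x, r) i) = f 0 x * ∏ i : Fin j, f i.succ (r i) := by
        intro x r
        rw [Fin.prod_univ_succ]
        rfl
      simp_rw [e]
      rw [Fin.prod_univ_succ, ← ih (fun i => f i.succ) fun i => hf _,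
        ← lintegral_mul_const _ (hf 0)]
      refine lintegral_congr fun x => ?_
      rw [lintegral_const_mul]
      exact Finset.measurable_prod _ fun i _ => (hf i.succ).comp (measurable_pi_apply i)
    · refine Measurable.aemeasurable ?_
      refine Finset.measurable_prod _ fun i _ => (hf i).comp ?_
      exact (measurable_pi_apply i).comp (MeasurableEquiv.measurable _)

@[simp] lemma closeSum_castSucc {j : ℕ} (s : Plane) (r : Fin j → Plane) (i : Fin j) :
    closeSum s r i.castSucc = r i := by
  simp [closeSum]

@[simp] lemma closeSum_last {j : ℕ} (s : Plane) (r : Fin j → Plane) :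
    closeSum s r (Fin.last j) = s - ∑ i, r i := by
  simp [closeSum]

@[simp] lemma sum_closeSum {j : ℕ} (s : Plane) (r : Fin j → Plane) :
    ∑ i, closeSum s r i = s := by
  rw [Fin.sum_univ_castSucc]
  simp

lemma continuous_closeSum (j : ℕ) :
    Continuous fun z : Plane × (Fin j → Plane) => closeSum z.1 z.2 := by
  refine continuous_pi fun i => ?_
  refine Fin.lastCases ?_ (fun i => ?_) i
  · simp only [closeSum_last]
    fun_prop
  · simp only [closeSum_castSucc]
    fun_prop

/-- Disintegration of the momenta `r_{1:j+1}` along their total momentum. -/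
lemma lintegral_closeSum {j : ℕ} (f : (Fin (j + 1) → Plane) → ℝ≥0∞) (hf : Measurable f) :
    ∫⁻ q, f q = ∫⁻ s : Plane, ∫⁻ r : Fin j → Plane, f (closeSum s r) := by
  have h := ((volume_preserving_piFinSuccAbove (fun _ : Fin (j + 1) => Plane)
    (Fin.last j)).symm).lintegral_comp hf
  have e : ∀ (x : Plane) (r : Fin j → Plane),
      (MeasurableEquiv.piFinSuccAbove (fun _ : Fin (j + 1) => Plane) (Fin.last j)).symm (x, r)
        = closeSum (x + ∑ i, r i) r := by
    intro x r
    have : (MeasurableEquiv.piFinSuccAbove (fun _ : Fin (j + 1) => Plane) (Fin.last j)).symm (x, r)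
        = Fin.snoc (α := fun _ => Plane) r x := Fin.insertNth_last' x r
    rw [this, closeSum, add_sub_cancel_right]
  have hm : Measurable fun z : Plane × (Fin j → Plane) => f (closeSum z.1 z.2) :=
    hf.comp (continuous_closeSum j).measurable
  rw [← h, Measure.volume_eq_prod,
    lintegral_prod_symm (fun a => f ((MeasurableEquiv.piFinSuccAbove
      (fun _ : Fin (j + 1) => Plane) (Fin.last j)).symm a))
      (hf.comp (MeasurableEquiv.measurable _)).aemeasurable]
  simp_rw [e]
  rw [lintegral_lintegral_swap (f := fun s r => f (closeSum s r)) hm.aemeasurable]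
  refine lintegral_congr fun r => ?_
  exact lintegral_add_right_eq_self (fun s => f (closeSum s r)) (∑ i, r i)

lemma continuous_sumElim {ι ι' κ : Type*} (E : ι ⊕ ι' ≃ κ) :
    Continuous fun z : (ι → Plane) × (ι' → Plane) => Sum.elim z.1 z.2 ∘ E.symm := by
  refine continuous_pi fun i => ?_
  rcases h : E.symm i with a | a
  · simp only [Function.comp, h, Sum.elim_inl]
    fun_prop
  · simp only [Function.comp, h, Sum.elim_inr]
    fun_prop

lemma lintegral_sumElim {ι ι' κ : Type*} [Fintype ι] [Fintype ι'] [Fintype κ] (E : ι ⊕ ι' ≃ κ)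
    (f : (κ → Plane) → ℝ≥0∞) (hf : Measurable f) :
    ∫⁻ p, f p = ∫⁻ y : ι' → Plane, ∫⁻ z : ι → Plane, f (Sum.elim z y ∘ E.symm) := by
  have h1 := (volume_measurePreserving_piCongrLeft (fun _ : κ => Plane) E).lintegral_comp hf
  have hf' := hf.comp (MeasurableEquiv.piCongrLeft (fun _ : κ => Plane) E).measurable
  have h2 := (volume_measurePreserving_sumPiEquivProdPi_symm
    (fun _ : ι ⊕ ι' => Plane)).lintegral_comp hf'
  rw [← h1]
  simp only [Function.comp_def] at h2
  rw [← h2, Measure.volume_eq_prod, lintegral_prod_symm]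
  · refine lintegral_congr fun y => lintegral_congr fun z => ?_
    congr 1
    funext i
    obtain ⟨a, rfl⟩ := E.surjective i
    have h3 : ∀ v : ι ⊕ ι' → Plane,
        (MeasurableEquiv.piCongrLeft (fun _ : κ => Plane) E) v (E a) = v a := fun v => by
      rw [MeasurableEquiv.coe_piCongrLeft]
      exact Equiv.piCongrLeft_apply_apply (fun _ : κ => Plane) E v a
    rw [h3]
    simp only [Function.comp, Equiv.symm_apply_apply]
    rcases a with a | a <;> rfl
  · exact (hf'.comp (MeasurableEquiv.measurable _)).aemeasurable

/-- The density `∏ᵢ Θ_τ(pᵢ)` of `Ξ_n^τ`. -/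
noncomputable def specDensity (ρ : Plane → ℝ) (τ : ℝ) {ι : Type*} [Fintype ι] (q : ι → Plane) :
    ℝ≥0∞ := ∏ i, ENNReal.ofReal (Theta ρ τ (q i))

lemma specDensity_eq_ofReal (ρ : Plane → ℝ) (τ : ℝ) {ι : Type*} [Fintype ι] (q : ι → Plane) :
    specDensity ρ τ q = ENNReal.ofReal (∏ i, Theta ρ τ (q i)) :=
  (ENNReal.ofReal_prod_of_nonneg fun i _ => Theta_nonneg ρ τ (q i)).symm

lemma measurable_specDensity {ρ : Plane → ℝ} (hρ : IsMollifier ρ) (τ : ℝ) {ι : Type*}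
    [Fintype ι] : Measurable fun q : ι → Plane => specDensity ρ τ q :=
  Finset.measurable_prod _ fun i _ => (measurable_ofReal_Theta hρ τ).comp (measurable_pi_apply i)

lemma lintegral_Xi {ρ : Plane → ℝ} (hρ : IsMollifier ρ) (τ : ℝ) (n : ℕ)
    (f : (Fin n → Plane) → ℝ≥0∞) :
    ∫⁻ p, f p ∂(Xi ρ τ n) = ∫⁻ p, specDensity ρ τ p * f p := by
  have h : (fun p : Fin n → Plane => ENNReal.ofReal (∏ i, Theta ρ τ (p i)))
      = fun p => specDensity ρ τ p := funext fun p => (specDensity_eq_ofReal ρ τ p).symm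
  rw [Xi, h, lintegral_withDensity_eq_lintegral_mul_non_measurable _
    (measurable_specDensity hρ τ) (Eventually.of_forall fun p => ?_)]
  · rfl
  · rw [specDensity_eq_ofReal]
    exact ENNReal.ofReal_lt_top

lemma specDensity_sumElim (ρ : Plane → ℝ) (τ : ℝ) {ι ι' κ : Type*} [Fintype ι] [Fintype ι']
    [Fintype κ] (E : ι ⊕ ι' ≃ κ) (z : ι → Plane) (y : ι' → Plane) :
    specDensity ρ τ (Sum.elim z y ∘ E.symm) = specDensity ρ τ z * specDensity ρ τ y := by
  unfold specDensity
  rw [← E.prod_comp, Fintype.prod_sum_type]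
  simp

/-- A product of one-particle functions integrated over the momenta with given total momentum. -/
lemma lintegral_fiber_le {ρ : Plane → ℝ} (hρ : IsMollifier ρ) {B : ℝ}
    (hB : ∀ q, mollSq ρ q ≤ B) {τ : ℝ} {j : ℕ} (f : Fin j → Plane → ℝ≥0∞)
    (hf : ∀ i, Measurable (f i)) (s : Plane) :
    ∫⁻ r : Fin j → Plane, specDensity ρ τ (closeSum s r) * ∏ i, f i (r i)
      ≤ ENNReal.ofReal B * ∏ i, ∫⁻ x, ENNReal.ofReal (Theta ρ τ x) * f i x := by
  have hT := measurable_ofReal_Theta hρ τ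
  rw [← lintegral_pi_prod (fun i x => ENNReal.ofReal (Theta ρ τ x) * f i x)
    fun i => hT.mul (hf i), ← lintegral_const_mul' _ _ ENNReal.ofReal_ne_top]
  refine lintegral_mono fun r => ?_
  simp only [specDensity, Fin.prod_univ_castSucc, closeSum_castSucc, closeSum_last,
    Finset.prod_mul_distrib]
  rw [mul_comm (∏ i, _) (ENNReal.ofReal _), mul_assoc]
  exact mul_le_mul' (ENNReal.ofReal_le_ofReal (hB _)) le_rfl

/-! ### The collision integral -/

/-- The collision integral `∫_{r_{[1:j+1]} = p_{[I]}} Ξ_{j+1}(dr) G(r, p_{Iᶜ})` of a nonnegative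
function `G`. -/
noncomputable def collInt (ρ : Plane → ℝ) (τ : ℝ) (j : ℕ) {n k : ℕ} (G : (Fin n → Plane) → ℝ≥0∞)
    (I : Finset (Fin k)) (p : Fin k → Plane) : ℝ≥0∞ :=
  ∫⁻ r : Fin j → Plane, specDensity ρ τ (closeSum (sumOn I p) r) *
    G (assemble n I (closeSum (sumOn I p) r) p)

/-- The splitting of the `k` output momenta into those of `I`, enumerated by `e`, and the
spectators, enumerated increasingly. -/
noncomputable def outEquiv {l k : ℕ} {I : Finset (Fin k)} (e : Fin l ≃ I) :
    Fin l ⊕ Fin Iᶜ.card ≃ Fin k :=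
  ((e.sumCongr (Iᶜ.orderIsoOfFin rfl).toEquiv).trans
    ((Equiv.refl _).sumCongr (Equiv.subtypeEquivRight fun x => by simp))).trans
    (Equiv.sumCompl (· ∈ I))

lemma outEquiv_inl {l k : ℕ} {I : Finset (Fin k)} (e : Fin l ≃ I) (i : Fin l) :
    outEquiv e (Sum.inl i) = e i := rfl

lemma outEquiv_inr {l k : ℕ} {I : Finset (Fin k)} (e : Fin l ≃ I) (i : Fin Iᶜ.card) :
    outEquiv e (Sum.inr i) = Iᶜ.orderEmbOfFin rfl i := rfl

/-- The splitting of the `n` input momenta into colliding ones and spectators. -/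
def inEquiv {j q n : ℕ} (h : j + 1 + q = n) : Fin (j + 1) ⊕ Fin q ≃ Fin n :=
  finSumFinEquiv.trans (finCongr h)

lemma assemble_eq {j k n : ℕ} {I : Finset (Fin k)} (h : j + 1 + Iᶜ.card = n)
    (r : Fin (j + 1) → Plane) (p : Fin k → Plane) :
    assemble n I r p
      = Sum.elim r (fun i => p (Iᶜ.orderEmbOfFin rfl i)) ∘ (inEquiv h).symm := by
  funext i
  obtain ⟨a, rfl⟩ := (inEquiv h).surjective i
  simp only [Function.comp, Equiv.symm_apply_apply]
  rcases a with a | a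
  · have : ((inEquiv h (Sum.inl a) : Fin n) : ℕ) = a := by simp [inEquiv]
    simp only [assemble, this, Sum.elim_inl]
    rw [dif_pos a.2]
  · have : ((inEquiv h (Sum.inr a) : Fin n) : ℕ) = j + 1 + a := by simp [inEquiv]
    simp only [assemble, this, Sum.elim_inr]
    rw [dif_neg (by omega), dif_pos (by omega)]
    congr 2
    exact Fin.ext (by simp)

lemma sumOn_sumElim {l k : ℕ} {I : Finset (Fin k)} (e : Fin l ≃ I) (z : Fin l → Plane)
    (y : Fin Iᶜ.card → Plane) : sumOn I (Sum.elim z y ∘ (outEquiv e).symm) = ∑ i, z i := by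
  rw [sumOn, ← Finset.sum_coe_sort, ← e.sum_comp]
  refine Finset.sum_congr rfl fun i _ => ?_
  rw [← outEquiv_inl e i]
  simp

lemma continuous_sumOn {k : ℕ} (I : Finset (Fin k)) : Continuous fun p => sumOn I p := by
  unfold sumOn
  fun_prop

lemma continuous_assemble (n : ℕ) {j k : ℕ} (I : Finset (Fin k)) :
    Continuous fun z : (Fin k → Plane) × (Fin (j + 1) → Plane) => assemble n I z.2 z.1 := by
  refine continuous_pi fun i => ?_
  unfold assemble
  split_ifs <;> fun_prop

lemma continuous_collision (n j : ℕ) {k : ℕ} (I : Finset (Fin k)) :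
    Continuous fun z : (Fin k → Plane) × (Fin j → Plane) =>
      assemble n I (closeSum (sumOn I z.1) z.2) z.1 := by
  have h1 : Continuous fun z : (Fin k → Plane) × (Fin j → Plane) => closeSum (sumOn I z.1) z.2 :=
    (continuous_closeSum j).comp (((continuous_sumOn I).comp continuous_fst).prodMk continuous_snd)
  exact (continuous_assemble n I).comp (continuous_fst.prodMk h1)

lemma measurable_collInt {ρ : Plane → ℝ} (hρ : IsMollifier ρ) (τ : ℝ) (j : ℕ) {n k : ℕ}
    {G : (Fin n → Plane) → ℝ≥0∞} (hG : Measurable G) (I : Finset (Fin k)) :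
    Measurable (collInt ρ τ j G I) := by
  refine Measurable.lintegral_prod_right' (f := fun z : (Fin k → Plane) × (Fin j → Plane) =>
    specDensity ρ τ (closeSum (sumOn I z.1) z.2) *
    G (assemble n I (closeSum (sumOn I z.1) z.2) z.1)) ?_
  refine Measurable.mul ?_ (hG.comp (continuous_collision n j I).measurable)
  refine (measurable_specDensity hρ τ).comp ?_
  exact ((continuous_closeSum j).comp
    (((continuous_sumOn I).comp continuous_fst).prodMk continuous_snd)).measurable

/-- Integrating the collision integral over the output momenta amounts to integrating over the
input momenta, once the fibres `{p_I : p_{[I]} = s}` are integrated out. -/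
lemma lintegral_collInt_le {ρ : Plane → ℝ} (hρ : IsMollifier ρ) (τ : ℝ) {j n k l : ℕ}
    {I : Finset (Fin k)} (h : j + 1 + Iᶜ.card = n) (e : Fin (l + 1) ≃ I)
    {V : (Fin (l + 1) → Plane) → ℝ≥0∞} (hV : Measurable V) {g : (Fin n → Plane) → ℝ≥0∞}
    (hg : Measurable g) {D : ℝ≥0∞}
    (hD : ∀ s, ∫⁻ r : Fin l → Plane, specDensity ρ τ (closeSum s r) * V (closeSum s r) ≤ D) :
    ∫⁻ p, V (fun i => p (e i)) * collInt ρ τ j g I p ∂(Xi ρ τ k) ≤ D * ∫⁻ x, g x ∂(Xi ρ τ n) := by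
  have hS {a : ℕ} : Measurable fun q : Fin a → Plane => specDensity ρ τ q :=
    measurable_specDensity hρ τ
  set Q : Plane → (Fin Iᶜ.card → Plane) → ℝ≥0∞ := fun s y => ∫⁻ r : Fin j → Plane,
    specDensity ρ τ (closeSum s r) * g (Sum.elim (closeSum s r) y ∘ (inEquiv h).symm) with hQ
  have hQm : ∀ y, Measurable fun s => Q s y := by
    intro y
    refine Measurable.lintegral_prod_right' (f := fun z : Plane × (Fin j → Plane) =>
      specDensity ρ τ (closeSum z.1 z.2) *
        g (Sum.elim (closeSum z.1 z.2) y ∘ (inEquiv h).symm)) ?_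
    refine (hS.comp (continuous_closeSum j).measurable).mul (hg.comp ?_)
    exact ((continuous_sumElim (inEquiv h)).comp
      ((continuous_closeSum j).prodMk continuous_const)).measurable
  have hcoll : ∀ (z : Fin (l + 1) → Plane) (y : Fin Iᶜ.card → Plane),
      collInt ρ τ j g I (Sum.elim z y ∘ (outEquiv e).symm) = Q (∑ i, z i) y := by
    intro z y
    simp only [collInt, sumOn_sumElim, hQ]
    refine lintegral_congr fun r => ?_
    rw [assemble_eq h]
    congr 4
    funext i
    rw [← outEquiv_inr e i]
    simp
  have hVe : ∀ (z : Fin (l + 1) → Plane) (y : Fin Iᶜ.card → Plane),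
      (fun i => (Sum.elim z y ∘ (outEquiv e).symm) (e i)) = z := by
    intro z y
    funext i
    rw [← outEquiv_inl e i]
    simp
  have hVm : Measurable fun p : Fin k → Plane => V (fun i => p (e i)) :=
    hV.comp (measurable_pi_lambda _ fun i => measurable_pi_apply _)
  rw [lintegral_Xi hρ, lintegral_Xi hρ, lintegral_sumElim (outEquiv e)
    (fun p => specDensity ρ τ p * (V (fun i => p (e i)) * collInt ρ τ j g I p))
    (hS.mul (hVm.mul (measurable_collInt hρ τ j hg I))),
    lintegral_sumElim (inEquiv h) (fun x => specDensity ρ τ x * g x) (hS.mul hg),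
    ← lintegral_const_mul]
  swap
  · refine Measurable.lintegral_prod_right' (f := fun z : (Fin Iᶜ.card → Plane) ×
      (Fin (j + 1) → Plane) => specDensity ρ τ (Sum.elim z.2 z.1 ∘ (inEquiv h).symm) *
      g (Sum.elim z.2 z.1 ∘ (inEquiv h).symm)) ?_
    exact (hS.mul hg).comp ((continuous_sumElim (inEquiv h)).comp
      (continuous_snd.prodMk continuous_fst)).measurable
  refine lintegral_mono fun y => ?_
  simp only [specDensity_sumElim, hcoll, hVe]
  have hz : Measurable fun z : Fin (l + 1) → Plane =>
      specDensity ρ τ z * specDensity ρ τ y * (V z * Q (∑ i, z i) y) := by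
    refine (hS.mul_const _).mul (hV.mul ((hQm y).comp ?_))
    exact Finset.measurable_sum _ fun i _ => measurable_pi_apply i
  have hx : Measurable fun x : Fin (j + 1) → Plane =>
      specDensity ρ τ x * specDensity ρ τ y * g (Sum.elim x y ∘ (inEquiv h).symm) := by
    refine (hS.mul_const _).mul (hg.comp ?_)
    exact ((continuous_sumElim (inEquiv h)).comp
      (continuous_id.prodMk continuous_const)).measurable
  rw [lintegral_closeSum _ hz, lintegral_closeSum _ hx, ← lintegral_const_mul]
  swap
  · exact (hx.comp (continuous_closeSum j).measurable).lintegral_prod_right'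
  refine lintegral_mono fun s => ?_
  simp only [sum_closeSum]
  have hVc : Measurable fun r : Fin l → Plane =>
      specDensity ρ τ (closeSum s r) * V (closeSum s r) :=
    (hS.mul hV).comp ((continuous_closeSum l).comp
      (continuous_const.prodMk continuous_id)).measurable
  have hgc : Measurable fun r : Fin j → Plane => specDensity ρ τ (closeSum s r) *
      g (Sum.elim (closeSum s r) y ∘ (inEquiv h).symm) := by
    have h2 : Continuous fun r : Fin j → Plane => closeSum s r :=
      (continuous_closeSum j).comp (continuous_const.prodMk continuous_id)
    exact (hS.comp h2.measurable).mul
      (hg.comp ((continuous_sumElim (inEquiv h)).comp (h2.prodMk continuous_const)).measurable)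
  calc ∫⁻ r : Fin l → Plane, specDensity ρ τ (closeSum s r) * specDensity ρ τ y *
        (V (closeSum s r) * Q s y)
      = (∫⁻ r : Fin l → Plane, specDensity ρ τ (closeSum s r) * V (closeSum s r)) *
          (specDensity ρ τ y * Q s y) := by
        rw [← lintegral_mul_const _ hVc]
        refine lintegral_congr fun r => ?_
        ring
    _ ≤ D * (specDensity ρ τ y * Q s y) := mul_le_mul' (hD s) le_rfl
    _ = D * ∫⁻ r : Fin j → Plane, specDensity ρ τ (closeSum s r) * specDensity ρ τ y *
          g (Sum.elim (closeSum s r) y ∘ (inEquiv h).symm) := by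
        rw [hQ, ← lintegral_const_mul _ hgc]
        congr 1
        refine lintegral_congr fun r => ?_
        ring

/-- The Cauchy–Schwarz inequality in the form `(∫ f)² ≤ ∫ a ∫ b` for `f² ≤ a b`. -/
lemma sq_lintegral_le {X : Type*} [MeasurableSpace X] {μ : Measure X} {f a b : X → ℝ≥0∞}
    (ha : Measurable a) (hb : Measurable b) (h : ∀ x, f x ^ 2 ≤ a x * b x) :
    (∫⁻ x, f x ∂μ) ^ 2 ≤ (∫⁻ x, a x ∂μ) * ∫⁻ x, b x ∂μ := by
  have hpt : ∀ x, f x ≤ a x ^ (1 / 2 : ℝ) * b x ^ (1 / 2 : ℝ) := by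
    intro x
    rw [← ENNReal.mul_rpow_of_nonneg _ _ (by norm_num)]
    calc f x = (f x ^ 2) ^ (1 / 2 : ℝ) := by
          rw [← ENNReal.rpow_natCast, ← ENNReal.rpow_mul]
          norm_num
      _ ≤ _ := ENNReal.rpow_le_rpow (h x) (by norm_num)
  have hH := ENNReal.lintegral_mul_le_Lp_mul_Lq μ Real.HolderConjugate.two_two
    (ha.pow_const (1 / 2 : ℝ)).aemeasurable (hb.pow_const (1 / 2 : ℝ)).aemeasurable
  have hs : ∀ c : ℝ≥0∞, (c ^ (1 / 2 : ℝ)) ^ (2 : ℝ) = c := fun c => by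
    rw [← ENNReal.rpow_mul]
    norm_num
  simp only [hs] at hH
  calc (∫⁻ x, f x ∂μ) ^ 2
      ≤ ((∫⁻ x, a x ∂μ) ^ (1 / 2 : ℝ) * (∫⁻ x, b x ∂μ) ^ (1 / 2 : ℝ)) ^ 2 :=
        pow_le_pow_left' ((lintegral_mono hpt).trans hH) 2
    _ = _ := by
        rw [mul_pow, ← ENNReal.rpow_natCast, ← ENNReal.rpow_natCast]
        simp only [Nat.cast_ofNat, hs]

/-- The weighted `L²` estimate for the collision integral: the weight `V` is integrated over the
output momenta `p_I`, the weight `u` over the input momenta `r_{1:j+1}`, both at fixed total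
momentum, and `Y` is a function of the total momentum, common to both. -/
lemma lintegral_collInt_sq_le {ρ : Plane → ℝ} (hρ : IsMollifier ρ) (τ : ℝ) {j n k l : ℕ}
    {I : Finset (Fin k)} (h : j + 1 + Iᶜ.card = n) (e : Fin (l + 1) ≃ I)
    {V : (Fin (l + 1) → Plane) → ℝ≥0∞} (hV : Measurable V) {G H : (Fin n → Plane) → ℝ≥0∞}
    (hH : Measurable H) {u : (Fin (j + 1) → Plane) → ℝ≥0∞} (hu : Measurable u)
    {Y : Plane → ℝ≥0∞} (hY : Measurable Y)
    (hG : ∀ x, G x ^ 2 ≤ u (fun i => x (inEquiv h (Sum.inl i))) * H x) {A D : ℝ≥0∞}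
    (hA : ∀ s, ∫⁻ r : Fin j → Plane, specDensity ρ τ (closeSum s r) * u (closeSum s r) ≤ A)
    (hD : ∀ s, ∫⁻ r : Fin l → Plane, specDensity ρ τ (closeSum s r) * V (closeSum s r) ≤ D) :
    ∫⁻ p, V (fun i => p (e i)) * (Y (sumOn I p) * collInt ρ τ j G I p ^ 2) ∂(Xi ρ τ k)
      ≤ A * D * ∫⁻ x, Y (∑ i, x (inEquiv h (Sum.inl i))) * H x ∂(Xi ρ τ n) := by
  have hS {a : ℕ} : Measurable fun q : Fin a → Plane => specDensity ρ τ q :=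
    measurable_specDensity hρ τ
  have hgm : Measurable fun x : Fin n → Plane => A * (Y (∑ i, x (inEquiv h (Sum.inl i))) * H x) := by
    refine ((hY.comp ?_).mul hH).const_mul _
    exact Finset.measurable_sum _ fun i _ => measurable_pi_apply _
  have hpt : ∀ p, Y (sumOn I p) * collInt ρ τ j G I p ^ 2
      ≤ collInt ρ τ j (fun x => A * (Y (∑ i, x (inEquiv h (Sum.inl i))) * H x)) I p := by
    intro p
    have hc : Measurable fun r : Fin j → Plane => closeSum (sumOn I p) r :=
      ((continuous_closeSum j).comp (continuous_const.prodMk continuous_id)).measurable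
    have hHm : Measurable fun r : Fin j → Plane =>
        specDensity ρ τ (closeSum (sumOn I p) r) * H (assemble n I (closeSum (sumOn I p) r) p) :=
      (hS.comp hc).mul (hH.comp ((continuous_collision n j I).comp
        (continuous_const.prodMk continuous_id)).measurable)
    have hin : ∀ r : Fin j → Plane, (fun i => assemble n I (closeSum (sumOn I p) r) p
        (inEquiv h (Sum.inl i))) = closeSum (sumOn I p) r := by
      intro r
      funext i
      rw [assemble_eq h]
      simp
    have hCS := sq_lintegral_le (μ := volume) ((hS.mul hu).comp hc) hHm
      (f := fun r => specDensity ρ τ (closeSum (sumOn I p) r) *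
        G (assemble n I (closeSum (sumOn I p) r) p)) (fun r => by
        have := hG (assemble n I (closeSum (sumOn I p) r) p)
        rw [hin] at this
        simp only [Function.comp, Pi.mul_apply]
        calc _ = specDensity ρ τ (closeSum (sumOn I p) r) ^ 2 *
              G (assemble n I (closeSum (sumOn I p) r) p) ^ 2 := by rw [mul_pow]
          _ ≤ specDensity ρ τ (closeSum (sumOn I p) r) ^ 2 * _ := mul_le_mul' le_rfl this
          _ = _ := by ring)
    have hin' : ∀ r : Fin j → Plane, ∑ i, assemble n I (closeSum (sumOn I p) r) p
        (inEquiv h (Sum.inl i)) = sumOn I p := by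
      intro r
      rw [show ∑ i, assemble n I (closeSum (sumOn I p) r) p (inEquiv h (Sum.inl i))
        = ∑ i, closeSum (sumOn I p) r i from Finset.sum_congr rfl fun i _ => congrFun (hin r) i]
      simp
    calc Y (sumOn I p) * collInt ρ τ j G I p ^ 2
        ≤ Y (sumOn I p) * (A * ∫⁻ r : Fin j → Plane, specDensity ρ τ (closeSum (sumOn I p) r) *
            H (assemble n I (closeSum (sumOn I p) r) p)) :=
          mul_le_mul' le_rfl (hCS.trans (mul_le_mul' (hA _) le_rfl))
      _ = _ := by
          rw [collInt, ← mul_assoc, ← lintegral_const_mul _ hHm]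
          refine lintegral_congr fun r => ?_
          rw [hin']
          ring
  calc ∫⁻ p, V (fun i => p (e i)) * (Y (sumOn I p) * collInt ρ τ j G I p ^ 2) ∂(Xi ρ τ k)
      ≤ ∫⁻ p, V (fun i => p (e i)) *
          collInt ρ τ j (fun x => A * (Y (∑ i, x (inEquiv h (Sum.inl i))) * H x)) I p
            ∂(Xi ρ τ k) := lintegral_mono fun p => mul_le_mul' le_rfl (hpt p)
    _ ≤ D * ∫⁻ x, A * (Y (∑ i, x (inEquiv h (Sum.inl i))) * H x) ∂(Xi ρ τ n) :=
        lintegral_collInt_le hρ τ h e hV hgm hD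
    _ = _ := by
        rw [lintegral_const_mul]
        · ring
        · refine (hY.comp ?_).mul hH
          exact Finset.measurable_sum _ fun i _ => measurable_pi_apply _

/-! ### One-particle constants and fibre integrals -/

/-- The weight `(1 + ½ |√R_τ p|²)^{-a}`. -/
noncomputable def decay (τ a : ℝ) (p : Plane) : ℝ := (1 + 1 / 2 * ‖sqrtR τ p‖ ^ 2) ^ (-a)

lemma measurable_decay (τ a : ℝ) : Measurable (decay τ a) := by
  have h := (continuous_sqrtR τ).measurable
  unfold decay
  fun_prop

lemma decay_nonneg (τ a : ℝ) (p : Plane) : 0 ≤ decay τ a p :=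
  Real.rpow_nonneg (by positivity) _

/-- A constant `K` that serves in all the one-particle integrals of the argument, for the
interpolation exponent `α`. -/
structure OneParticleBound (ρ : Plane → ℝ) (α K : ℝ) : Prop where
  one_le : 1 ≤ K
  mollSq_le : ∀ q, mollSq ρ q ≤ K
  small : ∀ τ χ : ℝ, 0 < τ → 0 ≤ χ →
    ∫⁻ p, ENNReal.ofReal (Theta ρ τ p) * Set.indicator (smallSet τ χ) 1 p
      ≤ ENNReal.ofReal (K * χ * massTheta τ)
  weight : ∀ τ a : ℝ, 0 < τ → (a = 1 / 2 ∨ a = α ∨ a = 1 - α) →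
    ∫⁻ p, ENNReal.ofReal (Theta ρ τ p) * ENNReal.ofReal (decay τ a p)
      ≤ ENNReal.ofReal (K * τ ^ (-a) * massTheta τ)
  small_weight : ∀ τ χ : ℝ, 0 < τ → 0 ≤ χ →
    ∫⁻ p, ENNReal.ofReal (Theta ρ τ p) *
        Set.indicator (smallSet τ χ) (fun p => ENNReal.ofReal (decay τ (1 / 2) p)) p
      ≤ ENNReal.ofReal (K * χ ^ (1 / 2 : ℝ) * τ ^ (-(1 / 2) : ℝ) * massTheta τ)
  small_sing : ∀ τ χ : ℝ, 0 < τ → 0 ≤ χ →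
    ∫⁻ p, ENNReal.ofReal (Theta ρ τ p) *
        Set.indicator (smallSet τ χ) (fun p => ENNReal.ofReal (singWeight τ α (1 - α) p)) p
      ≤ ENNReal.ofReal (K * χ ^ (1 / 2 : ℝ) * τ ^ (-(1 / 2) : ℝ) * massTheta τ)

lemma exists_oneParticleBound {ρ : Plane → ℝ} (hρ : IsMollifier ρ) {α : ℝ} (h0 : 0 < α)
    (h1 : α < 1) : ∃ K, OneParticleBound ρ α K := by
  obtain ⟨B, hB1, hB⟩ := hρ.exists_mollSq_le
  set c : ℝ → ℝ → ℝ := fun a b => B * (2 / (1 - a)) * (2 / (1 - b)) with hc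
  have hcpos : ∀ a b : ℝ, a < 1 → b < 1 → 0 ≤ c a b := by
    intro a b ha hb
    have : 0 < 1 - a := by linarith
    have : 0 < 1 - b := by linarith
    positivity
  have c0 := hcpos 0 0 (by norm_num) (by norm_num)
  have c1 := hcpos (1 / 2) (1 / 2) (by norm_num) (by norm_num)
  have c2 := hcpos α α h1 h1
  have c3 := hcpos (1 - α) (1 - α) (by linarith) (by linarith)
  have c4 := hcpos α (1 - α) h1 (by linarith)
  set K := B + 2 + c 0 0 + c (1 / 2) (1 / 2) + c α α + c (1 - α) (1 - α) + c α (1 - α) with hK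
  refine ⟨K, by linarith, fun q => (hB q).trans (by linarith), ?_, ?_, ?_, ?_⟩
  · intro τ χ hτ hχ
    have hM := massTheta_pos hτ
    have h := lintegral_small_le (a := 0) (b := 0) hB hB1 hτ hχ (by norm_num) (by norm_num)
    simp only [singWeight, neg_zero, Real.rpow_zero, mul_one, ENNReal.ofReal_one, add_zero,
      zero_div, sub_zero] at h
    refine h.trans (ENNReal.ofReal_le_ofReal ?_)
    rw [div_self two_ne_zero, Real.rpow_one]
    have : c 0 0 ≤ K := by linarith
    simp only [hc, sub_zero] at this
    gcongr
  · intro τ a hτ ha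
    have hM := massTheta_pos hτ
    have ha0 : 0 ≤ a := by rcases ha with h | h | h <;> linarith
    have ha1 : a < 1 := by rcases ha with h | h | h <;> linarith
    refine (lintegral_weight_le hρ hB hB1 hτ ha0 ha1).trans (ENNReal.ofReal_le_ofReal ?_)
    have : c a a + 2 ≤ K := by rcases ha with h | h | h <;> rw [h] <;> linarith
    simp only [hc] at this
    gcongr
  · intro τ χ hτ hχ
    have hM := massTheta_pos hτ
    have h := lintegral_small_le (a := 1 / 2) (b := 1 / 2) hB hB1 hτ hχ (by norm_num) (by norm_num)
    refine (lintegral_mono_ae ?_).trans (h.trans (ENNReal.ofReal_le_ofReal ?_))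
    · filter_upwards [ae_coord_ne_zero] with p hp
      refine mul_le_mul' le_rfl ?_
      by_cases hs : p ∈ smallSet τ χ
      · rw [Set.indicator_of_mem hs, Set.indicator_of_mem hs]
        exact ENNReal.ofReal_le_ofReal (one_add_rpow_le_singWeight (by norm_num) hp)
      · rw [Set.indicator_of_notMem hs]
        exact zero_le
    · have : c (1 / 2) (1 / 2) ≤ K := by linarith
      simp only [hc] at this
      rw [show (2 - 1 / 2 - 1 / 2 : ℝ) / 2 = 1 / 2 by norm_num,
        show ((1 / 2 + 1 / 2 : ℝ) / 2) = 1 / 2 by norm_num]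
      gcongr
  · intro τ χ hτ hχ
    have hM := massTheta_pos hτ
    have h := lintegral_small_le (a := α) (b := 1 - α) hB hB1 hτ hχ h1 (by linarith)
    refine h.trans (ENNReal.ofReal_le_ofReal ?_)
    have : c α (1 - α) ≤ K := by linarith
    simp only [hc] at this
    rw [show (2 - α - (1 - α) : ℝ) / 2 = 1 / 2 by ring,
      show ((α + (1 - α) : ℝ) / 2) = 1 / 2 by ring]
    gcongr

lemma lintegral_fiber_zero {ρ : Plane → ℝ} (hρ : IsMollifier ρ) {B : ℝ}
    (hB : ∀ q, mollSq ρ q ≤ B) {τ : ℝ} (hτ : 0 < τ) (j : ℕ) (s : Plane) :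
    ∫⁻ r : Fin j → Plane, specDensity ρ τ (closeSum s r)
      ≤ ENNReal.ofReal (B * massTheta τ ^ j) := by
  have h := lintegral_fiber_le hρ hB (τ := τ) (fun (_ : Fin j) _ => (1 : ℝ≥0∞))
    (fun _ => measurable_const) s
  simp only [Finset.prod_const_one, mul_one, lintegral_Theta hρ hτ, Finset.prod_const,
    Finset.card_univ, Fintype.card_fin] at h
  refine h.trans (le_of_eq ?_)
  have hM := massTheta_pos hτ
  rw [← ENNReal.ofReal_pow hM.le, ← ENNReal.ofReal_mul' (by positivity)]

lemma lintegral_fiber_one {ρ : Plane → ℝ} (hρ : IsMollifier ρ) {B : ℝ}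
    (hB : ∀ q, mollSq ρ q ≤ B) {τ : ℝ} (hτ : 0 < τ) (j : ℕ) {f : Plane → ℝ≥0∞} (hf : Measurable f)
    {a : ℝ} (ha : ∫⁻ p, ENNReal.ofReal (Theta ρ τ p) * f p ≤ ENNReal.ofReal a) (s : Plane) :
    ∫⁻ r : Fin (j + 1) → Plane, specDensity ρ τ (closeSum s r) * f (closeSum s r 0)
      ≤ ENNReal.ofReal (B * a * massTheta τ ^ j) := by
  have hM := massTheta_pos hτ
  have hB0 : 0 ≤ B := (mollSq_nonneg ρ 0).trans (hB 0)
  have h := lintegral_fiber_le hρ hB (τ := τ)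
    (Fin.cons f fun (_ : Fin j) _ => (1 : ℝ≥0∞) : Fin (j + 1) → Plane → ℝ≥0∞)
    (fun i => Fin.cases hf (fun _ => measurable_const) i) s
  simp only [Fin.prod_univ_succ, Fin.cons_zero, Fin.cons_succ, Finset.prod_const_one, mul_one,
    lintegral_Theta hρ hτ, Finset.prod_const, Finset.card_univ, Fintype.card_fin] at h
  have e : ∀ r : Fin (j + 1) → Plane, closeSum s r 0 = r 0 := fun r => closeSum_castSucc s r 0
  simp only [e]
  refine h.trans ?_
  rw [mul_assoc, ENNReal.ofReal_mul hB0, ENNReal.ofReal_mul' (by positivity),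
    ENNReal.ofReal_pow hM.le]
  gcongr

lemma lintegral_fiber_two {ρ : Plane → ℝ} (hρ : IsMollifier ρ) {B : ℝ}
    (hB : ∀ q, mollSq ρ q ≤ B) {τ : ℝ} (hτ : 0 < τ) (j : ℕ) {f g : Plane → ℝ≥0∞}
    (hf : Measurable f) (hg : Measurable g)
    {a b : ℝ} (ha0 : 0 ≤ a) (ha : ∫⁻ p, ENNReal.ofReal (Theta ρ τ p) * f p ≤ ENNReal.ofReal a)
    (hb : ∫⁻ p, ENNReal.ofReal (Theta ρ τ p) * g p ≤ ENNReal.ofReal b) (s : Plane) :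
    ∫⁻ r : Fin (j + 2) → Plane, specDensity ρ τ (closeSum s r) *
        (f (closeSum s r 0) * g (closeSum s r 1))
      ≤ ENNReal.ofReal (B * (a * b) * massTheta τ ^ j) := by
  have hM := massTheta_pos hτ
  have hB0 : 0 ≤ B := (mollSq_nonneg ρ 0).trans (hB 0)
  have h := lintegral_fiber_le hρ hB (τ := τ)
    (Fin.cons f (Fin.cons g fun (_ : Fin j) _ => (1 : ℝ≥0∞)) : Fin (j + 2) → Plane → ℝ≥0∞)
    (fun i => Fin.cases hf (fun i => Fin.cases hg (fun _ => measurable_const) i) i) s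
  simp only [Fin.prod_univ_succ, Fin.cons_zero, Fin.cons_succ, Finset.prod_const_one, mul_one,
    lintegral_Theta hρ hτ, Finset.prod_const, Finset.card_univ, Fintype.card_fin] at h
  have e : ∀ r : Fin (j + 2) → Plane, closeSum s r 0 = r 0 := fun r => closeSum_castSucc s r 0
  have e' : ∀ r : Fin (j + 2) → Plane, closeSum s r 1 = r 1 := fun r => closeSum_castSucc s r 1
  simp only [e, e']
  refine h.trans ?_
  rw [mul_assoc, mul_assoc, ENNReal.ofReal_mul hB0, ENNReal.ofReal_mul ha0,
    ENNReal.ofReal_mul' (by positivity), ENNReal.ofReal_pow hM.le]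
  gcongr

/-! ### The estimate for a fixed set of output momenta -/

/-- The interpolated energy density `(½ ν_τ |𝔢₁ · x|²)^α (1 + ½ |√R_τ x|²)^{1-α}`. -/
noncomputable def interpWeight (τ α : ℝ) {n : ℕ} (x : Fin n → Plane) : ℝ :=
  (1 / 2 * (nu τ * dirSq 0 x)) ^ α * (1 + 1 / 2 * anisoSq τ x) ^ (1 - α)

/-- Configurations with all momenta small relative to the cutoff, and no vanishing coordinate. -/
def goodSet (τ χ : ℝ) (n : ℕ) : Set (Fin n → Plane) :=
  {x | anisoSq τ x ≤ τ * χ ∧ ∀ i c, x i c ≠ 0}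

lemma dirSq_nonneg (c : Fin 2) {n : ℕ} (x : Fin n → Plane) : 0 ≤ dirSq c x :=
  Finset.sum_nonneg fun _ _ => sq_nonneg _

lemma anisoSq_nonneg (τ : ℝ) {n : ℕ} (x : Fin n → Plane) : 0 ≤ anisoSq τ x :=
  Finset.sum_nonneg fun _ _ => sq_nonneg _

lemma norm_sq_le_anisoSq (τ : ℝ) {n : ℕ} (x : Fin n → Plane) (i : Fin n) :
    ‖sqrtR τ (x i)‖ ^ 2 ≤ anisoSq τ x :=
  Finset.single_le_sum (f := fun l => ‖sqrtR τ (x l)‖ ^ 2) (fun _ _ => sq_nonneg _)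
    (Finset.mem_univ i)

lemma nu_mul_dirSq_le (τ : ℝ) {n : ℕ} (x : Fin n → Plane) : nu τ * dirSq 0 x ≤ anisoSq τ x := by
  rw [dirSq, anisoSq, Finset.mul_sum]
  refine Finset.sum_le_sum fun i _ => ?_
  rw [norm_sqrtR_sq]
  linarith [sq_nonneg (x i 1)]

lemma measurable_anisoSq (τ : ℝ) (n : ℕ) : Measurable fun x : Fin n → Plane => anisoSq τ x := by
  have h := (continuous_sqrtR τ).measurable
  unfold anisoSq
  fun_prop

lemma measurable_dirSq (c : Fin 2) (n : ℕ) : Measurable fun x : Fin n → Plane => dirSq c x := by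
  unfold dirSq
  fun_prop

lemma measurable_interpWeight (τ α : ℝ) (n : ℕ) :
    Measurable fun x : Fin n → Plane => interpWeight τ α x := by
  have h1 := measurable_anisoSq τ n
  have h2 := measurable_dirSq 0 n
  unfold interpWeight
  fun_prop

lemma half_dirSq_le_interpWeight {τ α : ℝ} (h1 : α ≤ 1) {n : ℕ} (x : Fin n → Plane) :
    1 / 2 * (nu τ * dirSq 0 x) ≤ interpWeight τ α x := by
  have hd : 0 ≤ 1 / 2 * (nu τ * dirSq 0 x) := by
    have := dirSq_nonneg 0 x; have := nu_pos τ; positivity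
  have hle : 1 / 2 * (nu τ * dirSq 0 x) ≤ 1 + 1 / 2 * anisoSq τ x := by
    linarith [nu_mul_dirSq_le τ x]
  calc 1 / 2 * (nu τ * dirSq 0 x)
      = (1 / 2 * (nu τ * dirSq 0 x)) ^ α * (1 / 2 * (nu τ * dirSq 0 x)) ^ (1 - α) := by
        rw [← Real.rpow_add' hd (by norm_num)]
        norm_num
    _ ≤ _ := by
        unfold interpWeight
        gcongr

lemma sq_sum_le_dirSq {j n q : ℕ} (h : j + 1 + q = n) (c : Fin 2) (x : Fin n → Plane) :
    (∑ i, x (inEquiv h (Sum.inl i))) c ^ 2 ≤ (j + 1) * dirSq c x := by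
  have e : (∑ i, x (inEquiv h (Sum.inl i))) c = ∑ i, x (inEquiv h (Sum.inl i)) c := by
    simp [Finset.sum_apply]
  have h1 := sq_sum_le_card_mul_sum_sq (s := Finset.univ)
    (f := fun i : Fin (j + 1) => x (inEquiv h (Sum.inl i)) c)
  rw [Finset.card_univ, Fintype.card_fin] at h1
  push_cast at h1
  rw [e]
  refine h1.trans (mul_le_mul_of_nonneg_left ?_ (by positivity))
  rw [dirSq, ← (inEquiv h).sum_comp, Fintype.sum_sum_type]
  exact le_add_of_nonneg_right (Finset.sum_nonneg fun _ _ => sq_nonneg _)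

/-- The estimate of a collision term reduces to bounds for two fibre integrals and to pointwise
inequalities between weights. -/
lemma lintegral_collision_le_of_weights {ρ : Plane → ℝ} (hρ : IsMollifier ρ) {τ α : ℝ}
    {j n k l : ℕ} {I : Finset (Fin k)} (h : j + 1 + Iᶜ.card = n) (e : Fin (l + 1) ≃ I)
    {V : (Fin (l + 1) → Plane) → ℝ≥0∞} (hV : Measurable V) {G H : (Fin n → Plane) → ℝ≥0∞}
    (hH : Measurable H) {u : (Fin (j + 1) → Plane) → ℝ≥0∞} (hu : Measurable u)
    {Y : Plane → ℝ≥0∞} (hY : Measurable Y)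
    (hG : ∀ x, G x ^ 2 ≤ u (fun i => x (inEquiv h (Sum.inl i))) * H x) {A D c C : ℝ}
    (hc : 0 ≤ c) (hA0 : 0 ≤ A) (hD0 : 0 ≤ D)
    (hA : ∀ s, ∫⁻ r : Fin j → Plane, specDensity ρ τ (closeSum s r) * u (closeSum s r)
      ≤ ENNReal.ofReal A)
    (hD : ∀ s, ∫⁻ r : Fin l → Plane, specDensity ρ τ (closeSum s r) * V (closeSum s r)
      ≤ ENNReal.ofReal D)
    {w : (Fin k → Plane) → ℝ≥0∞}
    (hw : ∀ p, w p ≤ ENNReal.ofReal c * (V (fun i => p (e i)) * Y (sumOn I p)))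
    (hYH : ∀ x, Y (∑ i, x (inEquiv h (Sum.inl i))) * H x
      ≤ ENNReal.ofReal (2 * (j + 1)) * (ENNReal.ofReal (interpWeight τ α x) * G x ^ 2))
    (hC : c * (A * D) * 2 ≤ C) :
    ∫⁻ p, w p * collInt ρ τ j G I p ^ 2 ∂(Xi ρ τ k)
      ≤ ENNReal.ofReal (C * (j + 1)) *
        ∫⁻ x, ENNReal.ofReal (interpWeight τ α x) * G x ^ 2 ∂(Xi ρ τ n) := by
  calc ∫⁻ p, w p * collInt ρ τ j G I p ^ 2 ∂(Xi ρ τ k)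
      ≤ ∫⁻ p, ENNReal.ofReal c * (V (fun i => p (e i)) *
          (Y (sumOn I p) * collInt ρ τ j G I p ^ 2)) ∂(Xi ρ τ k) := by
        refine lintegral_mono fun p => ?_
        refine (mul_le_mul' (hw p) le_rfl).trans (le_of_eq ?_)
        ring
    _ ≤ ENNReal.ofReal c * (ENNReal.ofReal A * ENNReal.ofReal D *
          ∫⁻ x, Y (∑ i, x (inEquiv h (Sum.inl i))) * H x ∂(Xi ρ τ n)) := by
        rw [lintegral_const_mul' _ _ ENNReal.ofReal_ne_top]
        exact mul_le_mul' le_rfl (lintegral_collInt_sq_le hρ τ h e hV hH hu hY hG hA hD)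
    _ ≤ ENNReal.ofReal c * (ENNReal.ofReal A * ENNReal.ofReal D *
          (ENNReal.ofReal (2 * (j + 1)) *
          ∫⁻ x, ENNReal.ofReal (interpWeight τ α x) * G x ^ 2 ∂(Xi ρ τ n))) := by
        gcongr
        rw [← lintegral_const_mul' _ _ ENNReal.ofReal_ne_top]
        exact lintegral_mono hYH
    _ = ENNReal.ofReal (c * (A * D) * 2 * (j + 1)) *
          ∫⁻ x, ENNReal.ofReal (interpWeight τ α x) * G x ^ 2 ∂(Xi ρ τ n) := by
        have e1 : ENNReal.ofReal (c * (A * D) * 2 * (j + 1)) = ENNReal.ofReal c *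
            (ENNReal.ofReal A * ENNReal.ofReal D) * ENNReal.ofReal (2 * (j + 1)) := by
          rw [← ENNReal.ofReal_mul hA0, ← ENNReal.ofReal_mul hc,
            ← ENNReal.ofReal_mul (by positivity)]
          congr 1
          ring
        rw [e1]
        ring
    _ ≤ _ := by gcongr

/-- The energy factor `ν_τ (𝔢₁ · p_{[I]})² / (1 + ½ |√R_τ p|²)` of a collision. -/
noncomputable def energyFactor (τ : ℝ) {k : ℕ} (I : Finset (Fin k)) (p : Fin k → Plane) : ℝ :=
  nu τ * sumOn I p 0 ^ 2 / (1 + 1 / 2 * anisoSq τ p)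

lemma measurable_sumOn_coord {k : ℕ} (I : Finset (Fin k)) :
    Measurable fun p : Fin k → Plane => sumOn I p 0 := by
  have e : (fun p : Fin k → Plane => sumOn I p 0) = fun p => ∑ i ∈ I, p i 0 := by
    funext p
    simp [sumOn, Finset.sum_apply]
  rw [e]
  fun_prop

lemma measurable_energyFactor (τ : ℝ) {k : ℕ} (I : Finset (Fin k)) :
    Measurable (energyFactor τ I) :=
  (((measurable_sumOn_coord I).pow_const 2).const_mul _).div
    (((measurable_anisoSq τ k).const_mul _).const_add _)

lemma nu_mul_sumOn_sq_le (τ : ℝ) {k : ℕ} (I : Finset (Fin k)) (p : Fin k → Plane) :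
    nu τ * sumOn I p 0 ^ 2 ≤ I.card * anisoSq τ p := by
  have e : sumOn I p 0 = ∑ i ∈ I, p i 0 := by simp [sumOn, Finset.sum_apply]
  have h1 := sq_sum_le_card_mul_sum_sq (s := I) (f := fun i => p i 0)
  have h2 : ∑ i ∈ I, p i 0 ^ 2 ≤ dirSq 0 p :=
    Finset.sum_le_sum_of_subset_of_nonneg (Finset.subset_univ I) fun _ _ _ => sq_nonneg _
  have h3 := nu_pos τ
  rw [e]
  calc nu τ * (∑ i ∈ I, p i 0) ^ 2 ≤ nu τ * (I.card * dirSq 0 p) := by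
        gcongr
        exact h1.trans (by gcongr)
    _ = I.card * (nu τ * dirSq 0 p) := by ring
    _ ≤ _ := by gcongr; exact nu_mul_dirSq_le τ p

/-- With two output momenta singled out, the resolvent `(1 + ½ |√R_τ p|²)⁻¹` is split between
them. -/
lemma energyFactor_le_two (τ : ℝ) {k : ℕ} (I : Finset (Fin k)) (p : Fin k → Plane) (i i' : Fin k) :
    energyFactor τ I p
      ≤ decay τ (1 / 2) (p i) * decay τ (1 / 2) (p i') * (nu τ * sumOn I p 0 ^ 2) := by
  have h1 := norm_sq_le_anisoSq τ p i
  have h2 := norm_sq_le_anisoSq τ p i'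
  have hν := nu_pos τ
  have ha := anisoSq_nonneg τ p
  have hd : ∀ a : Fin k, (1 + 1 / 2 * anisoSq τ p) ^ (-(1 / 2) : ℝ) ≤ decay τ (1 / 2) (p a) := by
    intro a
    refine Real.rpow_le_rpow_of_nonpos (by positivity) ?_ (by norm_num)
    linarith [norm_sq_le_anisoSq τ p a]
  have e : (1 + 1 / 2 * anisoSq τ p)⁻¹
      = (1 + 1 / 2 * anisoSq τ p) ^ (-(1 / 2) : ℝ) * (1 + 1 / 2 * anisoSq τ p) ^ (-(1 / 2) : ℝ) := by
    rw [← Real.rpow_add (by positivity), ← Real.rpow_neg_one]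
    norm_num
  rw [energyFactor, div_eq_mul_inv, e, mul_comm]
  gcongr
  · exact decay_nonneg _ _ _
  · exact hd i
  · exact hd i'

/-- With two output momenta in all, part of the energy factor is kept as a power of the energy. -/
lemma energyFactor_le_rpow {τ α : ℝ} (h0 : 0 ≤ α) (h1 : α ≤ 1) {k : ℕ} {I : Finset (Fin k)}
    (hI : I.card = 2) (p : Fin k → Plane) (i : Fin k) :
    energyFactor τ I p ≤ 4 * (decay τ α (p i) * (nu τ * sumOn I p 0 ^ 2) ^ α) := by
  have hi := norm_sq_le_anisoSq τ p i
  have hν := nu_pos τ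
  have ha := anisoSq_nonneg τ p
  set X := nu τ * sumOn I p 0 ^ 2 with hX
  set W := 1 + 1 / 2 * anisoSq τ p with hW
  have hX0 : 0 ≤ X := by positivity
  have hW0 : 0 < W := by positivity
  have hXW : X / W ≤ 4 := by
    rw [div_le_iff₀ hW0]
    have := nu_mul_sumOn_sq_le τ I p
    rw [hI] at this
    push_cast at this
    linarith
  have hd : W ^ (-α) ≤ decay τ α (p i) := by
    refine Real.rpow_le_rpow_of_nonpos (by positivity) ?_ (by linarith)
    linarith
  calc energyFactor τ I p = X / W := rfl
    _ = (X / W) ^ (1 - α) * (X / W) ^ α := by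
        rw [← Real.rpow_add' (by positivity) (by norm_num)]
        norm_num
    _ ≤ 4 * (X / W) ^ α := by
        gcongr
        calc (X / W) ^ (1 - α) ≤ 4 ^ (1 - α) := by gcongr
          _ ≤ 4 ^ (1 : ℝ) := Real.rpow_le_rpow_of_exponent_le (by norm_num) (by linarith)
          _ = 4 := Real.rpow_one 4
    _ = 4 * (W ^ (-α) * X ^ α) := by
        rw [Real.div_rpow hX0 hW0.le, Real.rpow_neg hW0.le]
        ring
    _ ≤ _ := by gcongr

lemma energyFactor_le_of_card_one (τ : ℝ) {k : ℕ} {I : Finset (Fin k)}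
    (hI : I.card = 1) (p : Fin k → Plane) : energyFactor τ I p ≤ 2 := by
  have ha := anisoSq_nonneg τ p
  rw [energyFactor, div_le_iff₀ (by positivity)]
  have := nu_mul_sumOn_sq_le τ I p
  rw [hI] at this
  push_cast at this
  linarith

lemma rpow_neg_half_mul_self {τ : ℝ} (hτ : 0 < τ) :
    τ ^ (-(1 / 2) : ℝ) * τ ^ (-(1 / 2) : ℝ) = τ⁻¹ := by
  rw [← Real.rpow_add hτ, ← Real.rpow_neg_one]
  norm_num

lemma rpow_half_mul_self {χ : ℝ} (hχ : 0 ≤ χ) : χ ^ (1 / 2 : ℝ) * χ ^ (1 / 2 : ℝ) = χ := by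
  rw [← Real.rpow_add' hχ (by norm_num)]
  norm_num

/-- The case of at least three output momenta: two of them share the resolvent. The function `f`
is the weight given to each of the two, restricted or not to small momenta, and `u` is `1` or the
restriction of an input momentum to small values. -/
lemma collision_three {ρ : Plane → ℝ} (hρ : IsMollifier ρ) {α K : ℝ}
    (hK : OneParticleBound ρ α K) (h1 : α < 1) {τ : ℝ} (hτ : 0 < τ)
    {j n k l : ℕ} {I : Finset (Fin k)} (h : j + 1 + Iᶜ.card = n) (e : Fin (l + 3) ≃ I)
    {G : (Fin n → Plane) → ℝ≥0∞} (hGm : Measurable G)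
    {u : (Fin (j + 1) → Plane) → ℝ≥0∞} (hu : Measurable u)
    (hG : ∀ x, G x ^ 2 ≤ u (fun i => x (inEquiv h (Sum.inl i))) * G x ^ 2)
    {f : Plane → ℝ≥0∞} (hf : Measurable f) {A d C : ℝ} (hA0 : 0 ≤ A) (hd0 : 0 ≤ d)
    (hA : ∀ s, ∫⁻ r : Fin j → Plane, specDensity ρ τ (closeSum s r) * u (closeSum s r)
      ≤ ENNReal.ofReal A)
    (hd : ∫⁻ p, ENNReal.ofReal (Theta ρ τ p) * f p ≤ ENNReal.ofReal d)
    {w : (Fin k → Plane) → ℝ≥0∞}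
    (hw : ∀ p, w p ≤ f (p (e 0)) * f (p (e 1)) * ENNReal.ofReal (nu τ * sumOn I p 0 ^ 2))
    (hC : 2 * A * (K * (d * d) * massTheta τ ^ l) ≤ C) :
    ∫⁻ p, w p * collInt ρ τ j G I p ^ 2 ∂(Xi ρ τ k)
      ≤ ENNReal.ofReal (C * (j + 1)) *
        ∫⁻ x, ENNReal.ofReal (interpWeight τ α x) * G x ^ 2 ∂(Xi ρ τ n) := by
  have hM := massTheta_pos hτ
  have hK0 := hK.one_le
  have hν := nu_pos τ
  refine lintegral_collision_le_of_weights hρ h e (V := fun q => f (q 0) * f (q 1))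
    (by fun_prop) (hGm.pow_const 2) hu (Y := fun s => ENNReal.ofReal (nu τ * s 0 ^ 2))
    (by fun_prop) hG zero_le_one hA0 (by positivity) hA
    (lintegral_fiber_two hρ hK.mollSq_le hτ l hf hf hd0 hd hd) (fun p => ?_) (fun x => ?_)
    (by linarith)
  · rw [ENNReal.ofReal_one, one_mul]
    exact hw p
  · rw [← mul_assoc, ← ENNReal.ofReal_mul (by positivity)]
    refine mul_le_mul' (ENNReal.ofReal_le_ofReal ?_) le_rfl
    have h2 := sq_sum_le_dirSq h 0 x
    have h3 := half_dirSq_le_interpWeight (τ := τ) h1.le x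
    calc nu τ * (∑ i, x (inEquiv h (Sum.inl i))) 0 ^ 2 ≤ nu τ * ((j + 1) * dirSq 0 x) := by
          gcongr
      _ = 2 * (j + 1) * (1 / 2 * (nu τ * dirSq 0 x)) := by ring
      _ ≤ _ := by gcongr

/-- The case of two output momenta: the energy is split by interpolation between the output and
the input momenta. -/
lemma collision_two {ρ : Plane → ℝ} (hρ : IsMollifier ρ) {α K : ℝ}
    (hK : OneParticleBound ρ α K) (h0 : 0 < α) (h1 : α < 1) {τ : ℝ} (hτ : 0 < τ)
    {j n k : ℕ} {I : Finset (Fin k)} (h : j + 1 + Iᶜ.card = n) (e : Fin 2 ≃ I)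
    {G : (Fin n → Plane) → ℝ≥0∞} (hGm : Measurable G)
    {u : (Fin (j + 1) → Plane) → ℝ≥0∞} (hu : Measurable u)
    (hG : ∀ x, G x ^ 2 ≤ u (fun i => x (inEquiv h (Sum.inl i))) *
      (ENNReal.ofReal ((1 + 1 / 2 * anisoSq τ x) ^ (1 - α)) * G x ^ 2))
    {A C : ℝ} (hA0 : 0 ≤ A)
    (hA : ∀ s, ∫⁻ r : Fin j → Plane, specDensity ρ τ (closeSum s r) * u (closeSum s r)
      ≤ ENNReal.ofReal A)
    (hC : 8 * A * (K * (K * τ ^ (-α) * massTheta τ)) ≤ C) :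
    ∫⁻ p, ENNReal.ofReal (energyFactor τ I p) * collInt ρ τ j G I p ^ 2 ∂(Xi ρ τ k)
      ≤ ENNReal.ofReal (C * (j + 1)) *
        ∫⁻ x, ENNReal.ofReal (interpWeight τ α x) * G x ^ 2 ∂(Xi ρ τ n) := by
  have hM := massTheta_pos hτ
  have hK0 := hK.one_le
  have hν := nu_pos τ
  have hI : I.card = 2 := by
    have := Fintype.card_congr e
    simpa using this.symm
  have hf := (measurable_decay τ α).ennreal_ofReal
  refine lintegral_collision_le_of_weights hρ h e
    (V := fun q => ENNReal.ofReal (decay τ α (q 0)))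
    (H := fun x => ENNReal.ofReal ((1 + 1 / 2 * anisoSq τ x) ^ (1 - α)) * G x ^ 2)
    (hf.comp (measurable_pi_apply 0)) (((by have := measurable_anisoSq τ n; fun_prop :
      Measurable fun x : Fin n → Plane =>
        ENNReal.ofReal ((1 + 1 / 2 * anisoSq τ x) ^ (1 - α)))).mul (hGm.pow_const 2)) hu
    (Y := fun s => ENNReal.ofReal ((nu τ * s 0 ^ 2) ^ α))
    (by fun_prop) hG (c := 4) (by norm_num) hA0 (by positivity) hA
    (lintegral_fiber_one hρ hK.mollSq_le hτ 0 hf (hK.weight τ α hτ (Or.inr (Or.inl rfl))))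
    (fun p => ?_) (fun x => ?_) (by rw [pow_zero, mul_one]; linarith)
  · rw [← ENNReal.ofReal_mul (decay_nonneg _ _ _), ← ENNReal.ofReal_mul (by norm_num)]
    exact ENNReal.ofReal_le_ofReal (energyFactor_le_rpow h0.le h1.le hI p _)
  · rw [← mul_assoc, ← mul_assoc, ← ENNReal.ofReal_mul (by positivity),
      ← ENNReal.ofReal_mul (by positivity)]
    refine mul_le_mul' (ENNReal.ofReal_le_ofReal ?_) le_rfl
    have h2 := sq_sum_le_dirSq h 0 x
    have ha := anisoSq_nonneg τ x
    have hd := dirSq_nonneg 0 x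
    unfold interpWeight
    rw [← mul_assoc]
    refine mul_le_mul_of_nonneg_right ?_ (by positivity)
    calc (nu τ * (∑ i, x (inEquiv h (Sum.inl i))) 0 ^ 2) ^ α
        ≤ (2 * (j + 1) * (1 / 2 * (nu τ * dirSq 0 x))) ^ α := by
          refine Real.rpow_le_rpow (by positivity) ?_ h0.le
          calc nu τ * (∑ i, x (inEquiv h (Sum.inl i))) 0 ^ 2
              ≤ nu τ * ((j + 1) * dirSq 0 x) := by gcongr
            _ = _ := by ring
      _ = (2 * (j + 1)) ^ α * (1 / 2 * (nu τ * dirSq 0 x)) ^ α :=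
          Real.mul_rpow (by positivity) (by positivity)
      _ ≤ _ := by
          refine mul_le_mul_of_nonneg_right ?_ (by positivity)
          calc (2 * ((j : ℝ) + 1)) ^ α ≤ (2 * (j + 1)) ^ (1 : ℝ) :=
                Real.rpow_le_rpow_of_exponent_le (by linarith [(Nat.cast_nonneg j : (0:ℝ) ≤ j)])
                  h1.le
            _ = _ := Real.rpow_one _

lemma singWeight_mul_interp_ge {τ α : ℝ} (h0 : 0 < α) (h1 : α < 1) {n : ℕ} {x : Fin n → Plane}
    (hx : ∀ i c, x i c ≠ 0) {a b : Fin n} (hab : a ≠ b) :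
    1 ≤ singWeight τ α (1 - α) (x a) * singWeight τ α (1 - α) (x b) * interpWeight τ α x := by
  have hν := nu_pos τ
  set X := |sqrtR τ (x a) 0| * |sqrtR τ (x b) 0| with hX
  set Z := |sqrtR τ (x a) 1| * |sqrtR τ (x b) 1| with hZ
  have hX0 : 0 < X := by
    have h : ∀ i, 0 < |sqrtR τ (x i) 0| := fun i =>
      abs_pos.2 (mul_ne_zero (Real.sqrt_pos.2 hν).ne' (hx i 0))
    exact mul_pos (h a) (h b)
  have hZ0 : 0 < Z := mul_pos (abs_pos.2 (hx a 1)) (abs_pos.2 (hx b 1))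
  have hsum : ∀ f : Fin n → ℝ, (∀ i, 0 ≤ f i) → f a + f b ≤ ∑ i, f i := by
    intro f hf
    rw [← Finset.sum_pair hab]
    exact Finset.sum_le_sum_of_subset_of_nonneg (Finset.subset_univ _) fun i _ _ => hf i
  have hXle : X ≤ 1 / 2 * (nu τ * dirSq 0 x) := by
    have e : ∀ i, |sqrtR τ (x i) 0| ^ 2 = nu τ * x i 0 ^ 2 := by
      intro i
      simp [sqrtR, mul_pow, Real.sq_sqrt hν.le]
    have := hsum (fun i => nu τ * x i 0 ^ 2) fun i => by positivity
    rw [dirSq, Finset.mul_sum]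
    have h2 := e a
    have h3 := e b
    nlinarith [sq_nonneg (|sqrtR τ (x a) 0| - |sqrtR τ (x b) 0|)]
  have hZle : Z ≤ 1 + 1 / 2 * anisoSq τ x := by
    have e : ∀ i, |sqrtR τ (x i) 1| ^ 2 ≤ ‖sqrtR τ (x i)‖ ^ 2 := by
      intro i
      rw [norm_sqrtR_sq, sq_abs]
      have : sqrtR τ (x i) 1 = x i 1 := rfl
      rw [this]
      have : 0 ≤ nu τ * x i 0 ^ 2 := by positivity
      linarith
    have h4 := hsum (fun i => ‖sqrtR τ (x i)‖ ^ 2) fun i => by positivity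
    have h5 : ∑ i, ‖sqrtR τ (x i)‖ ^ 2 = anisoSq τ x := rfl
    have h2 := e a
    have h3 := e b
    nlinarith [sq_nonneg (|sqrtR τ (x a) 1| - |sqrtR τ (x b) 1|)]
  have e1 : singWeight τ α (1 - α) (x a) * singWeight τ α (1 - α) (x b)
      = X ^ (-α) * Z ^ (-(1 - α)) := by
    rw [hX, hZ, Real.mul_rpow (abs_nonneg _) (abs_nonneg _),
      Real.mul_rpow (abs_nonneg _) (abs_nonneg _), singWeight, singWeight]
    ring
  rw [e1]
  calc (1 : ℝ) = X ^ (-α) * Z ^ (-(1 - α)) * (X ^ α * Z ^ (1 - α)) := by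
        rw [Real.rpow_neg hX0.le, Real.rpow_neg hZ0.le]
        field_simp
    _ ≤ _ := by
        unfold interpWeight
        have : 0 < 1 - α := by linarith
        have : 0 ≤ (1 / 2 * (nu τ * dirSq 0 x)) ^ α :=
          Real.rpow_nonneg (hX0.le.trans hXle) _
        gcongr

/-- The case of one output momentum: the input momenta are integrated against a weight which is
singular in the direction of the energy. -/
lemma collision_one {ρ : Plane → ℝ} (hρ : IsMollifier ρ) {α K : ℝ}
    (hK : OneParticleBound ρ α K) (h0 : 0 < α) (h1 : α < 1) {τ χ : ℝ} (hτ : 0 < τ) (hχ : 0 ≤ χ)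
    {j n k : ℕ} {I : Finset (Fin k)} (h : j + 2 + 1 + Iᶜ.card = n) (e : Fin 1 ≃ I)
    {G : (Fin n → Plane) → ℝ≥0∞} (hGm : Measurable G)
    (hG : ∀ x, x ∉ goodSet τ χ n → G x = 0) :
    ∫⁻ p, ENNReal.ofReal (energyFactor τ I p) * collInt ρ τ (j + 2) G I p ^ 2 ∂(Xi ρ τ k)
      ≤ ENNReal.ofReal (4 * K ^ 4 * (χ * (τ⁻¹ * massTheta τ ^ (j + 2))) * ((j + 2 : ℕ) + 1)) *
        ∫⁻ x, ENNReal.ofReal (interpWeight τ α x) * G x ^ 2 ∂(Xi ρ τ n) := by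
  have hM := massTheta_pos hτ
  have hK0 := hK.one_le
  have hI : I.card = 1 := by
    have := Fintype.card_congr e
    simpa using this.symm
  set f : Plane → ℝ≥0∞ :=
    Set.indicator (smallSet τ χ) (fun p => ENNReal.ofReal (singWeight τ α (1 - α) p)) with hf
  have hfm : Measurable f :=
    (measurable_singWeight τ α (1 - α)).ennreal_ofReal.indicator (measurableSet_smallSet τ χ)
  have hd := hK.small_sing τ χ hτ hχ
  set d := K * χ ^ (1 / 2 : ℝ) * τ ^ (-(1 / 2) : ℝ) * massTheta τ with hd'
  have hd0 : 0 ≤ d := by positivity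
  refine lintegral_collision_le_of_weights hρ h e (V := fun q => 1)
    (H := fun x => ENNReal.ofReal (interpWeight τ α x) * G x ^ 2) measurable_const
    (((measurable_interpWeight τ α n).ennreal_ofReal).mul (hGm.pow_const 2))
    (u := fun q => f (q 0) * f (q 1)) (by fun_prop)
    (Y := fun s => 1) measurable_const (fun x => ?_) (c := 2)
    (by norm_num) (by positivity) (D := K) (by positivity)
    (lintegral_fiber_two hρ hK.mollSq_le hτ j hfm hfm hd0 hd hd)
    (fun s => ?_) (fun p => ?_) (fun x => ?_) ?_
  · by_cases hx : x ∈ goodSet τ χ n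
    · have hs : ∀ i, x i ∈ smallSet τ χ := fun i => (norm_sq_le_anisoSq τ x i).trans hx.1
      simp only [hf]
      rw [Set.indicator_of_mem (hs _), Set.indicator_of_mem (hs _), ← mul_assoc]
      refine le_mul_of_one_le_left' ?_
      have hs0 : ∀ p, 0 ≤ singWeight τ α (1 - α) p := fun p => by
        unfold singWeight; positivity
      rw [← ENNReal.ofReal_mul (hs0 _), ← ENNReal.ofReal_mul (mul_nonneg (hs0 _) (hs0 _)),
        ENNReal.one_le_ofReal]
      refine singWeight_mul_interp_ge h0 h1 hx.2 fun hab => ?_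
      have h01 := Sum.inl_injective ((inEquiv h).injective hab)
      have := congrArg Fin.val h01
      simp at this
    · rw [hG x hx]
      simp
  · have := lintegral_fiber_zero hρ hK.mollSq_le hτ 0 s
    simpa using this
  · rw [mul_one, mul_one]
    exact ENNReal.ofReal_le_ofReal (energyFactor_le_of_card_one τ hI p)
  · rw [one_mul]
    refine le_mul_of_one_le_left' ?_
    rw [ENNReal.one_le_ofReal]
    linarith [(Nat.cast_nonneg (j + 2) : (0:ℝ) ≤ ((j + 2 : ℕ) : ℝ))]
  · have e1 := rpow_neg_half_mul_self hτ
    have e2 := rpow_half_mul_self hχ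
    refine le_of_eq ?_
    rw [← e1, hd']
    nth_rw 3 [← e2]
    ring

lemma small_of_goodSet {τ χ : ℝ} {n : ℕ} {x : Fin n → Plane} (hx : x ∈ goodSet τ χ n)
    (i : Fin n) : x i ∈ smallSet τ χ := (norm_sq_le_anisoSq τ x i).trans hx.1

/-- The estimate for a fixed set `I` of output momenta, when `|I| ≥ 2` and, if `|I| = 2`, at least
two momenta collide. -/
lemma collision_le {ρ : Plane → ℝ} (hρ : IsMollifier ρ) {α K : ℝ}
    (hK : OneParticleBound ρ α K) (h0 : 0 < α) (h1 : α < 1) {τ : ℝ} (hτ : 0 < τ)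
    {j n k l : ℕ} {I : Finset (Fin k)} (h : j + 1 + Iᶜ.card = n) (hI : I.card = l + 1)
    (hl : 2 ≤ l ∨ l = 1 ∧ 1 ≤ j) {G : (Fin n → Plane) → ℝ≥0∞} (hGm : Measurable G) :
    ∫⁻ p, ENNReal.ofReal (energyFactor τ I p) * collInt ρ τ j G I p ^ 2 ∂(Xi ρ τ k)
      ≤ ENNReal.ofReal (8 * K ^ 5 * (τ⁻¹ * massTheta τ ^ (j + l)) * (j + 1)) *
        ∫⁻ x, ENNReal.ofReal (interpWeight τ α x) * G x ^ 2 ∂(Xi ρ τ n) := by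
  have hM := massTheta_pos hτ
  have hK1 := hK.one_le
  have hK4 : K ^ 4 ≤ K ^ 5 := pow_le_pow_right₀ hK1 (by norm_num)
  have hν := nu_pos τ
  have e1 := rpow_neg_half_mul_self hτ
  obtain ⟨e⟩ : Nonempty (Fin (l + 1) ≃ I) := ⟨(I.equivFinOfCardEq hI).symm⟩
  rcases hl with hl | ⟨rfl, hj⟩
  · obtain ⟨l, rfl⟩ := Nat.exists_eq_add_of_le' hl
    refine collision_three hρ hK h1 hτ h e hGm (u := fun _ => 1) measurable_const
      (fun x => by rw [one_mul]) (measurable_decay τ (1 / 2)).ennreal_ofReal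
      (A := K * massTheta τ ^ j) (d := K * τ ^ (-(1 / 2) : ℝ) * massTheta τ)
      (by positivity) (by positivity) (fun s => ?_) (hK.weight τ (1 / 2) hτ (Or.inl rfl))
      (fun p => ?_) ?_
    · simp only [mul_one]
      exact lintegral_fiber_zero hρ hK.mollSq_le hτ j s
    · have d0 := decay_nonneg τ (1 / 2)
      rw [← ENNReal.ofReal_mul (d0 _), ← ENNReal.ofReal_mul (mul_nonneg (d0 _) (d0 _))]
      exact ENNReal.ofReal_le_ofReal (energyFactor_le_two τ I p _ _)
    · have : 0 ≤ τ⁻¹ * massTheta τ ^ (j + (l + 2)) := by positivity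
      calc _ = 2 * K ^ 4 * (τ⁻¹ * massTheta τ ^ (j + (l + 2))) := by rw [← e1]; ring
        _ ≤ _ := by
          gcongr
          norm_num
  · obtain ⟨j, rfl⟩ := Nat.exists_eq_add_of_le' hj
    have hD : Measurable (decay τ (1 - α)) := measurable_decay τ (1 - α)
    refine collision_two hρ hK h0 h1 hτ h e hGm
      (u := fun q => ENNReal.ofReal (decay τ (1 - α) (q 0)))
      (by fun_prop) (fun x => ?_) (A := K * (K * τ ^ (-(1 - α)) * massTheta τ) * massTheta τ ^ j)
      (by positivity)
      (lintegral_fiber_one hρ hK.mollSq_le hτ j (by fun_prop)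
        (hK.weight τ (1 - α) hτ (Or.inr (Or.inr rfl)))) ?_
    · rw [← mul_assoc, ← ENNReal.ofReal_mul (decay_nonneg _ _ _)]
      refine le_mul_of_one_le_left' ?_
      rw [ENNReal.one_le_ofReal, decay, Real.rpow_neg (by positivity), inv_mul_eq_div,
        one_le_div (by positivity)]
      have := norm_sq_le_anisoSq τ x (inEquiv h (Sum.inl 0))
      have : 0 < 1 - α := by linarith
      gcongr
    · have e3 : τ ^ (-(1 - α)) * τ ^ (-α) = τ⁻¹ := by
        rw [← Real.rpow_add hτ, ← Real.rpow_neg_one]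
        congr 1
        ring
      calc _ = 8 * K ^ 4 * (τ⁻¹ * massTheta τ ^ (j + 1 + 1)) := by rw [← e3]; ring
        _ ≤ _ := by gcongr

/-- When at least three momenta collide, the smallness of the colliding momenta yields a factor
`χ`. -/
lemma collision_le_of_many {ρ : Plane → ℝ} (hρ : IsMollifier ρ) {α K : ℝ}
    (hK : OneParticleBound ρ α K) (h0 : 0 < α) (h1 : α < 1) {τ χ : ℝ} (hτ : 0 < τ) (hχ : 0 ≤ χ)
    {j n k l : ℕ} {I : Finset (Fin k)} (h : j + 1 + Iᶜ.card = n) (hI : I.card = l + 1)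
    (hj : 2 ≤ j) {G : (Fin n → Plane) → ℝ≥0∞} (hGm : Measurable G)
    (hG : ∀ x, x ∉ goodSet τ χ n → G x = 0) :
    ∫⁻ p, ENNReal.ofReal (energyFactor τ I p) * collInt ρ τ j G I p ^ 2 ∂(Xi ρ τ k)
      ≤ ENNReal.ofReal (8 * K ^ 5 * (χ * (τ⁻¹ * massTheta τ ^ (j + l))) * (j + 1)) *
        ∫⁻ x, ENNReal.ofReal (interpWeight τ α x) * G x ^ 2 ∂(Xi ρ τ n) := by
  have hM := massTheta_pos hτ
  have hK1 := hK.one_le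
  have hK4 : K ^ 4 ≤ K ^ 5 := pow_le_pow_right₀ hK1 (by norm_num)
  have hν := nu_pos τ
  have e1 := rpow_neg_half_mul_self hτ
  have hsm : Measurable (Set.indicator (smallSet τ χ) (1 : Plane → ℝ≥0∞)) :=
    measurable_one.indicator (measurableSet_smallSet τ χ)
  have hsmall := hK.small τ χ hτ hχ
  obtain ⟨e⟩ : Nonempty (Fin (l + 1) ≃ I) := ⟨(I.equivFinOfCardEq hI).symm⟩
  obtain ⟨j, rfl⟩ := Nat.exists_eq_add_of_le' hj
  match l, hI, e with
  | 0, hI, e =>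
    refine (collision_one hρ hK h0 h1 hτ hχ h e hGm hG).trans ?_
    gcongr
    norm_num
  | 1, hI, e =>
    have hD : Measurable (decay τ (1 - α)) := measurable_decay τ (1 - α)
    refine collision_two hρ hK h0 h1 hτ h e hGm
      (u := fun q => ENNReal.ofReal (decay τ (1 - α) (q 0)) * Set.indicator (smallSet τ χ) 1 (q 1))
      (by fun_prop) (fun x => ?_)
      (A := K * ((K * τ ^ (-(1 - α)) * massTheta τ) * (K * χ * massTheta τ)) * massTheta τ ^ j)
      (by positivity)
      (lintegral_fiber_two hρ hK.mollSq_le hτ j (by fun_prop) hsm (by positivity)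
        (hK.weight τ (1 - α) hτ (Or.inr (Or.inr rfl))) hsmall) ?_
    · by_cases hx : x ∈ goodSet τ χ n
      · rw [Set.indicator_of_mem (small_of_goodSet hx _), Pi.one_apply, mul_one, ← mul_assoc,
          ← ENNReal.ofReal_mul (decay_nonneg _ _ _)]
        refine le_mul_of_one_le_left' ?_
        rw [ENNReal.one_le_ofReal, decay, Real.rpow_neg (by positivity), inv_mul_eq_div,
          one_le_div (by positivity)]
        have := norm_sq_le_anisoSq τ x (inEquiv h (Sum.inl 0))
        have : 0 < 1 - α := by linarith
        gcongr
      · simp [hG x hx]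
    · have e3 : τ ^ (-(1 - α)) * τ ^ (-α) = τ⁻¹ := by
        rw [← Real.rpow_add hτ, ← Real.rpow_neg_one]
        congr 1
        ring
      refine le_of_eq ?_
      rw [← e3]
      ring
  | l + 2, hI, e =>
    refine collision_three hρ hK h1 hτ h e hGm
      (u := fun q => Set.indicator (smallSet τ χ) 1 (q 0)) (by fun_prop)
      (fun x => ?_) (measurable_decay τ (1 / 2)).ennreal_ofReal
      (A := K * (K * χ * massTheta τ) * massTheta τ ^ (j + 1))
      (d := K * τ ^ (-(1 / 2) : ℝ) * massTheta τ)
      (by positivity) (by positivity) (lintegral_fiber_one hρ hK.mollSq_le hτ (j + 1) hsm hsmall)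
      (hK.weight τ (1 / 2) hτ (Or.inl rfl)) (fun p => ?_) ?_
    · by_cases hx : x ∈ goodSet τ χ n
      · rw [Set.indicator_of_mem (small_of_goodSet hx _), Pi.one_apply, one_mul]
      · simp [hG x hx]
    · have d0 := decay_nonneg τ (1 / 2)
      rw [← ENNReal.ofReal_mul (d0 _), ← ENNReal.ofReal_mul (mul_nonneg (d0 _) (d0 _))]
      exact ENNReal.ofReal_le_ofReal (energyFactor_le_two τ I p _ _)
    · calc _ = 2 * K ^ 5 * (χ * (τ⁻¹ * massTheta τ ^ (j + 2 + (l + 2)))) := by rw [← e1]; ring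
        _ ≤ _ := by
          gcongr
          norm_num

lemma exists_equiv_of_ne {k l : ℕ} {I : Finset (Fin k)} (hI : I.card = l + 2) {a b : Fin k}
    (ha : a ∈ I) (hb : b ∈ I) (hab : a ≠ b) :
    ∃ e : Fin (l + 2) ≃ I, (e 0 : Fin k) = a ∧ (e 1 : Fin k) = b := by
  set e₀ := (I.equivFinOfCardEq hI).symm
  set σ := Equiv.swap 0 (e₀.symm ⟨a, ha⟩) with hσ
  set e₁ := σ.trans e₀ with he₁
  have h10 : e₁ 0 = ⟨a, ha⟩ := by simp [he₁, hσ]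
  set t := Equiv.swap 1 (e₁.symm ⟨b, hb⟩) with ht
  have hne : e₁.symm ⟨b, hb⟩ ≠ 0 := by
    intro h
    rw [Equiv.symm_apply_eq, h10, Subtype.mk.injEq] at h
    exact hab h.symm
  refine ⟨t.trans e₁, ?_, ?_⟩
  · have : t 0 = 0 := Equiv.swap_apply_of_ne_of_ne (by simp) hne.symm
    simp [this, h10]
  · simp [ht]

/-- When two of at least three output momenta are small, a factor `χ` is gained. -/
lemma collision_le_of_pair {ρ : Plane → ℝ} (hρ : IsMollifier ρ) {α K : ℝ}
    (hK : OneParticleBound ρ α K) (h1 : α < 1) {τ χ : ℝ} (hτ : 0 < τ) (hχ : 0 ≤ χ)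
    {j n k l : ℕ} {I : Finset (Fin k)} (h : j + 1 + Iᶜ.card = n) (hI : I.card = l + 3)
    {a b : Fin k} (ha : a ∈ I) (hb : b ∈ I) (hab : a ≠ b)
    {G : (Fin n → Plane) → ℝ≥0∞} (hGm : Measurable G) :
    ∫⁻ p, (Set.indicator (smallSet τ χ) 1 (p a) * Set.indicator (smallSet τ χ) 1 (p b) *
        ENNReal.ofReal (energyFactor τ I p)) * collInt ρ τ j G I p ^ 2 ∂(Xi ρ τ k)
      ≤ ENNReal.ofReal (8 * K ^ 5 * (χ * (τ⁻¹ * massTheta τ ^ (j + (l + 2)))) * (j + 1)) *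
        ∫⁻ x, ENNReal.ofReal (interpWeight τ α x) * G x ^ 2 ∂(Xi ρ τ n) := by
  have hM := massTheta_pos hτ
  have hK1 := hK.one_le
  have hK4 : K ^ 4 ≤ K ^ 5 := pow_le_pow_right₀ hK1 (by norm_num)
  have e1 := rpow_neg_half_mul_self hτ
  have e2 := rpow_half_mul_self hχ
  obtain ⟨e, hea, heb⟩ := exists_equiv_of_ne hI ha hb hab
  have hfm : Measurable (Set.indicator (smallSet τ χ)
      (fun p => ENNReal.ofReal (decay τ (1 / 2) p))) :=
    (measurable_decay τ (1 / 2)).ennreal_ofReal.indicator (measurableSet_smallSet τ χ)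
  refine collision_three hρ hK h1 hτ h e hGm (u := fun _ => 1) measurable_const
    (fun x => by rw [one_mul]) hfm
    (A := K * massTheta τ ^ j) (d := K * χ ^ (1 / 2 : ℝ) * τ ^ (-(1 / 2) : ℝ) * massTheta τ)
    (by positivity) (by positivity) (fun s => ?_) (hK.small_weight τ χ hτ hχ)
    (fun p => ?_) ?_
  · simp only [mul_one]
    exact lintegral_fiber_zero hρ hK.mollSq_le hτ j s
  · rw [hea, heb]
    by_cases hpa : p a ∈ smallSet τ χ
    · by_cases hpb : p b ∈ smallSet τ χ
      · simp only [Set.indicator_of_mem hpa, Set.indicator_of_mem hpb, Pi.one_apply, one_mul]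
        have d0 := decay_nonneg τ (1 / 2)
        rw [← ENNReal.ofReal_mul (d0 _), ← ENNReal.ofReal_mul (mul_nonneg (d0 _) (d0 _))]
        exact ENNReal.ofReal_le_ofReal (energyFactor_le_two τ I p _ _)
      · simp [Set.indicator_of_notMem hpb]
    · simp [Set.indicator_of_notMem hpa]
  · have : 0 ≤ χ * (τ⁻¹ * massTheta τ ^ (j + (l + 2))) := by positivity
    calc _ = 2 * K ^ 4 * (χ * (τ⁻¹ * massTheta τ ^ (j + (l + 2)))) := by
            rw [← e1]
            nth_rw 3 [← e2]
            ring
      _ ≤ _ := by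
        gcongr
        norm_num

/-! ### Summation over the sets of output momenta -/

lemma sq_sum_le_card_mul {ι : Type*} (s : Finset ι) (f : ι → ℝ≥0∞) :
    (∑ i ∈ s, f i) ^ 2 ≤ s.card * ∑ i ∈ s, f i ^ 2 := by
  have h := ENNReal.rpow_sum_le_const_mul_sum_rpow s f (p := 2) (by norm_num)
  norm_num at h
  exact_mod_cast h

/-- Let the terms `X I` vanish unless `S` contains all spectators. If `S` has at most one further
element, there are few non-zero terms; otherwise each of them has two elements of `S` in `I`. -/
lemma sq_sum_powersetCard_le {k l q : ℕ} (hk : l + q = k) (S : Finset (Fin k))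
    (X : Finset (Fin k) → ℝ≥0∞) (hX : ∀ I ∈ Finset.powersetCard l Finset.univ, X I ≠ 0 → Iᶜ ⊆ S) :
    (∑ I ∈ Finset.powersetCard l (Finset.univ : Finset (Fin k)), X I) ^ 2
      ≤ ∑ I ∈ Finset.powersetCard l (Finset.univ : Finset (Fin k)),
        ((q + 1 : ℕ) + (k.choose l : ℕ) * ∑ ab ∈ I.offDiag,
          (if ab.1 ∈ S then 1 else 0) * (if ab.2 ∈ S then 1 else 0)) * X I ^ 2 := by
  classical
  set P := Finset.powersetCard l (Finset.univ : Finset (Fin k)) with hP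
  have hPc : P.card = k.choose l := by simp [hP]
  by_cases hS : S.card ≤ q + 1
  · set P' := P.filter fun I => X I ≠ 0 with hP'
    have hsum : ∑ I ∈ P, X I = ∑ I ∈ P', X I := (Finset.sum_filter_ne_zero P).symm
    have hcard : P'.card ≤ q + 1 := by
      have hmap : P'.card ≤ (Finset.powersetCard q S).card := by
        refine Finset.card_le_card_of_injOn (fun I => Iᶜ) (fun I hI => ?_)
          fun I _ J _ h => compl_injective h
        have hI' := Finset.mem_filter.1 hI
        refine Finset.mem_coe.2 (Finset.mem_powersetCard.2 ⟨hX I hI'.1 hI'.2, ?_⟩)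
        have := (Finset.mem_powersetCard.1 hI'.1).2
        rw [Finset.card_compl, Fintype.card_fin, this]
        omega
      rw [Finset.card_powersetCard] at hmap
      refine hmap.trans ((Nat.choose_le_choose q hS).trans ?_)
      rw [Nat.choose_succ_self_right]
    rw [hsum]
    calc (∑ I ∈ P', X I) ^ 2 ≤ P'.card * ∑ I ∈ P', X I ^ 2 := sq_sum_le_card_mul _ _
      _ ≤ (q + 1 : ℕ) * ∑ I ∈ P, X I ^ 2 := by
          gcongr
          exact Finset.filter_subset _ _
      _ = ∑ I ∈ P, (q + 1 : ℕ) * X I ^ 2 := Finset.mul_sum _ _ _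
      _ ≤ _ := by
          refine Finset.sum_le_sum fun I _ => ?_
          gcongr
          exact le_self_add
  · push Not at hS
    calc (∑ I ∈ P, X I) ^ 2 ≤ P.card * ∑ I ∈ P, X I ^ 2 := sq_sum_le_card_mul _ _
      _ = ∑ I ∈ P, (k.choose l : ℕ) * X I ^ 2 := by rw [hPc, Finset.mul_sum]
      _ ≤ _ := by
          refine Finset.sum_le_sum fun I hI => ?_
          by_cases hXI : X I = 0
          · simp [hXI]
          have hIc := (Finset.mem_powersetCard.1 hI).2
          have hsub := hX I hI hXI
          have h2 : 1 < (S ∩ I).card := by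
            have e1 : (S \ I).card ≤ q := by
              calc (S \ I).card ≤ Iᶜ.card := Finset.card_le_card fun x hx => by
                    simp only [Finset.mem_sdiff] at hx
                    simpa using hx.2
                _ = q := by
                    rw [Finset.card_compl, Fintype.card_fin, hIc]
                    omega
            have e2 := Finset.card_sdiff_add_card_inter S I
            omega
          obtain ⟨a, ha, b, hb, hab⟩ := Finset.one_lt_card.1 h2
          rw [Finset.mem_inter] at ha hb
          have hone : (1 : ℝ≥0∞) ≤ ∑ ab ∈ I.offDiag,
              (if ab.1 ∈ S then 1 else 0) * (if ab.2 ∈ S then 1 else 0) := by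
            have := Finset.single_le_sum (s := I.offDiag) (f := fun ab : Fin k × Fin k =>
              ((if ab.1 ∈ S then 1 else 0) * (if ab.2 ∈ S then 1 else 0) : ℝ≥0∞))
              (fun _ _ => zero_le) (a := (a, b)) (Finset.mem_offDiag.2 ⟨ha.2, hb.2, hab⟩)
            simpa [ha.1, hb.1] using this
          gcongr
          exact (le_mul_of_one_le_right' hone).trans le_add_self

/-! ### The components of the generator -/

/-- The scalar factor of `𝒜^{τ,m}_a`, without the combinatorial one. -/
noncomputable def genFactor (τ : ℝ) (m : ℕ) : ℝ :=
  τ ^ (1 - (m : ℝ) / 2) * nu τ ^ ((1 + (m : ℝ)) / 4) / (2 * Real.pi) ^ (m - 1)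

/-- The powers of `τ`, `ν_τ` and `2π` in the scalar factor balance the mass of the `m - 1`
integrations and the energy factor. -/
lemma genFactor_sq_mul {τ : ℝ} (hτ : 0 < τ) {m : ℕ} (hm : 1 ≤ m) :
    genFactor τ m ^ 2 * ((nu τ)⁻¹ * (τ⁻¹ * massTheta τ ^ (m - 1))) = 1 := by
  obtain ⟨m, rfl⟩ := Nat.exists_eq_add_of_le' hm
  have hν := nu_pos τ
  simp only [Nat.add_sub_cancel]
  have e1 : massTheta τ ^ m = (2 * Real.pi) ^ m * (2 * Real.pi) ^ m *
      (τ ^ (m : ℝ) * nu τ ^ (-(m : ℝ) / 2)) := by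
    rw [massTheta, show 4 * Real.pi ^ 2 = (2 * Real.pi) * (2 * Real.pi) by ring, mul_pow, mul_pow,
      mul_pow τ, Real.rpow_natCast, Real.sqrt_eq_rpow, ← Real.rpow_neg hν.le,
      ← Real.rpow_natCast (nu τ ^ (-(1 / 2) : ℝ)), ← Real.rpow_mul hν.le]
    congr 3
    ring
  have e2 : τ ^ (1 - ((m + 1 : ℕ) : ℝ) / 2) * τ ^ (1 - ((m + 1 : ℕ) : ℝ) / 2) * τ⁻¹ * τ ^ (m : ℝ)
      = 1 := by
    rw [← Real.rpow_neg_one, ← Real.rpow_add hτ, ← Real.rpow_add hτ, ← Real.rpow_add hτ]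
    push_cast
    ring_nf
    exact Real.rpow_zero _
  have e3 : nu τ ^ ((1 + ((m + 1 : ℕ) : ℝ)) / 4) * nu τ ^ ((1 + ((m + 1 : ℕ) : ℝ)) / 4) *
      (nu τ)⁻¹ * nu τ ^ (-(m : ℝ) / 2) = 1 := by
    rw [← Real.rpow_neg_one, ← Real.rpow_add hν, ← Real.rpow_add hν, ← Real.rpow_add hν]
    push_cast
    ring_nf
    exact Real.rpow_zero _
  have hπ : (2 * Real.pi) ^ m ≠ 0 := by positivity
  rw [genFactor, e1, Nat.add_sub_cancel]
  calc _ = (τ ^ (1 - ((m + 1 : ℕ) : ℝ) / 2) * τ ^ (1 - ((m + 1 : ℕ) : ℝ) / 2) * τ⁻¹ *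
          τ ^ (m : ℝ)) * (nu τ ^ ((1 + ((m + 1 : ℕ) : ℝ)) / 4) *
          nu τ ^ ((1 + ((m + 1 : ℕ) : ℝ)) / 4) * (nu τ)⁻¹ * nu τ ^ (-(m : ℝ) / 2)) := by
        field_simp
    _ = 1 := by rw [e2, e3, one_mul]

lemma enorm_collideIntegrand (ρ : Plane → ℝ) (τ : ℝ) (j : ℕ) {n k : ℕ} (ψ : (Fin n → Plane) → ℂ)
    (I : Finset (Fin k)) (p : Fin k → Plane) (r : Fin j → Plane) :
    ‖collideIntegrand ρ τ j ψ I p r‖ₑ = specDensity ρ τ (closeSum (sumOn I p) r) *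
      ‖ψ (assemble n I (closeSum (sumOn I p) r) p)‖ₑ := by
  rw [collideIntegrand, enorm_mul, specDensity_eq_ofReal]
  congr 1
  rw [← ofReal_norm, Complex.norm_real, Real.norm_of_nonneg]
  exact Finset.prod_nonneg fun i _ => Theta_nonneg _ _ _

lemma enorm_real_sq (x : ℝ) : ‖((x : ℝ) : ℂ)‖ₑ ^ 2 = ENNReal.ofReal (x ^ 2) := by
  rw [← ofReal_norm, Complex.norm_real, ← ENNReal.ofReal_pow (norm_nonneg _),
    Real.norm_eq_abs, sq_abs]

lemma enorm_genComp_sq_le (ρ : Plane → ℝ) (τ : ℝ) {m j n k : ℕ} (ψ : (Fin n → Plane) → ℂ)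
    (p : Fin k → Plane) :
    ‖genComp ρ τ m j n k ψ p‖ₑ ^ 2
      ≤ ENNReal.ofReal ((genFactor τ m * ((n ! : ℝ) / ((k ! : ℝ) * ((j + 1) ! : ℝ)))) ^ 2) *
        (∑ I ∈ Finset.powersetCard (m - j) (Finset.univ : Finset (Fin k)),
          ‖((sumOn I p 0 : ℝ) : ℂ)‖ₑ * collInt ρ τ j (fun x => ‖ψ x‖ₑ) I p) ^ 2 := by
  unfold genComp
  split_ifs with h
  · rw [enorm_mul, enorm_mul, mul_pow, mul_pow, enorm_real_sq]
    have hI : ‖-Complex.I‖ₑ = 1 := by simp [← ofReal_norm]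
    rw [hI, one_pow, one_mul]
    refine mul_le_mul' le_rfl (pow_le_pow_left' ?_ 2)
    refine (enorm_sum_le _ _).trans (Finset.sum_le_sum fun I _ => ?_)
    rw [enorm_mul]
    refine mul_le_mul' le_rfl ((enorm_integral_le_lintegral_enorm _).trans (le_of_eq ?_))
    simp only [enorm_collideIntegrand]
    rfl
  · simp

/-- The combinatorial factors of a component, with `n = q + j + 1`, `k = q + l` and `m = j + l`. -/
lemma factorial_identity (q j l : ℕ) :
    ((j + l) ! : ℝ) * ((q + l) ! : ℝ) *
        (((q + j + 1) ! : ℝ) / (((q + l) ! : ℝ) * ((j + 1) ! : ℝ))) ^ 2 *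
        ((q + l).choose l * (j + 1))
      = ((q + j + 1) ! : ℝ) * ((q + j + 1).choose (j + 1) * (j + l).choose j) := by
  have h1 : ((q + l).choose l : ℝ) = ((q + l) ! : ℝ) / ((l ! : ℝ) * (q ! : ℝ)) := by
    rw [Nat.cast_choose ℝ (by omega), Nat.add_sub_cancel]
  have h2 : ((q + j + 1).choose (j + 1) : ℝ)
      = ((q + j + 1) ! : ℝ) / (((j + 1) ! : ℝ) * (q ! : ℝ)) := by
    rw [Nat.cast_choose ℝ (by omega), show q + j + 1 - (j + 1) = q by omega]
  have h3 : ((j + l).choose j : ℝ) = ((j + l) ! : ℝ) / ((j ! : ℝ) * (l ! : ℝ)) := by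
    rw [Nat.cast_choose ℝ (by omega), show j + l - j = l by omega]
  have h4 : ((j + 1) ! : ℝ) = (j + 1) * (j ! : ℝ) := by
    rw [Nat.factorial_succ]; push_cast; ring
  rw [h1, h2, h3, h4]
  have := Nat.factorial_ne_zero
  have f1 : (j ! : ℝ) ≠ 0 := by exact_mod_cast this j
  have f2 : (l ! : ℝ) ≠ 0 := by exact_mod_cast this l
  have f3 : (q ! : ℝ) ≠ 0 := by exact_mod_cast this q
  have f4 : ((q + l) ! : ℝ) ≠ 0 := by exact_mod_cast this _
  have f5 : (j + 1 : ℝ) ≠ 0 := by positivity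
  field_simp

/-- Summation over the output sets: from a pointwise bound of the square of the sum to a bound of
the component `𝒜^{τ,m}_a`, `m = j + l + 1`. -/
lemma lintegral_genComp_le {ρ : Plane → ℝ} (hρ : IsMollifier ρ) {τ : ℝ} (hτ : 0 < τ)
    {q j l : ℕ} {ψ : (Fin (q + j + 1) → Plane) → ℂ} (hψ : Measurable ψ)
    {c : Finset (Fin (q + (l + 1))) → (Fin (q + (l + 1)) → Plane) → ℝ≥0∞}
    (hc : ∀ I, Measurable (c I))
    (hX : ∀ p, (∑ I ∈ Finset.powersetCard (l + 1) (Finset.univ : Finset (Fin (q + (l + 1)))),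
          ‖((sumOn I p 0 : ℝ) : ℂ)‖ₑ * collInt ρ τ j (fun x => ‖ψ x‖ₑ) I p) ^ 2
        ≤ ∑ I ∈ Finset.powersetCard (l + 1) (Finset.univ : Finset (Fin (q + (l + 1)))),
          c I p * (‖((sumOn I p 0 : ℝ) : ℂ)‖ₑ * collInt ρ τ j (fun x => ‖ψ x‖ₑ) I p) ^ 2)
    {M : ℝ} (hM : 0 ≤ M) {h : ℝ≥0∞} (γ : ℝ)
    (hI : ∀ I ∈ Finset.powersetCard (l + 1) (Finset.univ : Finset (Fin (q + (l + 1)))),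
      ∫⁻ p, c I p * (ENNReal.ofReal (nu τ * sumOn I p 0 ^ 2 * (1 + 1 / 2 * anisoSq τ p) ^ γ) *
          collInt ρ τ j (fun x => ‖ψ x‖ₑ) I p ^ 2) ∂(Xi ρ τ (q + (l + 1)))
        ≤ ENNReal.ofReal (M * (τ⁻¹ * massTheta τ ^ (j + l)) * (j + 1)) * h) :
    ((j + l + 1) ! : ℝ≥0∞) * (((q + (l + 1)) ! : ℝ≥0∞) *
      ∫⁻ p, ENNReal.ofReal ((1 + 1 / 2 * anisoSq τ p) ^ γ) *
        ‖genComp ρ τ (j + l + 1) j (q + j + 1) (q + (l + 1)) ψ p‖ₑ ^ 2 ∂(Xi ρ τ (q + (l + 1))))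
      ≤ ENNReal.ofReal (M * ((q + j + 1).choose (j + 1) * (j + l + 1).choose j)) *
        (((q + j + 1) ! : ℝ≥0∞) * h) := by
  have hMass := massTheta_pos hτ
  have hν := nu_pos τ
  set P := Finset.powersetCard (l + 1) (Finset.univ : Finset (Fin (q + (l + 1)))) with hP
  set a : ℝ := genFactor τ (j + l + 1) *
    (((q + j + 1) ! : ℝ) / (((q + (l + 1)) ! : ℝ) * ((j + 1) ! : ℝ))) with ha
  set N : ℝ := M * (τ⁻¹ * massTheta τ ^ (j + l)) * (j + 1) with hN
  have hN0 : 0 ≤ N := by positivity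
  have hml : j + l + 1 - j = l + 1 := by omega
  have hpt : ∀ p, ENNReal.ofReal ((1 + 1 / 2 * anisoSq τ p) ^ γ) *
      ‖genComp ρ τ (j + l + 1) j (q + j + 1) (q + (l + 1)) ψ p‖ₑ ^ 2
      ≤ ENNReal.ofReal (a ^ 2 * (nu τ)⁻¹) * ∑ I ∈ P, c I p *
        (ENNReal.ofReal (nu τ * sumOn I p 0 ^ 2 * (1 + 1 / 2 * anisoSq τ p) ^ γ) * collInt ρ τ j (fun x => ‖ψ x‖ₑ) I p ^ 2) := by
    intro p
    have hp := anisoSq_nonneg τ p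
    have h1 := enorm_genComp_sq_le ρ τ (m := j + l + 1) (j := j) (k := q + (l + 1)) ψ p
    rw [hml] at h1
    refine (mul_le_mul' le_rfl (h1.trans (mul_le_mul' le_rfl (hX p)))).trans (le_of_eq ?_)
    rw [← ha, ENNReal.ofReal_mul (sq_nonneg a), mul_left_comm, mul_assoc]
    congr 1
    rw [Finset.mul_sum, Finset.mul_sum]
    refine Finset.sum_congr rfl fun I _ => ?_
    rw [mul_pow, enorm_real_sq]
    have e : ENNReal.ofReal ((1 + 1 / 2 * anisoSq τ p) ^ γ) *
        ENNReal.ofReal (sumOn I p 0 ^ 2)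
        = ENNReal.ofReal (nu τ)⁻¹ * ENNReal.ofReal (nu τ * sumOn I p 0 ^ 2 * (1 + 1 / 2 * anisoSq τ p) ^ γ) := by
      rw [← ENNReal.ofReal_mul (by positivity), ← ENNReal.ofReal_mul (by positivity),
        ← mul_assoc, ← mul_assoc, inv_mul_cancel₀ hν.ne', one_mul, mul_comm]
    calc _ = c I p * (ENNReal.ofReal ((1 + 1 / 2 * anisoSq τ p) ^ γ) *
          ENNReal.ofReal (sumOn I p 0 ^ 2)) *
          collInt ρ τ j (fun x => ‖ψ x‖ₑ) I p ^ 2 := by ring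
      _ = _ := by rw [e]; ring
  have hm : ∀ I, Measurable fun p => c I p * (ENNReal.ofReal (nu τ * sumOn I p 0 ^ 2 * (1 + 1 / 2 * anisoSq τ p) ^ γ) *
      collInt ρ τ j (fun x => ‖ψ x‖ₑ) I p ^ 2) := fun I =>
    (hc I).mul (Measurable.mul (((((measurable_sumOn_coord I).pow_const 2).const_mul _).mul
      ((((measurable_anisoSq τ _).const_mul _).const_add _).pow_const _)).ennreal_ofReal)
      ((measurable_collInt hρ τ j hψ.enorm I).pow_const 2))
  have hint : ∫⁻ p, ENNReal.ofReal ((1 + 1 / 2 * anisoSq τ p) ^ γ) *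
        ‖genComp ρ τ (j + l + 1) j (q + j + 1) (q + (l + 1)) ψ p‖ₑ ^ 2 ∂(Xi ρ τ (q + (l + 1)))
      ≤ ENNReal.ofReal (a ^ 2 * (nu τ)⁻¹) *
        (((q + (l + 1)).choose (l + 1) : ℕ) * (ENNReal.ofReal N * h)) := by
    refine (lintegral_mono hpt).trans ?_
    rw [lintegral_const_mul' _ _ ENNReal.ofReal_ne_top, lintegral_finsetSum _ fun I _ => hm I]
    refine mul_le_mul' le_rfl ((Finset.sum_le_sum hI).trans (le_of_eq ?_))
    rw [Finset.sum_const, nsmul_eq_mul, hP, Finset.card_powersetCard, Finset.card_univ,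
      Fintype.card_fin]
  refine (mul_le_mul' le_rfl (mul_le_mul' le_rfl hint)).trans (le_of_eq ?_)
  have hkey : ((j + l + 1) ! : ℝ) * (((q + (l + 1)) ! : ℝ) *
      ((a ^ 2 * (nu τ)⁻¹) * (((q + (l + 1)).choose (l + 1) : ℝ) * N)))
      = M * ((q + j + 1).choose (j + 1) * (j + l + 1).choose j) * ((q + j + 1) ! : ℝ) := by
    have f1 := factorial_identity q j (l + 1)
    have f2 := genFactor_sq_mul hτ (m := j + l + 1) (by omega)
    rw [Nat.add_sub_cancel] at f2
    rw [← add_assoc j l 1] at f1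
    set D : ℝ := ((q + j + 1) ! : ℝ) / (((q + (l + 1)) ! : ℝ) * ((j + 1) ! : ℝ)) with hD
    rw [hN, ha, mul_pow]
    calc _ = M * (((j + l + 1) ! : ℝ) * ((q + (l + 1)) ! : ℝ) * D ^ 2 *
          ((q + (l + 1)).choose (l + 1) * (j + 1))) *
          (genFactor τ (j + l + 1) ^ 2 * ((nu τ)⁻¹ * (τ⁻¹ * massTheta τ ^ (j + l)))) := by ring
      _ = _ := by rw [f1, f2]; ring
  have hcast : ∀ x : ℕ, (x : ℝ≥0∞) = ENNReal.ofReal (x : ℝ) := fun x =>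
    (ENNReal.ofReal_natCast x).symm
  calc ((j + l + 1) ! : ℝ≥0∞) * (((q + (l + 1)) ! : ℝ≥0∞) *
      (ENNReal.ofReal (a ^ 2 * (nu τ)⁻¹) *
        (((q + (l + 1)).choose (l + 1) : ℕ) * (ENNReal.ofReal N * h))))
      = ENNReal.ofReal (((j + l + 1) ! : ℝ) * (((q + (l + 1)) ! : ℝ) *
      ((a ^ 2 * (nu τ)⁻¹) * (((q + (l + 1)).choose (l + 1) : ℝ) * N)))) * h := by
        have a0 : 0 ≤ a ^ 2 * (nu τ)⁻¹ := by positivity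
        rw [ENNReal.ofReal_mul (Nat.cast_nonneg _), ENNReal.ofReal_mul (Nat.cast_nonneg _),
          ENNReal.ofReal_mul a0, ENNReal.ofReal_mul (Nat.cast_nonneg _),
          ← hcast, ← hcast, ← hcast]
        ring
    _ = _ := by
        rw [hkey, ENNReal.ofReal_mul (by positivity), ← hcast]
        ring

/-! ### The combinatorial bounds -/

lemma choose_add_le_pow (q l : ℕ) : (q + l).choose l ≤ (l + 1) ^ q := by
  induction q with
  | zero => simp
  | succ q ih =>
    have h : (q + 1) * (q + 1 + l).choose l = (q + 1 + l) * (q + l).choose l := by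
      have h1 := Nat.add_one_mul_choose_eq (q + l) q
      rw [show (q + 1 + l).choose l = (q + l + 1).choose (q + 1) by
        rw [show q + 1 + l = q + l + 1 by ring, ← Nat.choose_symm_of_eq_add (show q + l + 1
          = (q + 1) + l by ring)], show (q + l).choose l = (q + l).choose q from
        (Nat.choose_symm_of_eq_add rfl).symm]
      rw [show q + 1 + l = q + l + 1 by ring, h1]
      ring
    have h2 : q + 1 + l ≤ (q + 1) * (l + 1) := by nlinarith
    refine le_of_mul_le_mul_left ?_ (by omega : 0 < q + 1)
    calc (q + 1) * (q + 1 + l).choose l = (q + 1 + l) * (q + l).choose l := h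
      _ ≤ ((q + 1) * (l + 1)) * (l + 1) ^ q := Nat.mul_le_mul h2 ih
      _ = _ := by ring

/-- The bound of a component between chaoses, up to a constant. -/
noncomputable def compBound (n m : ℕ) (χ : ℝ) : ℝ :=
  (n : ℝ) ^ 3 * (m : ℝ) ^ 2 + χ * 4 ^ n * (m : ℝ) ^ (n - 1)

/-- The cross term of the square of `compBound`. -/
lemma le_compBound_sq_of_cross {n m X : ℕ} {χ : ℝ} (hχ : 0 ≤ χ)
    (hX : X ≤ 2 * (n ^ 3 * m ^ 2 * 4 ^ n * m ^ (n - 1))) : χ * X ≤ compBound n m χ ^ 2 := by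
  have h : (X : ℝ) ≤ 2 * ((n : ℝ) ^ 3 * (m : ℝ) ^ 2 * 4 ^ n * (m : ℝ) ^ (n - 1)) := by
    exact_mod_cast hX
  have h2 : χ * X ≤ χ * (2 * ((n : ℝ) ^ 3 * (m : ℝ) ^ 2 * 4 ^ n * (m : ℝ) ^ (n - 1))) := by
    gcongr
  unfold compBound
  have ha : 0 ≤ ((n : ℝ) ^ 3 * (m : ℝ) ^ 2) ^ 2 := by positivity
  have hb : 0 ≤ (χ * 4 ^ n * (m : ℝ) ^ (n - 1)) ^ 2 := by positivity
  nlinarith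

/-- The square of the term of `compBound` without `χ`. -/
lemma le_compBound_sq_of_main {n m X : ℕ} {χ : ℝ} (hχ : 0 ≤ χ)
    (hX : X ≤ (n ^ 3 * m ^ 2) ^ 2) : (X : ℝ) ≤ compBound n m χ ^ 2 := by
  have h : (X : ℝ) ≤ ((n : ℝ) ^ 3 * (m : ℝ) ^ 2) ^ 2 := by exact_mod_cast hX
  refine h.trans ?_
  unfold compBound
  gcongr
  have : 0 ≤ χ * 4 ^ n * (m : ℝ) ^ (n - 1) := by positivity
  linarith

lemma choose_mul_choose_le {q j l : ℕ} (hj : 1 ≤ j) :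
    (q + (l + 1)).choose (l + 1) * ((q + j + 1).choose (j + 1) * (j + l + 1).choose j)
      ≤ 2 ^ (q + j + 1) * (j + l + 1) ^ (q + j) := by
  have h1 : (q + (l + 1)).choose (l + 1) ≤ (j + l + 1) ^ q :=
    (choose_add_le_pow q (l + 1)).trans (Nat.pow_le_pow_left (by omega) q)
  have h2 : (q + j + 1).choose (j + 1) ≤ 2 ^ (q + j + 1) := Nat.choose_le_two_pow _ _
  have h3 : (j + l + 1).choose j ≤ (j + l + 1) ^ j := Nat.choose_le_pow _ _
  calc _ ≤ (j + l + 1) ^ q * (2 ^ (q + j + 1) * (j + l + 1) ^ j) :=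
        Nat.mul_le_mul h1 (Nat.mul_le_mul h2 h3)
    _ = _ := by ring

/-! ### The estimate of a component -/

lemma compl_subset_of_collInt_ne_zero {ρ : Plane → ℝ} {τ χ : ℝ} {j n k : ℕ}
    {I : Finset (Fin k)} (h : j + 1 + Iᶜ.card = n) {G : (Fin n → Plane) → ℝ≥0∞}
    (hG : ∀ x, x ∉ goodSet τ χ n → G x = 0) {p : Fin k → Plane}
    (hne : collInt ρ τ j G I p ≠ 0) {a : Fin k} (ha : a ∈ Iᶜ) : p a ∈ smallSet τ χ := by
  by_contra hp
  refine hne ?_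
  unfold collInt
  rw [lintegral_eq_zero_of_ae_eq_zero]
  refine Eventually.of_forall fun r => ?_
  obtain ⟨i, hi⟩ : ∃ i, Iᶜ.orderEmbOfFin rfl i = a := by
    have := Finset.range_orderEmbOfFin Iᶜ (rfl : Iᶜ.card = Iᶜ.card)
    have h2 : a ∈ Set.range (Iᶜ.orderEmbOfFin rfl) := by rw [this]; exact ha
    exact h2
  have hx : assemble n I (closeSum (sumOn I p) r) p ∉ goodSet τ χ n := by
    intro hx
    have := small_of_goodSet hx (inEquiv h (Sum.inr i))
    rw [assemble_eq h] at this
    simp only [Function.comp, Equiv.symm_apply_apply, Sum.elim_inr, hi] at this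
    exact hp this
  simp [hG _ hx]

/-- The estimate of `𝒜^{τ,m}_a` from the `n`-th chaos, for `m ≥ 3`, on functions supported on small
momenta. -/
lemma lintegral_genComp_le_compBound {ρ : Plane → ℝ} (hρ : IsMollifier ρ) {α K : ℝ}
    (hK : OneParticleBound ρ α K) (h0 : 0 < α) (h1 : α < 1) {τ χ : ℝ} (hτ : 0 < τ) (hχ : 0 ≤ χ)
    {m j n k : ℕ} (hm : 3 ≤ m) (hjm : j < m) (hjn : j + 1 ≤ n) (hnk : n + m = k + 2 * j + 1)
    {ψ : (Fin n → Plane) → ℂ} (hψ : Measurable ψ) (hS : ∀ x, x ∉ goodSet τ χ n → ψ x = 0) :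
    (m ! : ℝ≥0∞) * ((k ! : ℝ≥0∞) *
      ∫⁻ p, ENNReal.ofReal ((1 + 1 / 2 * anisoSq τ p) ^ (-1 : ℝ)) *
        ‖genComp ρ τ m j n k ψ p‖ₑ ^ 2 ∂(Xi ρ τ k))
      ≤ ENNReal.ofReal (16 * K ^ 5 * compBound n m χ ^ 2) * ((n ! : ℝ≥0∞) *
        ∫⁻ x, ENNReal.ofReal (interpWeight τ α x) * ‖ψ x‖ₑ ^ 2 ∂(Xi ρ τ n)) := by
  obtain ⟨q, rfl⟩ : ∃ q, n = q + j + 1 := ⟨n - (j + 1), by omega⟩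
  obtain ⟨l, rfl⟩ : ∃ l, m = j + l + 1 := ⟨m - (j + 1), by omega⟩
  obtain rfl : k = q + (l + 1) := by omega
  have hM := massTheta_pos hτ
  have hK1 := hK.one_le
  have hGm := hψ.enorm
  have hG : ∀ x, x ∉ goodSet τ χ (q + j + 1) → ‖ψ x‖ₑ = 0 := fun x hx => by simp [hS x hx]
  set E : Finset (Fin (q + (l + 1))) → (Fin (q + (l + 1)) → Plane) → ℝ≥0∞ := fun I p =>
    ENNReal.ofReal (energyFactor τ I p) * collInt ρ τ j (fun x => ‖ψ x‖ₑ) I p ^ 2 with hE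
  have hEm : ∀ I, Measurable (E I) := fun I =>
    (measurable_energyFactor τ I).ennreal_ofReal.mul
      ((measurable_collInt hρ τ j hGm I).pow_const 2)
  have hef : ∀ (I : Finset (Fin (q + (l + 1)))) p,
      nu τ * sumOn I p 0 ^ 2 * (1 + 1 / 2 * anisoSq τ p) ^ (-1 : ℝ) = energyFactor τ I p :=
    fun I p => by rw [Real.rpow_neg_one]; rfl
  set H := ∫⁻ x, ENNReal.ofReal (interpWeight τ α x) * ‖ψ x‖ₑ ^ 2 ∂(Xi ρ τ (q + j + 1)) with hH
  have hIc : ∀ I ∈ Finset.powersetCard (l + 1) (Finset.univ : Finset (Fin (q + (l + 1)))),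
      I.card = l + 1 ∧ j + 1 + Iᶜ.card = q + j + 1 := by
    intro I hI
    have := (Finset.mem_powersetCard.1 hI).2
    refine ⟨this, ?_⟩
    rw [Finset.card_compl, Fintype.card_fin, this]
    omega
  set R := τ⁻¹ * massTheta τ ^ (j + l) with hR
  have hR0 : 0 ≤ R := by positivity
  -- the sum over `I` by the number of sets, affordable when `|I| = 2` or when three momenta collide
  have bound_of_uniform : ∀ κ : ℝ, 0 ≤ κ →
      (∀ I ∈ Finset.powersetCard (l + 1) (Finset.univ : Finset (Fin (q + (l + 1)))),
        ∫⁻ p, E I p ∂(Xi ρ τ (q + (l + 1))) ≤ ENNReal.ofReal (8 * K ^ 5 * (κ * R) * (j + 1)) * H) →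
      κ * (((q + (l + 1)).choose (l + 1) *
        ((q + j + 1).choose (j + 1) * (j + l + 1).choose j) : ℕ) : ℝ)
        ≤ compBound (q + j + 1) (j + l + 1) χ ^ 2 →
      ((j + l + 1) ! : ℝ≥0∞) * (((q + (l + 1)) ! : ℝ≥0∞) *
      ∫⁻ p, ENNReal.ofReal ((1 + 1 / 2 * anisoSq τ p) ^ (-1 : ℝ)) *
        ‖genComp ρ τ (j + l + 1) j (q + j + 1) (q + (l + 1)) ψ p‖ₑ ^ 2 ∂(Xi ρ τ (q + (l + 1))))
      ≤ ENNReal.ofReal (16 * K ^ 5 * compBound (q + j + 1) (j + l + 1) χ ^ 2) *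
        (((q + j + 1) ! : ℝ≥0∞) * H) := by
    intro κ hκ hκE hκC
    have := lintegral_genComp_le hρ hτ hψ
      (c := fun _ _ => (((q + (l + 1)).choose (l + 1) : ℕ) : ℝ≥0∞)) (fun _ => measurable_const)
      (fun p => by
        rw [← Finset.mul_sum]
        refine (sq_sum_le_card_mul _ _).trans (le_of_eq ?_)
        rw [Finset.card_powersetCard, Finset.card_univ, Fintype.card_fin])
      (M := 8 * K ^ 5 * (κ * ((q + (l + 1)).choose (l + 1) : ℕ))) (by positivity) (h := H) (-1)
      (fun I hI => by
        simp only [hef]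
        rw [lintegral_const_mul _ (hEm I)]
        refine (mul_le_mul' le_rfl (hκE I hI)).trans (le_of_eq ?_)
        rw [← mul_assoc, ← ENNReal.ofReal_natCast, ← ENNReal.ofReal_mul (Nat.cast_nonneg _)]
        congr 2
        ring)
    refine this.trans (mul_le_mul' (ENNReal.ofReal_le_ofReal ?_) le_rfl)
    push_cast at hκC ⊢
    have hK5 : 0 ≤ K ^ 5 := by positivity
    nlinarith [mul_le_mul_of_nonneg_left hκC hK5, sq_nonneg (compBound (q + j + 1) (j + l + 1) χ)]
  by_cases hj : 2 ≤ j
  · refine bound_of_uniform χ hχ (fun I hI => ?_) (le_compBound_sq_of_cross hχ ?_)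
    · exact collision_le_of_many hρ hK h0 h1 hτ hχ (hIc I hI).2 (hIc I hI).1 hj hGm hG
    · refine (choose_mul_choose_le (by omega)).trans ?_
      rw [show q + j + 1 - 1 = q + j by omega]
      have e1 : 2 ^ (q + j + 1) ≤ 4 ^ (q + j + 1) := Nat.pow_le_pow_left (by norm_num) _
      have e2 : 1 ≤ (q + j + 1) ^ 3 * (j + l + 1) ^ 2 := Nat.one_le_iff_ne_zero.2 (by positivity)
      calc 2 ^ (q + j + 1) * (j + l + 1) ^ (q + j)
          ≤ 1 * (4 ^ (q + j + 1) * (j + l + 1) ^ (q + j)) := by rw [one_mul]; gcongr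
        _ ≤ (2 * ((q + j + 1) ^ 3 * (j + l + 1) ^ 2)) * (4 ^ (q + j + 1) * (j + l + 1) ^ (q + j)) :=
            Nat.mul_le_mul_right _ (by omega)
        _ = _ := by ring
  by_cases hl : l = 1
  · obtain rfl : j = 1 := by omega
    subst hl
    refine bound_of_uniform 1 zero_le_one (fun I hI => ?_) ?_
    · rw [one_mul]
      exact collision_le hρ hK h0 h1 hτ (hIc I hI).2 (hIc I hI).1 (Or.inr ⟨rfl, le_rfl⟩) hGm
    · rw [one_mul]
      refine le_compBound_sq_of_main hχ ?_
      have c1 : (q + (1 + 1)).choose (1 + 1) ≤ (q + 1 + 1) ^ 2 := Nat.choose_le_pow _ _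
      have c2 : (q + 1 + 1).choose (1 + 1) ≤ (q + 1 + 1) ^ 2 := Nat.choose_le_pow _ _
      have c3 : (1 + 1 + 1).choose 1 = 3 := rfl
      rw [c3]
      calc _ ≤ (q + 1 + 1) ^ 2 * ((q + 1 + 1) ^ 2 * 3) :=
            Nat.mul_le_mul c1 (Nat.mul_le_mul c2 le_rfl)
        _ = 3 * ((q + 1 + 1) ^ 4 * 1) := by ring
        _ ≤ 81 * ((q + 1 + 1) ^ 4 * (q + 1 + 1) ^ 2) := by
            gcongr
            · norm_num
            · exact Nat.one_le_iff_ne_zero.2 (by positivity)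
        _ = _ := by ring
  -- the remaining case: at least three output momenta, at most two colliding ones
  obtain ⟨l, rfl⟩ : ∃ l', l = l' + 2 := ⟨l - 2, by omega⟩
  set D : ℕ := (q + (l + 2 + 1)).choose (l + 2 + 1) with hD
  set s : Plane → ℝ≥0∞ := Set.indicator (smallSet τ χ) 1 with hs
  have hsm : Measurable s := measurable_one.indicator (measurableSet_smallSet τ χ)
  have hmult : ∀ p : Fin (q + (l + 2 + 1)) → Plane,
      (∑ I ∈ Finset.powersetCard (l + 2 + 1) (Finset.univ : Finset (Fin (q + (l + 2 + 1)))),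
          ‖((sumOn I p 0 : ℝ) : ℂ)‖ₑ * collInt ρ τ j (fun x => ‖ψ x‖ₑ) I p) ^ 2
        ≤ ∑ I ∈ Finset.powersetCard (l + 2 + 1) (Finset.univ : Finset (Fin (q + (l + 2 + 1)))),
          (((q + 1 : ℕ) : ℝ≥0∞) + D * ∑ ab ∈ I.offDiag, s (p ab.1) * s (p ab.2)) *
          (‖((sumOn I p 0 : ℝ) : ℂ)‖ₑ * collInt ρ τ j (fun x => ‖ψ x‖ₑ) I p) ^ 2 := by
    classical
    intro p
    have := sq_sum_powersetCard_le (q := q) (add_comm _ _)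
      (Finset.univ.filter fun i => p i ∈ smallSet τ χ)
      (fun I => ‖((sumOn I p 0 : ℝ) : ℂ)‖ₑ * collInt ρ τ j (fun x => ‖ψ x‖ₑ) I p)
      (fun I hI hne a ha => by
        rw [Finset.mem_filter]
        exact ⟨Finset.mem_univ a, compl_subset_of_collInt_ne_zero (hIc I hI).2 hG
          (right_ne_zero_of_mul hne) ha⟩)
    refine this.trans (le_of_eq ?_)
    refine Finset.sum_congr rfl fun I _ => ?_
    simp only [Finset.mem_filter, Finset.mem_univ, true_and, hs, Set.indicator_apply,
      Pi.one_apply]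
    rfl
  have hcm : ∀ I : Finset (Fin (q + (l + 2 + 1))), Measurable fun p : Fin (q + (l + 2 + 1)) → Plane =>
      (((q + 1 : ℕ) : ℝ≥0∞) + D * ∑ ab ∈ I.offDiag, s (p ab.1) * s (p ab.2)) := by
    intro I
    fun_prop
  have hpairm : ∀ (I : Finset (Fin (q + (l + 2 + 1)))) (ab : Fin (q + (l + 2 + 1)) × _),
      Measurable fun p : Fin (q + (l + 2 + 1)) → Plane => s (p ab.1) * s (p ab.2) * E I p := by
    intro I ab
    have := hEm I
    fun_prop
  have hint : ∀ I ∈ Finset.powersetCard (l + 2 + 1) (Finset.univ : Finset (Fin (q + (l + 2 + 1)))),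
      ∫⁻ p, (((q + 1 : ℕ) : ℝ≥0∞) + D * ∑ ab ∈ I.offDiag, s (p ab.1) * s (p ab.2)) * E I p
          ∂(Xi ρ τ (q + (l + 2 + 1)))
        ≤ ENNReal.ofReal (8 * K ^ 5 * ((q + 1 : ℕ) + (D * (l + 3) ^ 2 : ℕ) * χ) * R * (j + 1)) * H := by
    intro I hI
    have b1 := collision_le hρ hK h0 h1 hτ (hIc I hI).2 (hIc I hI).1 (Or.inl (by omega)) hGm
    have b2 : ∀ ab ∈ I.offDiag, ∫⁻ p, s (p ab.1) * s (p ab.2) * E I p ∂(Xi ρ τ (q + (l + 2 + 1)))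
        ≤ ENNReal.ofReal (8 * K ^ 5 * (χ * R) * (j + 1)) * H := by
      intro ab hab
      rw [Finset.mem_offDiag] at hab
      have := collision_le_of_pair hρ hK h1 hτ hχ (hIc I hI).2 (hIc I hI).1 hab.1 hab.2.1
        hab.2.2 hGm
      refine le_trans (le_of_eq (lintegral_congr fun p => ?_)) this
      simp only [hE, hs]
      ring
    calc ∫⁻ p, (((q + 1 : ℕ) : ℝ≥0∞) + D * ∑ ab ∈ I.offDiag, s (p ab.1) * s (p ab.2)) * E I p
          ∂(Xi ρ τ (q + (l + 2 + 1)))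
        = ∫⁻ p, (((q + 1 : ℕ) : ℝ≥0∞) * E I p + D * ∑ ab ∈ I.offDiag,
            s (p ab.1) * s (p ab.2) * E I p) ∂(Xi ρ τ (q + (l + 2 + 1))) := by
          refine lintegral_congr fun p => ?_
          rw [← Finset.sum_mul]
          ring
      _ = ((q + 1 : ℕ) : ℝ≥0∞) * ∫⁻ p, E I p ∂(Xi ρ τ (q + (l + 2 + 1))) +
            D * ∑ ab ∈ I.offDiag,
              ∫⁻ p, s (p ab.1) * s (p ab.2) * E I p ∂(Xi ρ τ (q + (l + 2 + 1))) := by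
          rw [lintegral_add_left ((hEm I).const_mul _), lintegral_const_mul _ (hEm I),
            lintegral_const_mul _ (Finset.measurable_fun_sum _ fun ab _ => hpairm I ab),
            lintegral_finsetSum _ fun ab _ => hpairm I ab]
      _ ≤ ((q + 1 : ℕ) : ℝ≥0∞) * (ENNReal.ofReal (8 * K ^ 5 * R * (j + 1)) * H) +
            D * (((l + 3) ^ 2 : ℕ) * (ENNReal.ofReal (8 * K ^ 5 * (χ * R) * (j + 1)) * H)) := by
          refine add_le_add (mul_le_mul' le_rfl b1) (mul_le_mul' le_rfl ?_)
          refine (Finset.sum_le_sum b2).trans ?_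
          rw [Finset.sum_const, nsmul_eq_mul]
          refine mul_le_mul' (Nat.cast_le.2 ?_) le_rfl
          rw [Finset.offDiag_card, (hIc I hI).1]
          have : (l + 2 + 1) * (l + 2 + 1) = (l + 3) ^ 2 := by ring
          omega
      _ = _ := by
          have e1 : ENNReal.ofReal (8 * K ^ 5 * ((q + 1 : ℕ) + (D * (l + 3) ^ 2 : ℕ) * χ) * R *
              (j + 1)) = ((q + 1 : ℕ) : ℝ≥0∞) * ENNReal.ofReal (8 * K ^ 5 * R * (j + 1)) +
              D * (((l + 3) ^ 2 : ℕ) * ENNReal.ofReal (8 * K ^ 5 * (χ * R) * (j + 1))) := by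
            rw [← ENNReal.ofReal_natCast, ← ENNReal.ofReal_natCast D,
              ← ENNReal.ofReal_natCast ((l + 3) ^ 2), ← ENNReal.ofReal_mul (Nat.cast_nonneg _),
              ← ENNReal.ofReal_mul (Nat.cast_nonneg _), ← ENNReal.ofReal_mul (Nat.cast_nonneg _),
              ← ENNReal.ofReal_add (by positivity) (by positivity)]
            congr 1
            push_cast
            ring
          rw [e1]
          ring
  have := lintegral_genComp_le hρ hτ hψ hcm hmult
    (M := 8 * K ^ 5 * ((q + 1 : ℕ) + (D * (l + 3) ^ 2 : ℕ) * χ)) (by positivity) (h := H) (-1)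
    (fun I hI => by
      simp only [hef]
      exact hint I hI)
  refine this.trans (mul_le_mul' (ENNReal.ofReal_le_ofReal ?_) le_rfl)
  have hj' : j ≤ 1 := by omega
  set n := q + j + 1 with hn
  set m := j + (l + 2) + 1 with hm'
  have c1 : n.choose (j + 1) ≤ n ^ 2 :=
    (Nat.choose_le_pow _ _).trans (Nat.pow_le_pow_right (by omega) (by omega))
  have c2 : m.choose j ≤ m :=
    (Nat.choose_le_pow _ _).trans ((Nat.pow_le_pow_right (by omega) hj').trans (by simp))
  have t1 : (((q + 1) * (n.choose (j + 1) * m.choose j) : ℕ) : ℝ) ≤ compBound n m χ ^ 2 := by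
    refine le_compBound_sq_of_main hχ ?_
    have hn1 : 1 ≤ n := by omega
    have hm1 : 1 ≤ m := by omega
    calc (q + 1) * (n.choose (j + 1) * m.choose j) ≤ n * (n ^ 2 * m) :=
          Nat.mul_le_mul (by omega) (Nat.mul_le_mul c1 c2)
      _ = n ^ 3 * m ^ 1 := by ring
      _ ≤ n ^ 6 * m ^ 4 := Nat.mul_le_mul (Nat.pow_le_pow_right hn1 (by omega))
          (Nat.pow_le_pow_right hm1 (by omega))
      _ = _ := by ring
  have t2 : χ * ((D * (l + 3) ^ 2 * (n.choose (j + 1) * m.choose j) : ℕ) : ℝ)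
      ≤ compBound n m χ ^ 2 := by
    refine le_compBound_sq_of_cross hχ ?_
    have hl3 : (l + 3) ^ 2 ≤ m ^ 2 := Nat.pow_le_pow_left (by omega) 2
    have hn1 : 1 ≤ n := by omega
    rw [show n - 1 = q + j by omega]
    have hDj : D * m.choose j ≤ 4 ^ n * m ^ (q + j) := by
      have h2m : l + 2 + 1 + 1 ≤ 2 * m := by omega
      rcases Nat.le_one_iff_eq_zero_or_eq_one.1 hj' with hj0 | hj1
      · have e1 : D ≤ (2 * m) ^ q :=
          (choose_add_le_pow q (l + 2 + 1)).trans (Nat.pow_le_pow_left h2m q)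
        calc D * m.choose j = D := by rw [hj0, Nat.choose_zero_right, mul_one]
          _ ≤ 2 ^ q * m ^ q := by rw [← mul_pow]; exact e1
          _ ≤ 4 ^ n * m ^ (q + j) := by
            refine Nat.mul_le_mul ((Nat.pow_le_pow_left (by norm_num) q).trans
              (Nat.pow_le_pow_right (by norm_num) (by omega))) (by rw [hj0, add_zero])
      · have e1 : D ≤ m ^ q :=
          (choose_add_le_pow q (l + 2 + 1)).trans (Nat.pow_le_pow_left (by omega) q)
        calc D * m.choose j ≤ m ^ q * m := Nat.mul_le_mul e1 c2
          _ = 1 * m ^ (q + j) := by rw [hj1]; ring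
          _ ≤ _ := Nat.mul_le_mul_right _ (Nat.one_le_pow _ _ (by norm_num))
    calc D * (l + 3) ^ 2 * (n.choose (j + 1) * m.choose j)
        = n.choose (j + 1) * (l + 3) ^ 2 * (D * m.choose j) := by ring
      _ ≤ n ^ 3 * m ^ 2 * (4 ^ n * m ^ (q + j)) := by
          refine Nat.mul_le_mul (Nat.mul_le_mul (c1.trans ?_) hl3) hDj
          exact Nat.pow_le_pow_right hn1 (by omega)
      _ ≤ _ := by
          rw [← mul_assoc]
          omega
  have hK5 : 0 ≤ K ^ 5 := by positivity
  push_cast at t1 t2 ⊢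
  calc _ = 8 * K ^ 5 * (((q : ℝ) + 1) * ((n.choose (j + 1) : ℝ) * (m.choose j : ℝ)) +
        χ * ((D : ℝ) * ((l : ℝ) + 3) ^ 2 * ((n.choose (j + 1) : ℝ) * (m.choose j : ℝ)))) := by ring
    _ ≤ 8 * K ^ 5 * (compBound n m χ ^ 2 + compBound n m χ ^ 2) := by gcongr
    _ = _ := by ring

/-! ### Almost everywhere statements and absolute convergence -/

lemma Xi_absolutelyContinuous (ρ : Plane → ℝ) (τ : ℝ) (n : ℕ) : Xi ρ τ n ≪ volume :=
  withDensity_absolutelyContinuous _ _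

lemma ae_coords_ne_zero (ρ : Plane → ℝ) (τ : ℝ) (n : ℕ) :
    ∀ᵐ x ∂(Xi ρ τ n), ∀ i c, x i c ≠ 0 := by
  refine (Xi_absolutelyContinuous ρ τ n).ae_le ?_
  refine ae_all_iff.2 fun i => ?_
  have h := Measure.quasiMeasurePreserving_eval (fun _ : Fin n => (volume : Measure Plane)) i
  exact h.ae ae_coord_ne_zero

/-- A function that vanishes almost everywhere has collision integrals that vanish almost
everywhere. -/
lemma collInt_ae_eq_zero {ρ : Plane → ℝ} (hρ : IsMollifier ρ) {τ : ℝ} (hτ : 0 < τ) {j n k : ℕ}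
    {I : Finset (Fin k)} (h : j + 1 + Iᶜ.card = n) (hI : I.Nonempty)
    {g : (Fin n → Plane) → ℝ≥0∞} (hg : Measurable g) (h0 : g =ᵐ[Xi ρ τ n] 0) :
    collInt ρ τ j g I =ᵐ[Xi ρ τ k] 0 := by
  obtain ⟨B, -, hB⟩ := hρ.exists_mollSq_le
  obtain ⟨l, hl⟩ : ∃ l, I.card = l + 1 := ⟨I.card - 1, by have := hI.card_pos; omega⟩
  have e := (I.equivFinOfCardEq hl).symm
  have hz : ∫⁻ x, g x ∂(Xi ρ τ n) = 0 := lintegral_eq_zero_of_ae_eq_zero h0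
  have := lintegral_collInt_le hρ τ h e (V := fun _ => 1) measurable_const hg
    (D := ENNReal.ofReal (B * massTheta τ ^ l)) (fun s => by
      simpa only [mul_one] using lintegral_fiber_zero hρ hB hτ l s)
  simp only [one_mul, hz, mul_zero, nonpos_iff_eq_zero] at this
  exact (lintegral_eq_zero_iff (measurable_collInt hρ τ j hg I)).1 this

lemma card_compl_of_mem {m j n k : ℕ} (hjm : j < m) (hnk : n + m = k + 2 * j + 1)
    {I : Finset (Fin k)}
    (hI : I ∈ Finset.powersetCard (m - j) (Finset.univ : Finset (Fin k))) :
    I.Nonempty ∧ j + 1 + Iᶜ.card = n := by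
  have hc := (Finset.mem_powersetCard.1 hI).2
  have hle := Finset.card_le_univ I
  rw [Fintype.card_fin] at hle
  refine ⟨Finset.card_pos.1 (by omega), ?_⟩
  rw [Finset.card_compl, Fintype.card_fin]
  omega

lemma continuous_collideArg {j k : ℕ} (I : Finset (Fin k)) :
    Continuous fun z : (Fin k → Plane) × (Fin j → Plane) => closeSum (sumOn I z.1) z.2 :=
  (continuous_closeSum j).comp (((continuous_sumOn I).comp continuous_fst).prodMk continuous_snd)

lemma measurable_collideIntegrand {ρ : Plane → ℝ} (hρ : IsMollifier ρ) (τ : ℝ) (j : ℕ) {n k : ℕ}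
    {ψ : (Fin n → Plane) → ℂ} (hψ : Measurable ψ) (I : Finset (Fin k)) :
    Measurable fun z : (Fin k → Plane) × (Fin j → Plane) =>
      collideIntegrand ρ τ j ψ I z.1 z.2 := by
  unfold collideIntegrand
  have hT := continuous_Theta hρ τ
  have h1 : Continuous fun z : (Fin k → Plane) × (Fin j → Plane) =>
      ∏ i, Theta ρ τ (closeSum (sumOn I z.1) z.2 i) :=
    continuous_finsetProd _ fun i _ =>
      hT.comp ((continuous_apply i).comp (continuous_collideArg I))
  exact (Complex.continuous_ofReal.comp h1).measurable.mul
    (hψ.comp (continuous_collision n j I).measurable)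

lemma measurable_genComp {ρ : Plane → ℝ} (hρ : IsMollifier ρ) (τ : ℝ) (m j n k : ℕ)
    {ψ : (Fin n → Plane) → ℂ} (hψ : Measurable ψ) : Measurable (genComp ρ τ m j n k ψ) := by
  unfold genComp
  split_ifs
  · refine Measurable.const_mul (Finset.measurable_fun_sum _ fun I _ => ?_) _
    refine (Complex.measurable_ofReal.comp (measurable_sumOn_coord I)).mul ?_
    exact (measurable_collideIntegrand hρ τ j hψ I).stronglyMeasurable.integral_prod_right.measurable
  · exact measurable_const

/-- The components of the generator do not depend on the choice of the representatives. -/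
lemma genComp_congr_ae {ρ : Plane → ℝ} (hρ : IsMollifier ρ) {τ : ℝ} (hτ : 0 < τ) {m j n k : ℕ}
    (hjm : j < m) {ψ ψ' : (Fin n → Plane) → ℂ} (hψ : Measurable ψ) (hψ' : Measurable ψ')
    (h : ψ =ᵐ[Xi ρ τ n] ψ') :
    genComp ρ τ m j n k ψ =ᵐ[Xi ρ τ k] genComp ρ τ m j n k ψ' := by
  by_cases hc : j + 1 ≤ n ∧ n + m = k + 2 * j + 1
  swap
  · exact Eventually.of_forall fun p => by simp only [genComp, if_neg hc]
  have hg : Measurable fun x => ‖ψ x - ψ' x‖ₑ := (hψ.sub hψ').enorm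
  have hg0 : (fun x => ‖ψ x - ψ' x‖ₑ) =ᵐ[Xi ρ τ n] 0 := by
    filter_upwards [h] with x hx
    simp [hx]
  have hall : ∀ᵐ p ∂(Xi ρ τ k),
      ∀ I ∈ Finset.powersetCard (m - j) (Finset.univ : Finset (Fin k)),
        collInt ρ τ j (fun x => ‖ψ x - ψ' x‖ₑ) I p = 0 := by
    refine ae_all_iff.2 fun I => ?_
    by_cases hI : I ∈ Finset.powersetCard (m - j) (Finset.univ : Finset (Fin k))
    · obtain ⟨hne, hcard⟩ := card_compl_of_mem hjm hc.2 hI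
      filter_upwards [collInt_ae_eq_zero hρ hτ hcard hne hg hg0] with p hp _ using hp
    · exact Eventually.of_forall fun p hI' => absurd hI' hI
  filter_upwards [hall] with p hp
  simp only [genComp, if_pos hc]
  congr 1
  refine Finset.sum_congr rfl fun I hI => ?_
  congr 1
  refine integral_congr_ae ?_
  have hm : Measurable fun r : Fin j → Plane => specDensity ρ τ (closeSum (sumOn I p) r) *
      ‖ψ (assemble n I (closeSum (sumOn I p) r) p) -
        ψ' (assemble n I (closeSum (sumOn I p) r) p)‖ₑ := by
    refine Measurable.mul ?_ (hg.comp ((continuous_collision n j I).comp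
      (continuous_const.prodMk continuous_id)).measurable)
    exact (measurable_specDensity hρ τ).comp ((continuous_collideArg I).comp
      (continuous_const.prodMk continuous_id)).measurable
  have h0 := (lintegral_eq_zero_iff hm).1 (hp I hI)
  filter_upwards [h0] with r hr
  rcases mul_eq_zero.1 hr with h1 | h1
  · rw [specDensity_eq_ofReal, ENNReal.ofReal_eq_zero] at h1
    have h2 : ∏ i, Theta ρ τ (closeSum (sumOn I p) r i) = 0 :=
      le_antisymm h1 (Finset.prod_nonneg fun i _ => Theta_nonneg _ _ _)
    simp [collideIntegrand, h2]
  · rw [enorm_eq_zero, sub_eq_zero] at h1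
    simp only [collideIntegrand, h1]

lemma genConverges_of_lintegral_lt_top {ρ : Plane → ℝ} (hρ : IsMollifier ρ) {τ : ℝ} (hτ : 0 < τ)
    {Φ : FockSeq} (hm : ∀ n, Measurable (Φ n))
    (hΦ : ∀ n, ∫⁻ x, ‖Φ n x‖ₑ ^ 2 ∂(Xi ρ τ n) < ⊤) (m : ℕ) : GenConverges ρ τ m Φ := by
  intro n k j hjm hjn hnk
  obtain ⟨B, -, hB⟩ := hρ.exists_mollSq_le
  refine ae_all_iff.2 fun I => ?_
  by_cases hI : I ∈ Finset.powersetCard (m - j) (Finset.univ : Finset (Fin k))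
  swap
  · exact Eventually.of_forall fun p hI' => absurd hI' hI
  obtain ⟨hne, hcard⟩ := card_compl_of_mem hjm hnk hI
  obtain ⟨l, hl⟩ : ∃ l, I.card = l + 1 := ⟨I.card - 1, by have := hne.card_pos; omega⟩
  have e := (I.equivFinOfCardEq hl).symm
  have hcm := measurable_collInt hρ τ j (hm n).enorm I
  have := lintegral_collInt_sq_le hρ τ hcard e (V := fun _ => 1) measurable_const
    (G := fun x => ‖Φ n x‖ₑ) (H := fun x => ‖Φ n x‖ₑ ^ 2) ((hm n).enorm.pow_const 2)
    (u := fun _ => 1) measurable_const (Y := fun _ => 1) measurable_const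
    (fun x => by rw [one_mul]) (A := ENNReal.ofReal (B * massTheta τ ^ j))
    (D := ENNReal.ofReal (B * massTheta τ ^ l))
    (fun s => by simpa only [mul_one] using lintegral_fiber_zero hρ hB hτ j s)
    (fun s => by simpa only [mul_one] using lintegral_fiber_zero hρ hB hτ l s)
  simp only [one_mul] at this
  have hlt : ∫⁻ p, collInt ρ τ j (fun x => ‖Φ n x‖ₑ) I p ^ 2 ∂(Xi ρ τ k) < ⊤ :=
    this.trans_lt (ENNReal.mul_lt_top (ENNReal.mul_lt_top ENNReal.ofReal_lt_top
      ENNReal.ofReal_lt_top) (hΦ n))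
  filter_upwards [ae_lt_top (hcm.pow_const 2) hlt.ne] with p hp _
  have hms := (measurable_collideIntegrand hρ τ j (hm n) I).comp
    (measurable_const (a := p) |>.prodMk measurable_id)
  refine ⟨hms.aestronglyMeasurable, ?_⟩
  rw [HasFiniteIntegral]
  simp only [enorm_collideIntegrand]
  by_contra htop
  rw [not_lt, top_le_iff] at htop
  have : collInt ρ τ j (fun x => ‖Φ n x‖ₑ) I p = ⊤ := htop
  rw [this] at hp
  simp at hp

/-- The restriction of a kernel to the configurations with small, non-vanishing momenta. -/
noncomputable def cutGood (τ χ : ℝ) {n : ℕ} (ψ : (Fin n → Plane) → ℂ) : (Fin n → Plane) → ℂ :=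
  Set.indicator (goodSet τ χ n) ψ

lemma measurableSet_goodSet (τ χ : ℝ) (n : ℕ) : MeasurableSet (goodSet τ χ n) := by
  refine (measurableSet_le (measurable_anisoSq τ n) measurable_const).inter ?_
  have : {x : Fin n → Plane | ∀ i c, x i c ≠ 0} = ⋂ i, ⋂ c, {x | x i c ≠ 0} := by
    ext x; simp
  change MeasurableSet {x : Fin n → Plane | ∀ i c, x i c ≠ 0}
  rw [this]
  refine MeasurableSet.iInter fun i => MeasurableSet.iInter fun c => ?_
  have hm : Measurable fun x : Fin n → Plane => x i c := by fun_prop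
  exact hm (measurableSet_singleton 0).compl

lemma cutGood_ae_eq {ρ : Plane → ℝ} {τ χ : ℝ} {Φ : FockSeq} {n : ℕ}
    (hs : FourierSuppIn ρ τ Φ n {p | anisoSq τ p ≤ τ * χ}) :
    Φ n =ᵐ[Xi ρ τ n] cutGood τ χ (Φ n) := by
  filter_upwards [hs, ae_coords_ne_zero ρ τ n] with x hx hx'
  unfold cutGood
  by_cases h : x ∈ goodSet τ χ n
  · rw [Set.indicator_of_mem h]
  · rw [Set.indicator_of_notMem h]
    refine hx fun hmem => h ⟨hmem, hx'⟩

/-- The estimate of a component of the generator on functions whose support is small. -/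
lemma lintegral_genComp_supp_le {ρ : Plane → ℝ} (hρ : IsMollifier ρ) {α K : ℝ}
    (hK : OneParticleBound ρ α K) (h0 : 0 < α) (h1 : α < 1) {τ χ : ℝ} (hτ : 0 < τ) (hχ : 0 ≤ χ)
    {m j n k : ℕ} (hm : 3 ≤ m) (hjm : j < m) (hjn : j + 1 ≤ n) (hnk : n + m = k + 2 * j + 1)
    {Φ : FockSeq} (hΦ : Measurable (Φ n))
    (hs : FourierSuppIn ρ τ Φ n {p | anisoSq τ p ≤ τ * χ}) :
    (m ! : ℝ≥0∞) * ((k ! : ℝ≥0∞) *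
      ∫⁻ p, ENNReal.ofReal ((1 + 1 / 2 * anisoSq τ p) ^ (-1 : ℝ)) *
        ‖genComp ρ τ m j n k (Φ n) p‖ₑ ^ 2 ∂(Xi ρ τ k))
      ≤ ENNReal.ofReal (16 * K ^ 5 * compBound n m χ ^ 2) * ((n ! : ℝ≥0∞) *
        ∫⁻ x, ENNReal.ofReal (interpWeight τ α x) * ‖Φ n x‖ₑ ^ 2 ∂(Xi ρ τ n)) := by
  have hmc : Measurable (cutGood τ χ (Φ n)) := hΦ.indicator (measurableSet_goodSet τ χ n)
  have hae := cutGood_ae_eq hs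
  have h2 := lintegral_genComp_le_compBound hρ hK h0 h1 hτ hχ hm hjm hjn hnk hmc
    fun x hx => Set.indicator_of_notMem hx _
  have e1 : ∫⁻ p, ENNReal.ofReal ((1 + 1 / 2 * anisoSq τ p) ^ (-1 : ℝ)) *
        ‖genComp ρ τ m j n k (Φ n) p‖ₑ ^ 2 ∂(Xi ρ τ k)
      = ∫⁻ p, ENNReal.ofReal ((1 + 1 / 2 * anisoSq τ p) ^ (-1 : ℝ)) *
        ‖genComp ρ τ m j n k (cutGood τ χ (Φ n)) p‖ₑ ^ 2 ∂(Xi ρ τ k) := by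
    refine lintegral_congr_ae ?_
    filter_upwards [genComp_congr_ae hρ hτ (k := k) hjm hΦ hmc hae] with p hp
    rw [hp]
  have e2 : ∫⁻ x, ENNReal.ofReal (interpWeight τ α x) * ‖Φ n x‖ₑ ^ 2 ∂(Xi ρ τ n)
      = ∫⁻ x, ENNReal.ofReal (interpWeight τ α x) * ‖cutGood τ χ (Φ n) x‖ₑ ^ 2 ∂(Xi ρ τ n) := by
    refine lintegral_congr_ae ?_
    filter_upwards [hae] with x hx
    rw [← hx]
  rw [e1, e2]
  exact h2

lemma choose_mul_choose_le_pow (q j l : ℕ) :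
    (q + (l + 1)).choose (l + 1) * ((q + j + 1).choose (j + 1) * (j + l + 1).choose j)
      ≤ 4 ^ (q + j + 1) * (j + l + 1) ^ (q + j + 1) := by
  rcases Nat.eq_zero_or_pos j with rfl | hj
  · have h1 : (q + (l + 1)).choose (l + 1) ≤ (2 * (l + 1)) ^ q :=
      (choose_add_le_pow q (l + 1)).trans (Nat.pow_le_pow_left (by omega) q)
    have h2 : (q + 0 + 1).choose (0 + 1) ≤ 2 ^ (q + 1) := Nat.choose_le_two_pow _ _
    calc _ ≤ (2 * (l + 1)) ^ q * (2 ^ (q + 1) * 1) :=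
          Nat.mul_le_mul h1 (Nat.mul_le_mul h2 (by simp))
      _ = (2 ^ q * 2 ^ (q + 1)) * (l + 1) ^ q := by rw [mul_pow]; ring
      _ ≤ 4 ^ (q + 0 + 1) * (0 + l + 1) ^ (q + 0 + 1) := by
          refine Nat.mul_le_mul ?_ ?_
          · rw [show (4 : ℕ) = 2 * 2 by norm_num, mul_pow]
            exact Nat.mul_le_mul (Nat.pow_le_pow_right (by norm_num) (by omega)) le_rfl
          · rw [zero_add, add_zero]
            exact Nat.pow_le_pow_right (by omega) (by omega)
  · refine (choose_mul_choose_le hj).trans (Nat.mul_le_mul (Nat.pow_le_pow_left (by norm_num) _) ?_)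
    exact Nat.pow_le_pow_right (by omega) (by omega)

/-- A crude estimate of a component of the generator, in the norm of `ΓL²` and without
uniformity in `τ`, but for all `m`. -/
lemma lintegral_genComp_crude {ρ : Plane → ℝ} (hρ : IsMollifier ρ) {B : ℝ} (hB1 : 1 ≤ B)
    (hB : ∀ q, mollSq ρ q ≤ B) {τ : ℝ} (hτ : 0 < τ)
    {m j n k : ℕ} (hjm : j < m) (hjn : j + 1 ≤ n) (hnk : n + m = k + 2 * j + 1)
    {ψ : (Fin n → Plane) → ℂ} (hψ : Measurable ψ) :
    (m ! : ℝ≥0∞) * ((k ! : ℝ≥0∞) *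
      ∫⁻ p, ENNReal.ofReal ((1 + 1 / 2 * anisoSq τ p) ^ (0 : ℝ)) *
        ‖genComp ρ τ m j n k ψ p‖ₑ ^ 2 ∂(Xi ρ τ k))
      ≤ ENNReal.ofReal (B ^ 2 * τ * (4 ^ n * (m : ℝ) ^ n)) * ((n ! : ℝ≥0∞) *
        ∫⁻ x, ENNReal.ofReal (nu τ * dirSq 0 x) * ‖ψ x‖ₑ ^ 2 ∂(Xi ρ τ n)) := by
  obtain ⟨q, rfl⟩ : ∃ q, n = q + j + 1 := ⟨n - (j + 1), by omega⟩
  obtain ⟨l, rfl⟩ : ∃ l, m = j + l + 1 := ⟨m - (j + 1), by omega⟩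
  obtain rfl : k = q + (l + 1) := by omega
  have hM := massTheta_pos hτ
  have hν := nu_pos τ
  have hψm := hψ.enorm
  set D : ℕ := (q + (l + 1)).choose (l + 1) with hD
  have := lintegral_genComp_le hρ hτ hψ
      (c := fun _ _ => ((D : ℕ) : ℝ≥0∞)) (fun _ => measurable_const)
      (fun p => by
        rw [← Finset.mul_sum]
        refine (sq_sum_le_card_mul _ _).trans (le_of_eq ?_)
        rw [Finset.card_powersetCard, Finset.card_univ, Fintype.card_fin])
      (M := B ^ 2 * τ * D) (by positivity)
      (h := ∫⁻ x, ENNReal.ofReal (nu τ * dirSq 0 x) * ‖ψ x‖ₑ ^ 2 ∂(Xi ρ τ (q + j + 1))) 0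
      (fun I hI => by
        obtain ⟨hne, hcard⟩ := card_compl_of_mem (j := j) (m := j + l + 1)
          (n := q + j + 1) (by omega) (by omega)
          (by rw [show j + l + 1 - j = l + 1 by omega]; exact hI)
        have e := (I.equivFinOfCardEq (Finset.mem_powersetCard.1 hI).2).symm
        have h3 := lintegral_collInt_sq_le hρ τ hcard e (V := fun _ => 1) measurable_const
          (G := fun x => ‖ψ x‖ₑ) (H := fun x => ‖ψ x‖ₑ ^ 2) (hψm.pow_const 2)
          (u := fun _ => 1) measurable_const (Y := fun s => ENNReal.ofReal (nu τ * s 0 ^ 2))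
          (by fun_prop)
          (fun x => by rw [one_mul]) (A := ENNReal.ofReal (B * massTheta τ ^ j))
          (D := ENNReal.ofReal (B * massTheta τ ^ l))
          (fun s => by simpa only [mul_one] using lintegral_fiber_zero hρ hB hτ j s)
          (fun s => by simpa only [mul_one] using lintegral_fiber_zero hρ hB hτ l s)
        simp only [one_mul] at h3
        simp only [Real.rpow_zero, mul_one]
        rw [lintegral_const_mul' _ _ (ENNReal.natCast_ne_top D)]
        refine (mul_le_mul' le_rfl h3).trans ?_
        have h4 : ∫⁻ x, ENNReal.ofReal (nu τ * (∑ i, x (inEquiv hcard (Sum.inl i))) 0 ^ 2) *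
              ‖ψ x‖ₑ ^ 2 ∂(Xi ρ τ (q + j + 1))
            ≤ ENNReal.ofReal (j + 1) *
              ∫⁻ x, ENNReal.ofReal (nu τ * dirSq 0 x) * ‖ψ x‖ₑ ^ 2 ∂(Xi ρ τ (q + j + 1)) := by
          rw [← lintegral_const_mul' _ _ ENNReal.ofReal_ne_top]
          refine lintegral_mono fun x => ?_
          rw [← mul_assoc, ← ENNReal.ofReal_mul (by positivity)]
          refine mul_le_mul' (ENNReal.ofReal_le_ofReal ?_) le_rfl
          have := sq_sum_le_dirSq hcard 0 x
          calc _ ≤ nu τ * ((j + 1) * dirSq 0 x) := by gcongr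
            _ = _ := by ring
        refine (mul_le_mul' le_rfl (mul_le_mul' le_rfl h4)).trans (le_of_eq ?_)
        have e1 : ENNReal.ofReal (B ^ 2 * τ * D * (τ⁻¹ * massTheta τ ^ (j + l)) * (j + 1))
            = D * (ENNReal.ofReal (B * massTheta τ ^ j) * ENNReal.ofReal (B * massTheta τ ^ l) *
              ENNReal.ofReal (j + 1)) := by
          rw [← ENNReal.ofReal_natCast, ← ENNReal.ofReal_mul (by positivity),
            ← ENNReal.ofReal_mul (by positivity), ← ENNReal.ofReal_mul (by positivity)]
          congr 1
          field_simp
          ring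
        rw [e1]
        ring)
  refine this.trans (mul_le_mul' (ENNReal.ofReal_le_ofReal ?_) le_rfl)
  have hn : ((D * ((q + j + 1).choose (j + 1) * (j + l + 1).choose j) : ℕ) : ℝ)
      ≤ ((4 ^ (q + j + 1) * (j + l + 1) ^ (q + j + 1) : ℕ) : ℝ) :=
    Nat.cast_le.2 (choose_mul_choose_le_pow q j l)
  push_cast at hn ⊢
  calc _ = B ^ 2 * τ * ((D : ℝ) * ((q + j + 1).choose (j + 1) * (j + l + 1).choose j)) := by ring
    _ ≤ _ := by gcongr

/-! ### The operator `𝒜^{τ,1}` -/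

lemma sq_genOne_le {ρ : Plane → ℝ} {L : ℝ} (hL : ∀ q, |mollSq ρ q - 1| ≤ L * ‖q‖) {τ : ℝ}
    (hτ : 0 < τ) {n : ℕ} (p : Fin n → Plane) :
    (τ ^ (1 / 2 : ℝ) * nu τ ^ (1 / 2 : ℝ) * ∑ i, p i 0 * (Theta ρ τ (p i) - 1)) ^ 2
      ≤ L ^ 2 * (nu τ * dirSq 0 p * anisoSq τ p) := by
  have hν := nu_pos τ
  have h1 : (∑ i, p i 0 * (Theta ρ τ (p i) - 1)) ^ 2
      ≤ (∑ i, p i 0 ^ 2) * ∑ i, (Theta ρ τ (p i) - 1) ^ 2 :=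
    Finset.sum_mul_sq_le_sq_mul_sq _ _ _
  have h2 : ∑ i, (Theta ρ τ (p i) - 1) ^ 2 ≤ L ^ 2 * (τ⁻¹ * anisoSq τ p) := by
    rw [anisoSq, Finset.mul_sum, Finset.mul_sum]
    refine Finset.sum_le_sum fun i _ => ?_
    have := hL ((Real.sqrt τ)⁻¹ • sqrtR τ (p i))
    rw [← norm_rescale_sq hτ, ← mul_pow, ← sq_abs, Theta_eq_mollSq]
    exact pow_le_pow_left₀ (abs_nonneg _) this 2
  have e1 : (τ ^ (1 / 2 : ℝ)) ^ 2 = τ := by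
    rw [sq]; exact rpow_half_mul_self hτ.le
  have e2 : (nu τ ^ (1 / 2 : ℝ)) ^ 2 = nu τ := by
    rw [sq]; exact rpow_half_mul_self hν.le
  have hd := dirSq_nonneg 0 p
  rw [mul_pow, mul_pow, e1, e2]
  calc τ * nu τ * (∑ i, p i 0 * (Theta ρ τ (p i) - 1)) ^ 2
      ≤ τ * nu τ * (dirSq 0 p * (L ^ 2 * (τ⁻¹ * anisoSq τ p))) := by
        gcongr
        exact h1.trans (mul_le_mul_of_nonneg_left h2 hd)
    _ = (τ * τ⁻¹) * (L ^ 2 * (nu τ * dirSq 0 p * anisoSq τ p)) := by ring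
    _ = _ := by rw [mul_inv_cancel₀ hτ.ne', one_mul]

lemma enorm_genOne_sq_le {ρ : Plane → ℝ} {L : ℝ} (hL : ∀ q, |mollSq ρ q - 1| ≤ L * ‖q‖) {τ : ℝ}
    (hτ : 0 < τ) {n : ℕ} (ψ : (Fin n → Plane) → ℂ) (p : Fin n → Plane) :
    ‖genOne ρ τ ψ p‖ₑ ^ 2
      ≤ ENNReal.ofReal (L ^ 2 * (nu τ * dirSq 0 p * anisoSq τ p)) * ‖ψ p‖ₑ ^ 2 := by
  have hI : ‖-Complex.I‖ₑ = 1 := by simp [← ofReal_norm]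
  rw [genOne, enorm_mul, enorm_mul, mul_pow, mul_pow, enorm_real_sq, hI, one_pow, one_mul]
  exact mul_le_mul' (ENNReal.ofReal_le_ofReal (sq_genOne_le hL hτ p)) le_rfl

lemma lintegral_genOne_le {ρ : Plane → ℝ} {L : ℝ} (hL : ∀ q, |mollSq ρ q - 1| ≤ L * ‖q‖)
    {τ α : ℝ} (hτ : 0 < τ) (h1 : α < 1) {n : ℕ} (ψ : (Fin n → Plane) → ℂ) :
    ∫⁻ p, ENNReal.ofReal ((1 + 1 / 2 * anisoSq τ p) ^ (-1 : ℝ)) *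
        ‖genOne ρ τ ψ p‖ₑ ^ 2 ∂(Xi ρ τ n)
      ≤ ENNReal.ofReal (4 * L ^ 2) *
        ∫⁻ x, ENNReal.ofReal (interpWeight τ α x) * ‖ψ x‖ₑ ^ 2 ∂(Xi ρ τ n) := by
  rw [← lintegral_const_mul' _ _ ENNReal.ofReal_ne_top]
  refine lintegral_mono fun p => ?_
  have ha := anisoSq_nonneg τ p
  have hd := dirSq_nonneg 0 p
  have hν := nu_pos τ
  refine (mul_le_mul' le_rfl (enorm_genOne_sq_le hL hτ ψ p)).trans ?_
  rw [← mul_assoc, ← mul_assoc (ENNReal.ofReal (4 * L ^ 2)),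
    ← ENNReal.ofReal_mul (by positivity), ← ENNReal.ofReal_mul (by positivity)]
  refine mul_le_mul' (ENNReal.ofReal_le_ofReal ?_) le_rfl
  have h2 := half_dirSq_le_interpWeight (τ := τ) h1.le p
  rw [Real.rpow_neg_one, inv_mul_le_iff₀ (by positivity)]
  calc L ^ 2 * (nu τ * dirSq 0 p * anisoSq τ p)
      = 4 * L ^ 2 * ((1 / 2 * anisoSq τ p) * (1 / 2 * (nu τ * dirSq 0 p))) := by ring
    _ ≤ 4 * L ^ 2 * ((1 + 1 / 2 * anisoSq τ p) * interpWeight τ α p) := by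
        gcongr
        linarith
    _ = _ := by ring

/-! ### Norms on the Fock space -/

/-- The square of `fockNorm`. -/
noncomputable def fockSq (ρ : Plane → ℝ) (τ γ : ℝ) (Φ : FockSeq) : ℝ≥0∞ :=
  ∑' n : ℕ, (n ! : ℝ≥0∞) *
    ∫⁻ p, ENNReal.ofReal ((1 + 1 / 2 * anisoSq τ p) ^ γ) * ‖Φ n p‖ₑ ^ 2 ∂(Xi ρ τ n)

lemma fockNorm_eq (ρ : Plane → ℝ) (τ γ : ℝ) (Φ : FockSeq) :
    fockNorm ρ τ γ Φ = fockSq ρ τ γ Φ ^ (1 / 2 : ℝ) := rfl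

lemma measurable_weight (τ γ : ℝ) (n : ℕ) :
    Measurable fun p : Fin n → Plane => ENNReal.ofReal ((1 + 1 / 2 * anisoSq τ p) ^ γ) :=
  (((measurable_anisoSq τ n).const_mul _).const_add _ |>.pow_const γ).ennreal_ofReal

lemma fockSq_smul (ρ : Plane → ℝ) (τ γ : ℝ) (c : ℂ) (Φ : FockSeq) :
    fockSq ρ τ γ (c • Φ) = ‖c‖ₑ ^ 2 * fockSq ρ τ γ Φ := by
  unfold fockSq
  rw [← ENNReal.tsum_mul_left]
  refine tsum_congr fun n => ?_
  have hc : ‖c‖ₑ ^ 2 ≠ ⊤ := ENNReal.pow_ne_top enorm_ne_top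
  rw [mul_left_comm, ← lintegral_const_mul' _ _ hc]
  congr 1
  refine lintegral_congr fun p => ?_
  rw [Pi.smul_apply, Pi.smul_apply, smul_eq_mul, enorm_mul, mul_pow]
  ring

lemma lintegral_lt_top_of_fockNorm {ρ : Plane → ℝ} {τ : ℝ} {Φ : FockSeq}
    (h : fockNorm ρ τ 0 Φ < ⊤) (n : ℕ) : ∫⁻ x, ‖Φ n x‖ₑ ^ 2 ∂(Xi ρ τ n) < ⊤ := by
  rw [fockNorm_eq, ENNReal.rpow_lt_top_iff_of_pos (by norm_num)] at h
  have h1 := (ENNReal.le_tsum (f := fun n : ℕ => (n ! : ℝ≥0∞) * ∫⁻ p,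
    ENNReal.ofReal ((1 + 1 / 2 * anisoSq τ p) ^ (0 : ℝ)) * ‖Φ n p‖ₑ ^ 2 ∂(Xi ρ τ n)) n).trans_lt h
  simp only [Real.rpow_zero, ENNReal.ofReal_one, one_mul] at h1
  refine lt_of_le_of_lt ?_ h1
  have hn : (1 : ℝ≥0∞) ≤ (n ! : ℝ≥0∞) := by exact_mod_cast n.factorial_pos
  calc _ = 1 * ∫⁻ x, ‖Φ n x‖ₑ ^ 2 ∂(Xi ρ τ n) := (one_mul _).symm
    _ ≤ _ := mul_le_mul' hn le_rfl

/-- Hölder's inequality for series with values in `[0, ∞]`. -/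
lemma tsum_rpow_mul_rpow_le (f g : ℕ → ℝ≥0∞) {p q : ℝ} (hp : 0 ≤ p) (hq : 0 ≤ q)
    (hpq : p + q = 1) :
    ∑' n, f n ^ p * g n ^ q ≤ (∑' n, f n) ^ p * (∑' n, g n) ^ q := by
  simp only [← lintegral_count]
  exact ENNReal.lintegral_mul_norm_pow_le (measurable_of_countable f).aemeasurable
    (measurable_of_countable g).aemeasurable hp hq hpq

/-- The Cauchy-Schwarz inequality for series, in weighted form. -/
lemma sq_tsum_le (a b : ℕ → ℝ≥0∞) (h0 : ∀ i, b i ≠ 0) (h1 : ∀ i, b i ≠ ⊤) :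
    (∑' i, a i) ^ 2 ≤ (∑' i, b i) * ∑' i, (b i)⁻¹ * a i ^ 2 := by
  simp only [← lintegral_count]
  refine sq_lintegral_le (measurable_of_countable _) (measurable_of_countable _) fun i => ?_
  rw [← mul_assoc, ENNReal.mul_inv_cancel (h0 i) (h1 i), one_mul]

/-- The triangle inequality for a series of sequences of kernels that is dominated, term by term,
by the series `∑ bᵢ`. -/
lemma fockSq_le_of_enorm_le_tsum {ρ : Plane → ℝ} {τ γ : ℝ} {Φ : FockSeq} {x : ℕ → FockSeq}
    (hx : ∀ i n, Measurable (x i n)) (h : ∀ n p, ‖Φ n p‖ₑ ≤ ∑' i, ‖x i n p‖ₑ) {b : ℕ → ℝ≥0∞}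
    (h0 : ∀ i, b i ≠ 0) (h1 : ∀ i, b i ≠ ⊤) {Y : ℝ≥0∞}
    (hle : ∀ i, fockSq ρ τ γ (x i) ≤ b i ^ 2 * Y) :
    fockSq ρ τ γ Φ ≤ (∑' i, b i) ^ 2 * Y := by
  have hw := measurable_weight τ γ
  have key : ∀ n : ℕ, (n ! : ℝ≥0∞) *
      ∫⁻ p, ENNReal.ofReal ((1 + 1 / 2 * anisoSq τ p) ^ γ) * ‖Φ n p‖ₑ ^ 2 ∂(Xi ρ τ n)
      ≤ (∑' i, b i) * ∑' i, (b i)⁻¹ * ((n ! : ℝ≥0∞) * ∫⁻ p,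
        ENNReal.ofReal ((1 + 1 / 2 * anisoSq τ p) ^ γ) * ‖x i n p‖ₑ ^ 2 ∂(Xi ρ τ n)) := by
    intro n
    have e1 : ∫⁻ p, ENNReal.ofReal ((1 + 1 / 2 * anisoSq τ p) ^ γ) * ‖Φ n p‖ₑ ^ 2 ∂(Xi ρ τ n)
        ≤ ∫⁻ p, (∑' i, b i) * ∑' i, (b i)⁻¹ *
          (ENNReal.ofReal ((1 + 1 / 2 * anisoSq τ p) ^ γ) * ‖x i n p‖ₑ ^ 2) ∂(Xi ρ τ n) := by
      refine lintegral_mono fun p => ?_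
      refine (mul_le_mul' le_rfl ((pow_le_pow_left₀ zero_le (h n p) 2).trans
        (sq_tsum_le _ b h0 h1))).trans (le_of_eq ?_)
      rw [mul_left_comm, ← ENNReal.tsum_mul_left]
      congr 1
      exact tsum_congr fun i => mul_left_comm _ _ _
    have hmeas : ∀ i, Measurable fun p : Fin n → Plane =>
        ENNReal.ofReal ((1 + 1 / 2 * anisoSq τ p) ^ γ) * ‖x i n p‖ₑ ^ 2 := fun i =>
      (hw n).mul ((hx i n).enorm.pow_const 2)
    rw [lintegral_const_mul _ (Measurable.tsum fun i => (hmeas i).const_mul _),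
      lintegral_tsum fun i => ((hmeas i).const_mul _).aemeasurable] at e1
    simp only [lintegral_const_mul _ (hmeas _)] at e1
    refine (mul_le_mul' le_rfl e1).trans (le_of_eq ?_)
    rw [mul_left_comm, ← ENNReal.tsum_mul_left]
    congr 1
    exact tsum_congr fun i => mul_left_comm _ _ _
  refine (ENNReal.tsum_le_tsum key).trans ?_
  rw [ENNReal.tsum_mul_left, ENNReal.tsum_comm, sq, mul_assoc]
  refine mul_le_mul' le_rfl ?_
  rw [← ENNReal.tsum_mul_right]
  refine ENNReal.tsum_le_tsum fun i => ?_
  rw [ENNReal.tsum_mul_left]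
  calc (b i)⁻¹ * fockSq ρ τ γ (x i) ≤ (b i)⁻¹ * (b i ^ 2 * Y) := mul_le_mul' le_rfl (hle i)
    _ = ((b i)⁻¹ * b i) * (b i * Y) := by ring
    _ = _ := by rw [ENNReal.inv_mul_cancel (h0 i) (h1 i), one_mul]

/-! ### Interpolation between the two norms on the right-hand side -/

/-- The interpolated energy of the `n`-th component. -/
noncomputable def interpEnergy (ρ : Plane → ℝ) (τ α : ℝ) (Φ : FockSeq) (n : ℕ) : ℝ≥0∞ :=
  (n ! : ℝ≥0∞) *
    ∫⁻ x, ENNReal.ofReal (interpWeight τ α x) * ‖Φ n x‖ₑ ^ 2 ∂(Xi ρ τ n)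

lemma enorm_numberPow_anisoHalf_sq (τ s : ℝ) (Φ : FockSeq) (n : ℕ) (x : Fin n → Plane) :
    ‖numberPow s (anisoHalf τ Φ) n x‖ₑ ^ 2
      = ENNReal.ofReal (((n : ℝ) ^ s) ^ 2 * (1 / 2 * (nu τ * dirSq 0 x))) * ‖Φ n x‖ₑ ^ 2 := by
  have hd := dirSq_nonneg 0 x
  have hν := nu_pos τ
  rw [numberPow, anisoHalf, diagOp, diagOp, enorm_mul, enorm_mul, mul_pow, mul_pow, enorm_real_sq,
    enorm_real_sq, ← mul_assoc, ← ENNReal.ofReal_mul (sq_nonneg _),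
    show -(nu τ * L0e1Ker n x) = 1 / 2 * (nu τ * dirSq 0 x) by rw [L0e1Ker]; ring,
    Real.sq_sqrt (by positivity)]

lemma numberPow_zero (Φ : FockSeq) : numberPow 0 Φ = Φ := by
  funext n p
  simp [numberPow, diagOp]

lemma tsum_interpEnergy_le {ρ : Plane → ℝ} {τ α : ℝ} (s : ℝ) (h0 : 0 ≤ α) (h1 : α ≤ 1)
    {Φ : FockSeq} (hΦ : ∀ n, Measurable (Φ n)) :
    ∑' n : ℕ, ENNReal.ofReal ((((n : ℝ) ^ s) ^ 2) ^ α) * interpEnergy ρ τ α Φ n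
      ≤ fockSq ρ τ 0 (numberPow s (anisoHalf τ Φ)) ^ α * fockSq ρ τ 1 Φ ^ (1 - α) := by
  have h1' : 0 ≤ 1 - α := by linarith
  refine le_trans (ENNReal.tsum_le_tsum fun n => ?_)
    (tsum_rpow_mul_rpow_le _ _ h0 h1' (by ring))
  rw [ENNReal.mul_rpow_of_nonneg _ _ h0, ENNReal.mul_rpow_of_nonneg _ _ h1', interpEnergy,
    mul_left_comm, mul_mul_mul_comm, ← ENNReal.rpow_add_of_nonneg _ _ h0 h1',
    show α + (1 - α) = 1 by ring, ENNReal.rpow_one]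
  refine mul_le_mul' le_rfl ?_
  rw [← lintegral_const_mul' _ _ ENNReal.ofReal_ne_top]
  have hF : Measurable fun x : Fin n → Plane =>
      ENNReal.ofReal ((1 + 1 / 2 * anisoSq τ x) ^ (0 : ℝ)) *
        ‖numberPow s (anisoHalf τ Φ) n x‖ₑ ^ 2 := by
    simp only [enorm_numberPow_anisoHalf_sq]
    refine (measurable_weight τ 0 n).mul (Measurable.mul ?_ ((hΦ n).enorm.pow_const 2))
    exact ((((measurable_dirSq 0 n).const_mul _).const_mul _).const_mul _).ennreal_ofReal
  have hG : Measurable fun x : Fin n → Plane =>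
      ENNReal.ofReal ((1 + 1 / 2 * anisoSq τ x) ^ (1 : ℝ)) * ‖Φ n x‖ₑ ^ 2 :=
    (measurable_weight τ 1 n).mul ((hΦ n).enorm.pow_const 2)
  refine le_trans (le_of_eq (lintegral_congr fun x => ?_)) (ENNReal.lintegral_mul_norm_pow_le
    hF.aemeasurable hG.aemeasurable h0 h1' (by ring))
  have hd := dirSq_nonneg 0 x
  have hν := nu_pos τ
  have ha := anisoSq_nonneg τ x
  rw [enorm_numberPow_anisoHalf_sq, Real.rpow_zero, ENNReal.ofReal_one, one_mul, Real.rpow_one,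
    ENNReal.mul_rpow_of_nonneg _ _ h0, ENNReal.mul_rpow_of_nonneg _ _ h1', mul_mul_mul_comm,
    ← ENNReal.rpow_add_of_nonneg _ _ h0 h1', show α + (1 - α) = 1 by ring, ENNReal.rpow_one,
    ← mul_assoc, ENNReal.ofReal_rpow_of_nonneg (by positivity) h0,
    ENNReal.ofReal_rpow_of_nonneg (by positivity) h1', ← ENNReal.ofReal_mul (by positivity),
    ← ENNReal.ofReal_mul (by positivity), interpWeight,
    Real.mul_rpow (sq_nonneg _) (by positivity), mul_assoc]

/-- From squares of norms to norms. -/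
lemma fockNorm_le_of_fockSq_le {ρ : Plane → ℝ} {τ α R : ℝ}
    {Ψ Φ₁ Φ₂ : FockSeq}
    (h : fockSq ρ τ (-1) Ψ ≤
      ENNReal.ofReal R ^ 2 * (fockSq ρ τ 0 Φ₁ ^ α * fockSq ρ τ 1 Φ₂ ^ (1 - α))) :
    fockNorm ρ τ (-1) Ψ ≤
      ENNReal.ofReal R * fockNorm ρ τ 0 Φ₁ ^ α * fockNorm ρ τ 1 Φ₂ ^ (1 - α) := by
  have h2 : (0 : ℝ) ≤ 1 / 2 := by norm_num
  simp only [fockNorm_eq]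
  refine (ENNReal.rpow_le_rpow h h2).trans (le_of_eq ?_)
  rw [ENNReal.mul_rpow_of_nonneg _ _ h2, ENNReal.mul_rpow_of_nonneg _ _ h2,
    ← ENNReal.rpow_natCast, ← ENNReal.rpow_mul, ← ENNReal.rpow_mul, ← ENNReal.rpow_mul,
    ← ENNReal.rpow_mul, ← ENNReal.rpow_mul, mul_comm α, mul_comm (1 - α), mul_assoc]
  norm_num

/-! ### Estimates of `𝒜^{τ,m} Φ` -/

lemma genComp_of_not {ρ : Plane → ℝ} {τ : ℝ} {m j n k : ℕ} {ψ : (Fin n → Plane) → ℂ}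
    (h : ¬(j + 1 ≤ n ∧ n + m = k + 2 * j + 1)) : genComp ρ τ m j n k ψ = 0 := by
  funext p
  simp only [genComp, if_neg h, Pi.zero_apply]

lemma tsum_shift_le (h : ℕ → ℝ≥0∞) (d m : ℕ) :
    ∑' k : ℕ, (if m ≤ k + d then h (k + d - m) else 0) ≤ ∑' n, h n := by
  have e : ∑' k : ℕ, (if m ≤ k + d then h (k + d - m) else 0)
      = ∑' k : {k : ℕ | m ≤ k + d}, h ((k : ℕ) + d - m) := by
    rw [tsum_subtype {k : ℕ | m ≤ k + d} fun k => h (k + d - m)]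
    refine tsum_congr fun k => ?_
    by_cases hk : m ≤ k + d <;> simp [Set.indicator, hk]
  rw [e]
  refine ENNReal.tsum_comp_le_tsum_of_injective
    (f := fun k : {k : ℕ | m ≤ k + d} => (k : ℕ) + d - m) (fun a b hab => ?_) h
  have ha : m ≤ (a : ℕ) + d := a.2
  have hb : m ≤ (b : ℕ) + d := b.2
  simp only at hab
  exact Subtype.ext (by omega)

lemma fockSq_genA_le_of_genComp {ρ : Plane → ℝ} (hρ : IsMollifier ρ) {τ γ : ℝ} {m : ℕ}
    (hm : m ≠ 1) {Φ : FockSeq} (hΦ : ∀ n, Measurable (Φ n)) {h : ℕ → ℝ≥0∞}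
    (hle : ∀ j n k, j < m → j + 1 ≤ n → n + m = k + 2 * j + 1 →
      (m ! : ℝ≥0∞) * ((k ! : ℝ≥0∞) *
        ∫⁻ p, ENNReal.ofReal ((1 + 1 / 2 * anisoSq τ p) ^ γ) *
          ‖genComp ρ τ m j n k (Φ n) p‖ₑ ^ 2 ∂(Xi ρ τ k)) ≤ h n) :
    (m ! : ℝ≥0∞) * fockSq ρ τ γ (genA ρ τ m Φ) ≤ (m : ℝ≥0∞) ^ 2 * ∑' n, h n := by
  have hw := measurable_weight τ γ
  have hmeas : ∀ (j n k : ℕ), Measurable fun p : Fin k → Plane =>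
      ENNReal.ofReal ((1 + 1 / 2 * anisoSq τ p) ^ γ) *
        ‖genComp ρ τ m j n k (Φ n) p‖ₑ ^ 2 := fun j n k =>
    (hw k).mul ((measurable_genComp hρ τ m j n k (hΦ n)).enorm.pow_const 2)
  have step : ∀ k : ℕ, (k ! : ℝ≥0∞) *
      ∫⁻ p, ENNReal.ofReal ((1 + 1 / 2 * anisoSq τ p) ^ γ) * ‖genA ρ τ m Φ k p‖ₑ ^ 2 ∂(Xi ρ τ k)
      ≤ (m : ℝ≥0∞) * ∑ j ∈ Finset.range m, (k ! : ℝ≥0∞) *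
        ∫⁻ p, ENNReal.ofReal ((1 + 1 / 2 * anisoSq τ p) ^ γ) *
          ‖genComp ρ τ m j (k + 2 * j + 1 - m) k (Φ (k + 2 * j + 1 - m)) p‖ₑ ^ 2 ∂(Xi ρ τ k) := by
    intro k
    rw [← Finset.mul_sum, mul_left_comm]
    refine mul_le_mul' le_rfl ?_
    rw [← lintegral_finsetSum _ fun j _ => hmeas j _ k,
      ← lintegral_const_mul' _ _ (ENNReal.natCast_ne_top m)]
    refine lintegral_mono fun p => ?_
    simp only [genA, if_neg hm]
    rw [← Finset.mul_sum, mul_left_comm]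
    refine mul_le_mul' le_rfl ?_
    refine (pow_le_pow_left₀ zero_le (enorm_sum_le _ _) 2).trans ?_
    refine (sq_sum_le_card_mul _ _).trans (le_of_eq ?_)
    rw [Finset.card_range]
  have step2 : ∀ j ∈ Finset.range m, ∑' k : ℕ, (m ! : ℝ≥0∞) * ((k ! : ℝ≥0∞) *
        ∫⁻ p, ENNReal.ofReal ((1 + 1 / 2 * anisoSq τ p) ^ γ) *
          ‖genComp ρ τ m j (k + 2 * j + 1 - m) k (Φ (k + 2 * j + 1 - m)) p‖ₑ ^ 2 ∂(Xi ρ τ k))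
      ≤ ∑' n, h n := by
    intro j hj
    refine le_trans (ENNReal.tsum_le_tsum fun k => ?_) (tsum_shift_le h (2 * j + 1) m)
    by_cases hc : j + 1 ≤ k + 2 * j + 1 - m ∧ k + 2 * j + 1 - m + m = k + 2 * j + 1
    · rw [if_pos (by omega)]
      exact hle j _ k (Finset.mem_range.1 hj) hc.1 hc.2
    · rw [genComp_of_not hc]
      simp
  calc (m ! : ℝ≥0∞) * fockSq ρ τ γ (genA ρ τ m Φ)
      ≤ (m ! : ℝ≥0∞) * ∑' k : ℕ, (m : ℝ≥0∞) * ∑ j ∈ Finset.range m, (k ! : ℝ≥0∞) *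
        ∫⁻ p, ENNReal.ofReal ((1 + 1 / 2 * anisoSq τ p) ^ γ) *
          ‖genComp ρ τ m j (k + 2 * j + 1 - m) k (Φ (k + 2 * j + 1 - m)) p‖ₑ ^ 2 ∂(Xi ρ τ k) :=
        mul_le_mul' le_rfl (ENNReal.tsum_le_tsum step)
    _ = (m : ℝ≥0∞) * ∑ j ∈ Finset.range m, ∑' k : ℕ, (m ! : ℝ≥0∞) * ((k ! : ℝ≥0∞) *
        ∫⁻ p, ENNReal.ofReal ((1 + 1 / 2 * anisoSq τ p) ^ γ) *
          ‖genComp ρ τ m j (k + 2 * j + 1 - m) k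
            (Φ (k + 2 * j + 1 - m)) p‖ₑ ^ 2 ∂(Xi ρ τ k)) := by
        rw [ENNReal.tsum_mul_left, mul_left_comm,
          Summable.tsum_finsetSum fun _ _ => ENNReal.summable, Finset.mul_sum]
        simp only [ENNReal.tsum_mul_left]
    _ ≤ (m : ℝ≥0∞) * ∑ j ∈ Finset.range m, ∑' n, h n :=
        mul_le_mul' le_rfl (Finset.sum_le_sum step2)
    _ = _ := by
        rw [Finset.sum_const, Finset.card_range, nsmul_eq_mul]
        ring

/-- The estimate of `𝒜^{τ,m} Φ` in the norm of `ΓH⁻¹`, in terms of the interpolated energies. -/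
lemma fockSq_genA_le {ρ : Plane → ℝ} (hρ : IsMollifier ρ) {α K L : ℝ}
    (hK : OneParticleBound ρ α K) (hL : ∀ q, |mollSq ρ q - 1| ≤ L * ‖q‖) (h0 : 0 < α)
    (h1 : α < 1) {τ : ℝ} (hτ : 0 < τ) {m : ℕ} (hm1 : 1 ≤ m) (hm2 : m ≠ 2) {Φ : FockSeq}
    (hΦ : ∀ n, Measurable (Φ n)) {χ : ℕ → ℝ} (hχ : ∀ n, 0 ≤ χ n)
    (hs : ∀ n, 1 ≤ n → FourierSuppIn ρ τ Φ n {p | anisoSq τ p ≤ τ * χ n}) {g : ℕ → ℝ≥0∞}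
    (hg : ∀ n : ℕ, 1 ≤ n →
      ENNReal.ofReal ((n : ℝ) ^ 3 * (m : ℝ) ^ 3 + χ n * 4 ^ n * (m : ℝ) ^ n) ≤ g n) :
    (m ! : ℝ≥0∞) * fockSq ρ τ (-1) (genA ρ τ m Φ) ≤
      ENNReal.ofReal (16 * K ^ 5 + 4 * L ^ 2) * ∑' n, g n ^ 2 * interpEnergy ρ τ α Φ n := by
  have hK1 := hK.one_le
  have hm0 : (1 : ℝ) ≤ m := by exact_mod_cast hm1
  by_cases h : m = 1
  · subst h
    rw [Nat.factorial_one, Nat.cast_one, one_mul, fockSq, ← ENNReal.tsum_mul_left]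
    refine ENNReal.tsum_le_tsum fun n => ?_
    simp only [genA, if_true]
    rcases Nat.eq_zero_or_pos n with rfl | hn
    · simp [genOne]
    · have hg1 : (1 : ℝ≥0∞) ≤ g n ^ 2 := by
        refine one_le_pow₀ (le_trans ?_ (hg n hn))
        rw [← ENNReal.ofReal_one]
        refine ENNReal.ofReal_le_ofReal ?_
        have h2 : (1 : ℝ) ≤ (n : ℝ) ^ 3 := one_le_pow₀ (by exact_mod_cast hn)
        have := hχ n
        have h3 : 0 ≤ χ n * 4 ^ n * ((1 : ℕ) : ℝ) ^ n := by positivity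
        simp only [Nat.cast_one, one_pow, mul_one] at h3 ⊢
        linarith
      calc _ ≤ (n ! : ℝ≥0∞) * (ENNReal.ofReal (4 * L ^ 2) * ∫⁻ x,
              ENNReal.ofReal (interpWeight τ α x) * ‖Φ n x‖ₑ ^ 2 ∂(Xi ρ τ n)) :=
            mul_le_mul' le_rfl (lintegral_genOne_le hL hτ h1 _)
        _ = ENNReal.ofReal (4 * L ^ 2) * (1 * interpEnergy ρ τ α Φ n) := by
            rw [interpEnergy]; ring
        _ ≤ _ := by
            gcongr
            · have : 0 ≤ 16 * K ^ 5 := by positivity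
              linarith
  · have hm3 : 3 ≤ m := by omega
    refine (fockSq_genA_le_of_genComp hρ h hΦ (h := fun n =>
      if n = 0 then 0 else ENNReal.ofReal (16 * K ^ 5 * compBound n m (χ n) ^ 2) *
        interpEnergy ρ τ α Φ n) fun j n k hjm hjn hnk => ?_).trans ?_
    · rw [if_neg (by omega)]
      exact lintegral_genComp_supp_le hρ hK h0 h1 hτ (hχ n) hm3 hjm hjn hnk (hΦ n)
        (hs n (by omega))
    · rw [← ENNReal.tsum_mul_left, ← ENNReal.tsum_mul_left]
      refine ENNReal.tsum_le_tsum fun n => ?_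
      rcases Nat.eq_zero_or_pos n with rfl | hn
      · simp
      · rw [if_neg (by omega), ← mul_assoc, ← mul_assoc]
        refine mul_le_mul' ?_ le_rfl
        have hcb : (m : ℝ) * compBound n m (χ n)
            = (n : ℝ) ^ 3 * (m : ℝ) ^ 3 + χ n * 4 ^ n * (m : ℝ) ^ n := by
          obtain ⟨n, rfl⟩ : ∃ n', n = n' + 1 := ⟨n - 1, by omega⟩
          rw [compBound, Nat.add_sub_cancel]
          ring
        have hχn := hχ n
        calc (m : ℝ≥0∞) ^ 2 * ENNReal.ofReal (16 * K ^ 5 * compBound n m (χ n) ^ 2)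
            = ENNReal.ofReal (16 * K ^ 5) * ENNReal.ofReal (m * compBound n m (χ n)) ^ 2 := by
              rw [← ENNReal.ofReal_natCast, ← ENNReal.ofReal_pow (by positivity),
                ← ENNReal.ofReal_pow (by rw [hcb]; positivity),
                ← ENNReal.ofReal_mul (by positivity), ← ENNReal.ofReal_mul (by positivity)]
              congr 1
              ring
          _ ≤ ENNReal.ofReal (16 * K ^ 5 + 4 * L ^ 2) * g n ^ 2 := by
              rw [hcb]
              gcongr
              · nlinarith [sq_nonneg L]
              · exact hg n hn

/-- A crude estimate of `𝒜^{τ,m} Φ` in `ΓL²`, without uniformity in `τ` and `Φ`: the growth in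
`m` is polynomial, up to the factor `√m!`. -/
lemma exists_fockSq_genA_crude {ρ : Plane → ℝ} (hρ : IsMollifier ρ) {τ : ℝ} (hτ : 0 < τ)
    {Φ : FockSeq} (hΦ : ∀ n, Measurable (Φ n)) (h2 : ∀ n, ∫⁻ x, ‖Φ n x‖ₑ ^ 2 ∂(Xi ρ τ n) < ⊤)
    {N : ℕ} (hN : ∀ n, N ≤ n → Φ n = 0) {χ : ℕ → ℝ}
    (hs : ∀ n, 1 ≤ n → FourierSuppIn ρ τ Φ n {p | anisoSq τ p ≤ τ * χ n}) :
    ∃ Y : ℝ≥0∞, Y ≠ ⊤ ∧ ∀ m : ℕ, (m ! : ℝ≥0∞) * fockSq ρ τ 0 (genA ρ τ m Φ)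
      ≤ ENNReal.ofReal (((m : ℝ) + 1) ^ (N + 2)) ^ 2 * Y := by
  obtain ⟨B, hB1, hB⟩ := hρ.exists_mollSq_le
  obtain ⟨L, hL0, hL⟩ := hρ.exists_abs_mollSq_sub_one_le
  have hν := nu_pos τ
  -- on the support of `Φ`, the multipliers `ν_τ |𝔢₁ · p|²` and `|√R_τ p|²` are bounded
  have hsupp : ∀ n, ∀ᵐ x ∂(Xi ρ τ n), Φ n x ≠ 0 → anisoSq τ x ≤ |τ * χ n| := by
    intro n
    rcases Nat.eq_zero_or_pos n with rfl | hn
    · refine Eventually.of_forall fun x _ => ?_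
      rw [anisoSq, Finset.univ_eq_empty, Finset.sum_empty]
      exact abs_nonneg _
    · filter_upwards [hs n hn] with x hx hne
      by_contra hc
      refine hne (hx fun hmem => hc ?_)
      exact le_trans hmem (le_abs_self _)
  have hfin : ∀ (f : (n : ℕ) → (Fin n → Plane) → ℝ) (M : ℕ → ℝ),
      (∀ n x, anisoSq τ x ≤ |τ * χ n| → f n x ≤ M n) →
      ∑' n : ℕ, (n ! : ℝ≥0∞) * ∫⁻ x, ENNReal.ofReal (f n x) * ‖Φ n x‖ₑ ^ 2 ∂(Xi ρ τ n) ≠ ⊤ := by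
    intro f M hfM
    rw [tsum_eq_sum (s := Finset.range N)]
    · refine ENNReal.sum_ne_top.2 fun n _ => ?_
      refine ENNReal.mul_ne_top (ENNReal.natCast_ne_top _) (ne_of_lt ?_)
      refine lt_of_le_of_lt (b := ENNReal.ofReal (M n) * ∫⁻ x, ‖Φ n x‖ₑ ^ 2 ∂(Xi ρ τ n)) ?_
        (ENNReal.mul_lt_top ENNReal.ofReal_lt_top (h2 n))
      rw [← lintegral_const_mul' _ _ ENNReal.ofReal_ne_top]
      refine lintegral_mono_ae ?_
      filter_upwards [hsupp n] with x hx
      by_cases hz : Φ n x = 0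
      · simp [hz]
      · exact mul_le_mul' (ENNReal.ofReal_le_ofReal (hfM n x (hx hz))) le_rfl
    · intro n hn
      simp [hN n (by simpa using hn)]
  have hZ := hfin (fun n x => nu τ * dirSq 0 x) (fun n => |τ * χ n|) fun n x hx =>
    (nu_mul_dirSq_le τ x).trans hx
  have hZ1 := hfin (fun n x => nu τ * dirSq 0 x * anisoSq τ x) (fun n => |τ * χ n| * |τ * χ n|)
    fun n x hx => mul_le_mul ((nu_mul_dirSq_le τ x).trans hx) hx (anisoSq_nonneg τ x)
      (abs_nonneg _)
  set Z := ∑' n : ℕ, (n ! : ℝ≥0∞) *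
    ∫⁻ x, ENNReal.ofReal (nu τ * dirSq 0 x) * ‖Φ n x‖ₑ ^ 2 ∂(Xi ρ τ n) with hZdef
  set Z1 := ∑' n : ℕ, (n ! : ℝ≥0∞) *
    ∫⁻ x, ENNReal.ofReal (nu τ * dirSq 0 x * anisoSq τ x) * ‖Φ n x‖ₑ ^ 2 ∂(Xi ρ τ n) with hZ1def
  refine ⟨ENNReal.ofReal (B ^ 2 * τ * 4 ^ N) * Z + ENNReal.ofReal (L ^ 2) * Z1,
    ENNReal.add_ne_top.2 ⟨ENNReal.mul_ne_top ENNReal.ofReal_ne_top hZ,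
      ENNReal.mul_ne_top ENNReal.ofReal_ne_top hZ1⟩, fun m => ?_⟩
  have hone : (1 : ℝ) ≤ (m : ℝ) + 1 := by linarith [Nat.cast_nonneg (α := ℝ) m]
  by_cases hm : m = 1
  · subst hm
    have h3 : fockSq ρ τ 0 (genA ρ τ 1 Φ) ≤ ENNReal.ofReal (L ^ 2) * Z1 := by
      rw [fockSq, hZ1def, ← ENNReal.tsum_mul_left]
      refine ENNReal.tsum_le_tsum fun n => ?_
      rw [mul_left_comm, ← lintegral_const_mul' _ _ ENNReal.ofReal_ne_top]
      refine mul_le_mul' le_rfl (lintegral_mono fun x => ?_)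
      simp only [genA, if_true, Real.rpow_zero, ENNReal.ofReal_one, one_mul]
      refine (enorm_genOne_sq_le hL hτ _ x).trans (le_of_eq ?_)
      rw [ENNReal.ofReal_mul (by positivity), mul_assoc]
    calc _ = 1 * fockSq ρ τ 0 (genA ρ τ 1 Φ) := by simp
      _ ≤ _ := by
        refine mul_le_mul' (one_le_pow₀ ?_) (h3.trans le_add_self)
        rw [← ENNReal.ofReal_one]
        exact ENNReal.ofReal_le_ofReal (one_le_pow₀ hone)
  · refine (fockSq_genA_le_of_genComp hρ hm hΦ (h := fun n =>
      ENNReal.ofReal (B ^ 2 * τ * (4 ^ N * ((m : ℝ) + 1) ^ N)) * ((n ! : ℝ≥0∞) *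
        ∫⁻ x, ENNReal.ofReal (nu τ * dirSq 0 x) * ‖Φ n x‖ₑ ^ 2 ∂(Xi ρ τ n)))
      fun j n k hjm hjn hnk => ?_).trans ?_
    · rcases le_or_gt N n with hNn | hNn
      · rw [hN n hNn]
        have : genComp ρ τ m j n k (0 : (Fin n → Plane) → ℂ) = 0 := by
          funext p
          simp [genComp, collideIntegrand]
        simp [this]
      · refine (lintegral_genComp_crude hρ hB1 hB hτ hjm hjn hnk (hΦ n)).trans ?_
        gcongr
        · norm_num
        · calc (m : ℝ) ^ n ≤ ((m : ℝ) + 1) ^ n := by gcongr; linarith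
            _ ≤ _ := pow_le_pow_right₀ hone hNn.le
    · rw [ENNReal.tsum_mul_left, ← hZdef]
      refine le_trans ?_ (mul_le_mul' le_rfl le_self_add)
      rw [← mul_assoc ((m : ℝ≥0∞) ^ 2), ← mul_assoc (ENNReal.ofReal _ ^ 2)]
      refine mul_le_mul' ?_ le_rfl
      rw [← ENNReal.ofReal_natCast, ← ENNReal.ofReal_pow (by positivity),
        ← ENNReal.ofReal_pow (by positivity), ← ENNReal.ofReal_mul (by positivity),
        ← ENNReal.ofReal_mul (by positivity)]
      refine ENNReal.ofReal_le_ofReal ?_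
      calc (m : ℝ) ^ 2 * (B ^ 2 * τ * (4 ^ N * ((m : ℝ) + 1) ^ N))
          ≤ ((m : ℝ) + 1) ^ 2 * (B ^ 2 * τ * (4 ^ N * ((m : ℝ) + 1) ^ N)) := by
            gcongr; linarith
        _ = ((m : ℝ) + 1) ^ (N + 2) * (B ^ 2 * τ * 4 ^ N) := by ring
        _ ≤ (((m : ℝ) + 1) ^ (N + 2)) ^ 2 * (B ^ 2 * τ * 4 ^ N) := by
            gcongr
            rw [sq]
            exact le_mul_of_one_le_left (by positivity) (one_le_pow₀ hone)

/-! ### The estimate on a fixed chaos -/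

lemma interpEnergy_of_eq_zero {ρ : Plane → ℝ} {τ α : ℝ} {Φ : FockSeq} {n : ℕ} (h : Φ n = 0) :
    interpEnergy ρ τ α Φ n = 0 := by
  simp [interpEnergy, h]

lemma enorm_sqrt_factorial_sq (m : ℕ) :
    ‖((Real.sqrt (m ! : ℝ) : ℝ) : ℂ)‖ₑ ^ 2 = (m ! : ℝ≥0∞) := by
  rw [enorm_real_sq, Real.sq_sqrt (Nat.cast_nonneg _), ENNReal.ofReal_natCast]

theorem fockNorm_genA_le_of_single {ρ : Plane → ℝ} (hρ : IsMollifier ρ) {α : ℝ} (h0 : 0 < α)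
    (h1 : α < 1) : ∃ C : ℝ, 0 < C ∧
      ∀ (τ : ℝ) (m n : ℕ) (χ : ℝ) (Φ : FockSeq),
        0 < τ → 1 ≤ m → m ≠ 2 → 0 ≤ χ → χ ≤ 1 →
        IsFock ρ τ Φ → (∀ k, k ≠ n → Φ k = 0) →
        FourierSuppIn ρ τ Φ n {p | anisoSq τ p ≤ τ * χ} →
        GenConverges ρ τ m Φ ∧
        fockNorm ρ τ (-1) ((Real.sqrt (m ! : ℝ) : ℂ) • genA ρ τ m Φ) ≤
          ENNReal.ofReal (C * ((n : ℝ) ^ 3 * (m : ℝ) ^ 3 + χ * 4 ^ n * (m : ℝ) ^ n)) *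
            fockNorm ρ τ 0 (anisoHalf τ Φ) ^ α * fockNorm ρ τ 1 Φ ^ (1 - α) := by
  obtain ⟨K, hK⟩ := exists_oneParticleBound hρ h0 h1
  obtain ⟨L, hL0, hL⟩ := hρ.exists_abs_mollSq_sub_one_le
  have hK1 := hK.one_le
  have hQ : 0 < 16 * K ^ 5 + 4 * L ^ 2 := by positivity
  refine ⟨Real.sqrt (16 * K ^ 5 + 4 * L ^ 2), Real.sqrt_pos.2 hQ, ?_⟩
  intro τ m n χ Φ hτ hm1 hm2 hχ0 _ hΦ hone hsupp
  refine ⟨genConverges_of_lintegral_lt_top hρ hτ hΦ.measurable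
    (lintegral_lt_top_of_fockNorm hΦ.norm_lt_top) m, ?_⟩
  have hs : ∀ k, 1 ≤ k → FourierSuppIn ρ τ Φ k {p | anisoSq τ p ≤ τ * χ} := by
    intro k _
    by_cases hk : k = n
    · rw [hk]
      exact hsupp
    · exact Eventually.of_forall fun p _ => by rw [hone k hk, Pi.zero_apply]
  have h2 := fockSq_genA_le hρ hK hL h0 h1 hτ hm1 hm2 hΦ.measurable (χ := fun _ => χ)
    (fun _ => hχ0) hs (g := fun k =>
      ENNReal.ofReal ((k : ℝ) ^ 3 * (m : ℝ) ^ 3 + χ * 4 ^ k * (m : ℝ) ^ k)) fun _ _ => le_rfl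
  have h3 := tsum_interpEnergy_le (ρ := ρ) (τ := τ) 0 h0.le h1.le hΦ.measurable
  rw [numberPow_zero] at h3
  simp only [Real.rpow_zero, one_pow, Real.one_rpow, ENNReal.ofReal_one, one_mul] at h3
  refine fockNorm_le_of_fockSq_le ?_
  rw [fockSq_smul, enorm_sqrt_factorial_sq]
  refine h2.trans ?_
  have h4 : ∑' k : ℕ, ENNReal.ofReal ((k : ℝ) ^ 3 * (m : ℝ) ^ 3 + χ * 4 ^ k * (m : ℝ) ^ k) ^ 2 *
        interpEnergy ρ τ α Φ k
      = ENNReal.ofReal ((n : ℝ) ^ 3 * (m : ℝ) ^ 3 + χ * 4 ^ n * (m : ℝ) ^ n) ^ 2 *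
        ∑' k : ℕ, interpEnergy ρ τ α Φ k := by
    rw [← ENNReal.tsum_mul_left]
    refine tsum_congr fun k => ?_
    by_cases hk : k = n
    · rw [hk]
    · rw [interpEnergy_of_eq_zero (hone k hk), mul_zero, mul_zero]
  rw [h4, ENNReal.ofReal_mul (Real.sqrt_nonneg _), mul_pow,
    ← ENNReal.ofReal_pow (Real.sqrt_nonneg _), Real.sq_sqrt hQ.le,
    mul_assoc (ENNReal.ofReal (16 * K ^ 5 + 4 * L ^ 2))]
  exact mul_le_mul' le_rfl (mul_le_mul' le_rfl h3)

/-! ### Hermite expansions -/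

/-- `f` is dominated by a multiple of `exp (κ y²)`. -/
def GaussBound (κ : ℝ) (f : ℝ → ℝ) : Prop := ∃ M : ℝ, ∀ y, |f y| ≤ M * Real.exp (κ * y ^ 2)

lemma GaussBound.mul {κ κ' : ℝ} {f g : ℝ → ℝ} (hf : GaussBound κ f) (hg : GaussBound κ' g) :
    GaussBound (κ + κ') fun y => f y * g y := by
  obtain ⟨M, hM⟩ := hf
  obtain ⟨M', hM'⟩ := hg
  refine ⟨M * M', fun y => ?_⟩
  rw [abs_mul, add_mul, Real.exp_add]
  calc _ ≤ (M * Real.exp (κ * y ^ 2)) * (M' * Real.exp (κ' * y ^ 2)) :=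
        mul_le_mul (hM y) (hM' y) (abs_nonneg _) ((abs_nonneg _).trans (hM y))
    _ = _ := by ring

lemma gaussBound_polynomial {ε : ℝ} (hε : 0 < ε) (p : Polynomial ℝ) :
    GaussBound ε fun y => p.eval y := by
  induction p using Polynomial.induction_on' with
  | add p q hp hq =>
    obtain ⟨M, hM⟩ := hp
    obtain ⟨M', hM'⟩ := hq
    refine ⟨M + M', fun y => ?_⟩
    simp only [Polynomial.eval_add, add_mul]
    exact (abs_add_le _ _).trans (add_le_add (hM y) (hM' y))
  | monomial n a =>
    refine ⟨|a| * (1 + (n ! : ℝ) / ε ^ n), fun y => ?_⟩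
    simp only [Polynomial.eval_monomial, abs_mul, mul_assoc, abs_pow]
    refine mul_le_mul_of_nonneg_left ?_ (abs_nonneg a)
    have h1 : |y| ^ n ≤ 1 + (y ^ 2) ^ n := by
      rw [← sq_abs, ← pow_mul, mul_comm 2 n, pow_mul]
      nlinarith [sq_nonneg (|y| ^ n - 1)]
    have h2 : (y ^ 2) ^ n ≤ (n ! : ℝ) / ε ^ n * Real.exp (ε * y ^ 2) := by
      have := Real.pow_div_factorial_le_exp (ε * y ^ 2) (by positivity) n
      rw [div_le_iff₀ (by positivity), mul_pow] at this
      rw [div_mul_eq_mul_div, le_div_iff₀ (by positivity)]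
      linarith
    have h3 : 1 ≤ Real.exp (ε * y ^ 2) := Real.one_le_exp (by positivity)
    linarith

lemma integrable_gaussian_of_gaussBound {κ : ℝ} (hκ : κ < 1 / 2) {f : ℝ → ℝ} (hf : Continuous f)
    (hb : GaussBound κ f) : Integrable f (gaussianReal 0 1) := by
  obtain ⟨M, hM⟩ := hb
  have hexp : Integrable (fun y => M * Real.exp (κ * y ^ 2)) (gaussianReal 0 1) := by
    refine Integrable.const_mul ?_ M
    rw [gaussianReal_of_var_ne_zero 0 one_ne_zero, gaussianPDF_def,
      integrable_withDensity_iff_integrable_smul' (by fun_prop) (by simp)]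
    have := (integrable_exp_neg_mul_sq (b := 1 / 2 - κ) (by linarith)).const_mul
      (Real.sqrt (2 * Real.pi * (1 : NNReal)))⁻¹
    refine this.congr (Eventually.of_forall fun y => ?_)
    simp only
    rw [ENNReal.toReal_ofReal (gaussianPDFReal_nonneg _ _ _), gaussianPDFReal, smul_eq_mul,
      mul_assoc (Real.sqrt _)⁻¹, ← Real.exp_add]
    congr 2
    simp only [NNReal.coe_one]
    ring
  exact hexp.mono' hf.aestronglyMeasurable (Eventually.of_forall hM)

/-- The probabilists' Hermite polynomials, with real coefficients. -/
noncomputable def hermiteReal (m : ℕ) : Polynomial ℝ :=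
  (Polynomial.hermite m).map (Int.castRingHom ℝ)

lemma hermiteReal_succ (m : ℕ) :
    hermiteReal (m + 1)
      = Polynomial.X * hermiteReal m - Polynomial.derivative (hermiteReal m) := by
  rw [hermiteReal, Polynomial.hermite_succ, Polynomial.map_sub, Polynomial.map_mul,
    Polynomial.map_X, hermiteReal, Polynomial.derivative_map]

lemma hermiteCoeff_eq (F : ℝ → ℝ) (m : ℕ) :
    hermiteCoeff F m = ∫ y, F y * (hermiteReal m).eval y ∂(gaussianReal 0 1) := by
  rw [hermiteCoeff, ← integral_const_mul]
  refine integral_congr_ae (Eventually.of_forall fun y => ?_)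
  have : (m ! : ℝ) ≠ 0 := by positivity
  simp only
  rw [hermiteH, hermiteReal, Polynomial.eval_map, ← algebraMap_int_eq,
    ← Polynomial.aeval_def]
  field_simp

lemma hasDerivAt_gaussianPDFReal (y : ℝ) :
    HasDerivAt (gaussianPDFReal 0 1) (-y * gaussianPDFReal 0 1 y) y := by
  have h : HasDerivAt (fun x : ℝ => -(x - 0) ^ 2 / (2 * ((1 : NNReal) : ℝ))) (-y) y := by
    have := (((hasDerivAt_id y).sub_const 0).pow 2).neg.div_const (2 * ((1 : NNReal) : ℝ))
    refine this.congr_deriv ?_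
    simp
    ring
  have := h.exp.const_mul (Real.sqrt (2 * Real.pi * (1 : NNReal)))⁻¹
  rw [gaussianPDFReal_def]
  refine this.congr_deriv ?_
  ring

/-- Integration by parts against the Gaussian measure. -/
lemma integral_deriv_mul_hermiteReal {κ : ℝ} (hκ : κ < 1 / 2) {f : ℝ → ℝ} (hf : ContDiff ℝ 1 f)
    (hb : GaussBound κ f) (hb' : GaussBound κ (deriv f)) (m : ℕ) :
    ∫ y, deriv f y * (hermiteReal m).eval y ∂(gaussianReal 0 1)
      = ∫ y, f y * (hermiteReal (m + 1)).eval y ∂(gaussianReal 0 1) := by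
  have hε : 0 < (1 / 2 - κ) / 2 := by linarith
  have hκ' : κ + (1 / 2 - κ) / 2 < 1 / 2 := by linarith
  have hint : ∀ (g : ℝ → ℝ), Continuous g → GaussBound κ g → ∀ p : Polynomial ℝ,
      Integrable fun y => g y * (p.eval y * gaussianPDFReal 0 1 y) := by
    intro g hg hgb p
    have := integrable_gaussian_of_gaussBound hκ' (hg.mul p.continuous)
      (hgb.mul (gaussBound_polynomial hε p))
    rw [gaussianReal_of_var_ne_zero 0 one_ne_zero, gaussianPDF_def,
      integrable_withDensity_iff_integrable_smul' (by fun_prop) (by simp)] at this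
    refine this.congr (Eventually.of_forall fun y => ?_)
    simp only
    rw [ENNReal.toReal_ofReal (gaussianPDFReal_nonneg _ _ _), smul_eq_mul, Pi.mul_apply]
    ring
  have hd : ∀ y, HasDerivAt (fun y => (hermiteReal m).eval y * gaussianPDFReal 0 1 y)
      (-(hermiteReal (m + 1)).eval y * gaussianPDFReal 0 1 y) y := by
    intro y
    refine (((hermiteReal m).hasDerivAt y).mul (hasDerivAt_gaussianPDFReal y)).congr_deriv ?_
    rw [hermiteReal_succ, Polynomial.eval_sub, Polynomial.eval_mul, Polynomial.eval_X]
    ring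
  have hc := hf.continuous
  have hc' : Continuous (deriv f) := hf.continuous_deriv le_rfl
  have h := integral_mul_deriv_eq_deriv_mul_of_integrable
    (u := f) (v := fun y => (hermiteReal m).eval y * gaussianPDFReal 0 1 y)
    (u' := deriv f) (v' := fun y => -(hermiteReal (m + 1)).eval y * gaussianPDFReal 0 1 y)
    (fun y _ => (hf.differentiable one_ne_zero y).hasDerivAt) (fun y _ => hd y)
    (by
      have := (hint f hc hb (hermiteReal (m + 1))).neg
      refine this.congr (Eventually.of_forall fun y => ?_)
      simp only [Pi.neg_apply, Pi.mul_apply]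
      ring)
    (hint _ hc' hb' _) (hint _ hc hb _)
  rw [integral_gaussianReal_eq_integral_smul one_ne_zero,
    integral_gaussianReal_eq_integral_smul one_ne_zero]
  calc _ = ∫ y, deriv f y * ((hermiteReal m).eval y * gaussianPDFReal 0 1 y) := by
        refine integral_congr_ae (Eventually.of_forall fun y => ?_)
        simp only [smul_eq_mul]
        ring
    _ = -∫ y, f y * (-(hermiteReal (m + 1)).eval y * gaussianPDFReal 0 1 y) := by rw [h, neg_neg]
    _ = _ := by
        rw [← integral_neg]
        refine integral_congr_ae (Eventually.of_forall fun y => ?_)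
        simp only [smul_eq_mul]
        ring

lemma integral_polynomial_mul_hermiteReal (m : ℕ) (q : Polynomial ℝ) :
    ∫ y, q.eval y * (hermiteReal m).eval y ∂(gaussianReal 0 1)
      = ∫ y, (Polynomial.derivative^[m] q).eval y ∂(gaussianReal 0 1) := by
  induction m generalizing q with
  | zero => simp [hermiteReal]
  | succ m ih =>
    have hd : deriv (fun y => q.eval y) = fun y => (Polynomial.derivative q).eval y := by
      funext y
      exact Polynomial.deriv q
    have := integral_deriv_mul_hermiteReal (κ := 1 / 4) (by norm_num)
      (f := fun y => q.eval y) (by simpa only [Polynomial.coe_aeval_eq_eval] using q.contDiff_aeval (𝕜 := ℝ) 1)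
      (gaussBound_polynomial (by norm_num) q)
      (by rw [hd]; exact gaussBound_polynomial (by norm_num) _) m
    rw [← this, hd, ih, Function.iterate_succ_apply]

lemma natDegree_hermiteReal (m : ℕ) : (hermiteReal m).natDegree = m := by
  rw [hermiteReal, (Polynomial.hermite_monic m).natDegree_map, Polynomial.natDegree_hermite]

lemma integral_hermiteReal_mul_of_lt {m n : ℕ} (h : n < m) :
    ∫ y, (hermiteReal n).eval y * (hermiteReal m).eval y ∂(gaussianReal 0 1) = 0 := by
  rw [integral_polynomial_mul_hermiteReal,
    Polynomial.iterate_derivative_eq_zero (by rwa [natDegree_hermiteReal])]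
  simp

lemma integral_hermiteReal_sq (m : ℕ) :
    ∫ y, (hermiteReal m).eval y * (hermiteReal m).eval y ∂(gaussianReal 0 1) = (m ! : ℝ) := by
  have h : Polynomial.derivative^[m] (hermiteReal m) = Polynomial.C (m ! : ℝ) := by
    ext k
    rw [Polynomial.coeff_iterate_derivative, Polynomial.coeff_C]
    split_ifs with hk
    · subst hk
      have hl : (hermiteReal m).coeff m = 1 := by
        rw [hermiteReal, Polynomial.coeff_map, Polynomial.coeff_hermite_self, map_one]
      rw [zero_add, hl, Nat.descFactorial_self, nsmul_eq_mul, mul_one]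
    · rw [Polynomial.coeff_eq_zero_of_natDegree_lt, smul_zero]
      rw [natDegree_hermiteReal]
      omega
  rw [integral_polynomial_mul_hermiteReal, h]
  simp

lemma integral_hermiteReal_mul (m n : ℕ) :
    ∫ y, (hermiteReal n).eval y * (hermiteReal m).eval y ∂(gaussianReal 0 1)
      = if n = m then (m ! : ℝ) else 0 := by
  split_ifs with h
  · rw [h, integral_hermiteReal_sq]
  · rcases lt_or_gt_of_ne h with h | h
    · exact integral_hermiteReal_mul_of_lt h
    · simp only [mul_comm ((hermiteReal n).eval _)]
      exact integral_hermiteReal_mul_of_lt h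

/-- Bessel's inequality for the Hermite expansion. -/
lemma sum_hermiteCoeff_sq_le {κ : ℝ} (hκ : κ < 1 / 4) {f : ℝ → ℝ} (hf : Continuous f)
    (hb : GaussBound κ f) (N : ℕ) :
    ∑ m ∈ Finset.range N, hermiteCoeff f m ^ 2 / (m ! : ℝ)
      ≤ ∫ y, f y ^ 2 ∂(gaussianReal 0 1) := by
  set P : Polynomial ℝ :=
    ∑ m ∈ Finset.range N, Polynomial.C (hermiteCoeff f m / (m ! : ℝ)) * hermiteReal m with hP
  have hff : Integrable (fun y => f y ^ 2) (gaussianReal 0 1) := by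
    simp only [sq]
    exact integrable_gaussian_of_gaussBound (κ := κ + κ) (by linarith) (hf.mul hf) (hb.mul hb)
  have hfp : ∀ p : Polynomial ℝ, Integrable (fun y => f y * p.eval y) (gaussianReal 0 1) :=
    fun p => integrable_gaussian_of_gaussBound (κ := κ + 1 / 4) (by linarith)
      (hf.mul p.continuous) (hb.mul (gaussBound_polynomial (by norm_num) p))
  have hpp : ∀ p : Polynomial ℝ, Integrable (fun y => p.eval y) (gaussianReal 0 1) :=
    fun p => integrable_gaussian_of_gaussBound (κ := 1 / 4) (by norm_num)
      p.continuous (gaussBound_polynomial (by norm_num) p)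
  set S := ∑ m ∈ Finset.range N, hermiteCoeff f m ^ 2 / (m ! : ℝ) with hS
  have h1 : ∫ y, f y * P.eval y ∂(gaussianReal 0 1) = S := by
    simp only [hP, Polynomial.eval_finsetSum, Finset.mul_sum, Polynomial.eval_mul,
      Polynomial.eval_C]
    rw [integral_finsetSum]
    · refine Finset.sum_congr rfl fun m _ => ?_
      rw [sq, mul_div_right_comm]
      conv_rhs => rw [hermiteCoeff_eq f m, ← integral_const_mul]
      rw [hermiteCoeff_eq f m]
      refine integral_congr_ae (Eventually.of_forall fun y => ?_)
      simp only
      ring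
    · intro m _
      have := hfp (Polynomial.C (hermiteCoeff f m / (m ! : ℝ)) * hermiteReal m)
      simpa only [Polynomial.eval_mul, Polynomial.eval_C] using this
  have h2 : ∀ n < N, ∫ y, (hermiteReal n).eval y * P.eval y ∂(gaussianReal 0 1)
      = hermiteCoeff f n := by
    intro n hn
    simp only [hP, Polynomial.eval_finsetSum, Finset.mul_sum, Polynomial.eval_mul,
      Polynomial.eval_C]
    rw [integral_finsetSum]
    · have : ∀ m ∈ Finset.range N, ∫ y, (hermiteReal n).eval y *
            (hermiteCoeff f m / (m ! : ℝ) * (hermiteReal m).eval y) ∂(gaussianReal 0 1)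
          = if n = m then hermiteCoeff f m else 0 := by
        intro m _
        simp only [mul_left_comm _ (hermiteCoeff f m / (m ! : ℝ))]
        rw [integral_const_mul, integral_hermiteReal_mul]
        have : (m ! : ℝ) ≠ 0 := by positivity
        split_ifs
        · field_simp
        · ring
      rw [Finset.sum_congr rfl this, Finset.sum_ite_eq, if_pos (Finset.mem_range.2 hn)]
    · intro m _
      have := hpp (hermiteReal n * (Polynomial.C (hermiteCoeff f m / (m ! : ℝ)) * hermiteReal m))
      simpa only [Polynomial.eval_mul, Polynomial.eval_C] using this
  have h3 : ∫ y, P.eval y * P.eval y ∂(gaussianReal 0 1) = S := by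
    have : ∀ y, P.eval y * P.eval y = ∑ m ∈ Finset.range N,
        hermiteCoeff f m / (m ! : ℝ) * ((hermiteReal m).eval y * P.eval y) := by
      intro y
      conv_lhs => enter [1]; rw [hP]
      simp only [Polynomial.eval_finsetSum, Finset.sum_mul, Polynomial.eval_mul,
        Polynomial.eval_C, mul_assoc]
    simp only [this]
    rw [integral_finsetSum]
    · refine Finset.sum_congr rfl fun m hm => ?_
      rw [integral_const_mul, h2 m (Finset.mem_range.1 hm)]
      ring
    · intro m _
      have := hpp (hermiteReal m * P)
      simp only [Polynomial.eval_mul] at this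
      exact this.const_mul _
  have h4 : 0 ≤ ∫ y, (f y - P.eval y) ^ 2 ∂(gaussianReal 0 1) :=
    integral_nonneg fun y => sq_nonneg _
  have hPP : Integrable (fun y => P.eval y * P.eval y) (gaussianReal 0 1) := by
    simpa only [Polynomial.eval_mul] using hpp (P * P)
  have h5 : ∫ y, (f y - P.eval y) ^ 2 ∂(gaussianReal 0 1)
      = ∫ y, f y ^ 2 ∂(gaussianReal 0 1) - 2 * S + S := by
    calc _ = ∫ y, (f y ^ 2 - 2 * (f y * P.eval y) + P.eval y * P.eval y)
          ∂(gaussianReal 0 1) := by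
          refine integral_congr_ae (Eventually.of_forall fun y => ?_)
          simp only
          ring
      _ = _ := by
          have e1 : Integrable (fun y => f y ^ 2 - 2 * (f y * P.eval y)) (gaussianReal 0 1) :=
            hff.sub ((hfp P).const_mul 2)
          rw [integral_add e1 hPP, integral_sub hff ((hfp P).const_mul 2), integral_const_mul,
            h1, h3]
  linarith

/-! ### Summability of the Hermite coefficients -/

section Growth

variable {F : ℝ → ℝ} {κ : ℝ} {o : ℕ → ℝ}

lemma hermiteCoeff_iteratedDeriv (hF : ContDiff ℝ (⊤ : ℕ∞) F) (hκ : κ < 1 / 4)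
    (hb : ∀ (n : ℕ) (y : ℝ),
      |iteratedDeriv n F y| ≤ Real.exp (Real.exp (o n)) * Real.exp (κ * y ^ 2)) (i m : ℕ) :
    hermiteCoeff (iteratedDeriv i F) m = hermiteCoeff F (m + i) := by
  induction i generalizing m with
  | zero => rw [iteratedDeriv_zero, add_zero]
  | succ i ih =>
    have h := integral_deriv_mul_hermiteReal (κ := κ) (by linarith)
      (f := iteratedDeriv i F) (by
        rw [iteratedDeriv_eq_iterate]
        exact ContDiff.iterate_deriv' 1 i (hF.of_le (by exact_mod_cast le_top)))
      ⟨_, hb i⟩ (by rw [← iteratedDeriv_succ]; exact ⟨_, hb (i + 1)⟩) m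
    rw [← iteratedDeriv_succ, ← hermiteCoeff_eq, ← hermiteCoeff_eq, ih] at h
    rw [h]
    congr 1
    omega

lemma tsum_hermiteCoeff_add_sq_le (hF : ContDiff ℝ (⊤ : ℕ∞) F) (hκ : κ < 1 / 4)
    (hb : ∀ (n : ℕ) (y : ℝ),
      |iteratedDeriv n F y| ≤ Real.exp (Real.exp (o n)) * Real.exp (κ * y ^ 2)) (i : ℕ) :
    ∑' m : ℕ, ENNReal.ofReal (hermiteCoeff F (m + i) ^ 2 / (m ! : ℝ))
      ≤ ENNReal.ofReal (Real.exp (2 * Real.exp (o i)) *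
        ∫ y, Real.exp (2 * κ * y ^ 2) ∂(gaussianReal 0 1)) := by
  have hc : Continuous (iteratedDeriv i F) := hF.continuous_iteratedDeriv i (by exact_mod_cast le_top)
  rw [ENNReal.tsum_eq_iSup_nat]
  refine iSup_le fun N => ?_
  rw [← ENNReal.ofReal_sum_of_nonneg fun m _ => by positivity]
  refine ENNReal.ofReal_le_ofReal ?_
  have h := sum_hermiteCoeff_sq_le hκ hc ⟨_, hb i⟩ N
  simp only [hermiteCoeff_iteratedDeriv hF hκ hb] at h
  refine h.trans ?_
  rw [← integral_const_mul]
  refine integral_mono_of_nonneg (Eventually.of_forall fun y => sq_nonneg _) ?_ ?_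
  · refine Integrable.const_mul ?_ _
    refine integrable_gaussian_of_gaussBound (κ := 2 * κ) (by linarith) (by fun_prop) ⟨1, fun y => ?_⟩
    rw [abs_of_pos (Real.exp_pos _), one_mul]
  · refine Eventually.of_forall fun y => ?_
    calc iteratedDeriv i F y ^ 2 = |iteratedDeriv i F y| ^ 2 := (sq_abs _).symm
      _ ≤ (Real.exp (Real.exp (o i)) * Real.exp (κ * y ^ 2)) ^ 2 :=
          pow_le_pow_left₀ (abs_nonneg _) (hb i y) 2
      _ = _ := by
          rw [mul_pow, ← Real.exp_nat_mul, ← Real.exp_nat_mul]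
          congr 2
          push_cast
          ring

/-- For `i ≤ m`, `(m + 1)^i / m!` is at most `(i + 1)^i / (m - i)!`. -/
lemma pow_div_factorial_le {i m : ℕ} (h : i ≤ m) :
    ((m : ℝ) + 1) ^ i / (m ! : ℝ) ≤ ((i : ℝ) + 1) ^ i / ((m - i)! : ℝ) := by
  obtain ⟨d, rfl⟩ : ∃ d, m = d + i := ⟨m - i, by omega⟩
  rw [Nat.add_sub_cancel, div_le_div_iff₀ (by positivity) (by positivity)]
  have h1 : (d + i + 1 - i) ^ i ≤ (d + i).descFactorial i := Nat.pow_sub_le_descFactorial _ _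
  have h2 : (d + i - i)! * (d + i).descFactorial i = (d + i)! :=
    Nat.factorial_mul_descFactorial (by omega)
  rw [show d + i + 1 - i = d + 1 by omega] at h1
  rw [Nat.add_sub_cancel] at h2
  have h3 : (d + i + 1) ^ i ≤ ((i + 1) * (d + 1)) ^ i := Nat.pow_le_pow_left (by nlinarith) i
  have h4 : (d + i + 1) ^ i * d ! ≤ (i + 1) ^ i * (d + i)! := by
    rw [← h2]
    calc _ ≤ ((i + 1) * (d + 1)) ^ i * d ! := Nat.mul_le_mul h3 le_rfl
      _ = (i + 1) ^ i * (d ! * (d + 1) ^ i) := by rw [mul_pow]; ring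
      _ ≤ _ := Nat.mul_le_mul le_rfl (Nat.mul_le_mul le_rfl h1)
  exact_mod_cast h4

lemma tsum_hermiteCoeff_sq_mul_pow_le (hF : ContDiff ℝ (⊤ : ℕ∞) F) (hκ : κ < 1 / 4)
    (hb : ∀ (n : ℕ) (y : ℝ),
      |iteratedDeriv n F y| ≤ Real.exp (Real.exp (o n)) * Real.exp (κ * y ^ 2)) (i : ℕ) :
    ∑' m : ℕ, ENNReal.ofReal (hermiteCoeff F m ^ 2 / (m ! : ℝ) * ((m : ℝ) + 1) ^ i)
      ≤ ENNReal.ofReal (((i : ℝ) + 1) ^ i *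
        ((Real.exp (2 * Real.exp (o 0)) + Real.exp (2 * Real.exp (o i))) *
          ∫ y, Real.exp (2 * κ * y ^ 2) ∂(gaussianReal 0 1))) := by
  have hI : 0 ≤ ∫ y, Real.exp (2 * κ * y ^ 2) ∂(gaussianReal 0 1) :=
    integral_nonneg fun y => (Real.exp_pos _).le
  have h0 := tsum_hermiteCoeff_add_sq_le hF hκ hb 0
  have hi := tsum_hermiteCoeff_add_sq_le hF hκ hb i
  rw [ENNReal.ofReal_mul (by positivity), add_mul,
    ENNReal.ofReal_add (by positivity) (by positivity)]
  refine le_trans ?_ (mul_le_mul' le_rfl (add_le_add h0 ((tsum_shift_le _ 0 i).trans hi)))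
  rw [← ENNReal.tsum_add, ← ENNReal.tsum_mul_left]
  refine ENNReal.tsum_le_tsum fun m => ?_
  simp only [add_zero]
  by_cases h : i ≤ m
  · rw [if_pos h, Nat.sub_add_cancel h]
    refine le_trans ?_ (mul_le_mul' le_rfl le_add_self)
    rw [← ENNReal.ofReal_mul (by positivity)]
    refine ENNReal.ofReal_le_ofReal ?_
    have := mul_le_mul_of_nonneg_left (pow_div_factorial_le h) (sq_nonneg (hermiteCoeff F m))
    calc _ = hermiteCoeff F m ^ 2 * (((m : ℝ) + 1) ^ i / (m ! : ℝ)) := by ring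
      _ ≤ _ := this
      _ = _ := by ring
  · rw [if_neg h, add_zero, ← ENNReal.ofReal_mul (by positivity)]
    refine ENNReal.ofReal_le_ofReal ?_
    rw [mul_comm]
    have : (m : ℝ) ≤ i := by exact_mod_cast (not_le.1 h).le
    gcongr

/-- The constant in the bound of `∑ |c_m| (m + 1)^n / √m!`. -/
noncomputable def hermiteMoment (o : ℕ → ℝ) (κ : ℝ) (n : ℕ) : ℝ :=
  Real.sqrt ((∑' m : ℕ, (((m : ℝ) + 1) ^ 2)⁻¹) * ((((2 * n + 2 : ℕ) : ℝ) + 1) ^ (2 * n + 2) *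
    ((Real.exp (2 * Real.exp (o 0)) + Real.exp (2 * Real.exp (o (2 * n + 2)))) *
      ∫ y, Real.exp (2 * κ * y ^ 2) ∂(gaussianReal 0 1))))

lemma summable_inv_succ_sq : Summable fun m : ℕ => (((m : ℝ) + 1) ^ 2)⁻¹ := by
  have h := (summable_nat_add_iff 1).2 (Real.summable_nat_pow_inv.2 (by norm_num : 1 < 2))
  refine h.congr fun m => ?_
  push_cast
  rfl

lemma tsum_abs_hermiteCoeff_le (hF : ContDiff ℝ (⊤ : ℕ∞) F) (hκ : κ < 1 / 4)
    (hb : ∀ (n : ℕ) (y : ℝ),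
      |iteratedDeriv n F y| ≤ Real.exp (Real.exp (o n)) * Real.exp (κ * y ^ 2)) (n : ℕ) :
    ∑' m : ℕ, ENNReal.ofReal (|hermiteCoeff F m| / Real.sqrt (m ! : ℝ) * ((m : ℝ) + 1) ^ n)
      ≤ ENNReal.ofReal (hermiteMoment o κ n) := by
  have h1 := sq_tsum_le
    (fun m : ℕ => ENNReal.ofReal (|hermiteCoeff F m| / Real.sqrt (m ! : ℝ) * ((m : ℝ) + 1) ^ n))
    (fun m : ℕ => ENNReal.ofReal (((m : ℝ) + 1) ^ 2)⁻¹)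
    (fun m => by
      rw [ne_eq, ENNReal.ofReal_eq_zero, not_le]
      positivity)
    (fun m => ENNReal.ofReal_ne_top)
  have hS : 0 ≤ ∑' m : ℕ, (((m : ℝ) + 1) ^ 2)⁻¹ := tsum_nonneg fun m => by positivity
  have hI : 0 ≤ ∫ y, Real.exp (2 * κ * y ^ 2) ∂(gaussianReal 0 1) :=
    integral_nonneg fun y => (Real.exp_pos _).le
  have h2 : ∑' m : ℕ, (ENNReal.ofReal (((m : ℝ) + 1) ^ 2)⁻¹)⁻¹ *
      ENNReal.ofReal (|hermiteCoeff F m| / Real.sqrt (m ! : ℝ) * ((m : ℝ) + 1) ^ n) ^ 2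
      = ∑' m : ℕ, ENNReal.ofReal (hermiteCoeff F m ^ 2 / (m ! : ℝ) *
        ((m : ℝ) + 1) ^ (2 * n + 2)) := by
    refine tsum_congr fun m => ?_
    rw [← ENNReal.ofReal_inv_of_pos (by positivity), inv_inv,
      ← ENNReal.ofReal_pow (by positivity), ← ENNReal.ofReal_mul (by positivity)]
    congr 1
    rw [mul_pow, div_pow, sq_abs, Real.sq_sqrt (Nat.cast_nonneg _)]
    ring
  rw [h2, ← ENNReal.ofReal_tsum_of_nonneg (fun m => by positivity) summable_inv_succ_sq] at h1
  have h3 := h1.trans (mul_le_mul' le_rfl (tsum_hermiteCoeff_sq_mul_pow_le hF hκ hb (2 * n + 2)))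
  rw [← ENNReal.ofReal_mul hS] at h3
  rw [hermiteMoment, Real.sqrt_eq_rpow, ← ENNReal.ofReal_rpow_of_nonneg (by positivity)
    (by norm_num)]
  refine le_trans (le_of_eq ?_) (ENNReal.rpow_le_rpow h3 (by norm_num))
  rw [← ENNReal.rpow_natCast, ← ENNReal.rpow_mul]
  norm_num

/-- The moments of the Hermite coefficients grow so slowly that they are summable against
`χ_n 4^n`. -/
lemma summable_chiSeq_mul_hermiteMoment {c : ℝ} (hc : 0 < c)
    (ho : Tendsto (fun n : ℕ => o n / n) atTop (𝓝 0)) :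
    Summable fun n : ℕ => chiSeq c n * 4 ^ n * hermiteMoment o κ n := by
  set S := ∑' m : ℕ, (((m : ℝ) + 1) ^ 2)⁻¹ with hSdef
  set J := ∫ y, Real.exp (2 * κ * y ^ 2) ∂(gaussianReal 0 1) with hJdef
  have hS : 0 ≤ S := tsum_nonneg fun m => by positivity
  have hJ : 0 ≤ J := integral_nonneg fun y => (Real.exp_pos _).le
  set D := S * (2 * Real.exp (2 * Real.exp (o 0)) * J) with hD
  have hD0 : 0 ≤ D := by positivity
  -- eventually `exp (o (2n + 2)) ≤ exp (cn/2)`, and `exp (cn/2)` beats polynomials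
  have ev1 : ∀ᶠ n : ℕ in atTop, o (2 * n + 2) ≤ c / 2 * n := by
    have ht : Tendsto (fun n : ℕ => 2 * n + 2) atTop atTop :=
      tendsto_atTop_mono (fun n => by simp only [id]; omega) tendsto_id
    have := (ho.comp ht).eventually (gt_mem_nhds (show (0 : ℝ) < c / 8 by positivity))
    filter_upwards [this, eventually_ge_atTop 1] with n hn hn1
    simp only [Function.comp_apply] at hn
    rw [div_lt_iff₀ (by positivity)] at hn
    push_cast at hn
    have h1 : (1 : ℝ) ≤ n := by exact_mod_cast hn1
    nlinarith
  have ev2 : ∀ᶠ n : ℕ in atTop, 20 * (n : ℝ) ^ 2 ≤ Real.exp (c / 2 * n) := by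
    have h := (isLittleO_pow_exp_pos_mul_atTop (k := 2) (show 0 < c / 2 by positivity)).bound
      (show (0 : ℝ) < 1 / 20 by norm_num)
    filter_upwards [tendsto_natCast_atTop_atTop.eventually h] with n hn
    rw [Real.norm_of_nonneg (by positivity), Real.norm_of_nonneg (Real.exp_pos _).le] at hn
    linarith
  have hsum : Summable fun n : ℕ => Real.sqrt D * Real.exp (-(n : ℝ)) :=
    Real.summable_exp_neg_nat.mul_left _
  refine Summable.of_norm_bounded_eventually_nat hsum ?_
  filter_upwards [ev1, ev2, eventually_ge_atTop 1] with n h1 h2 hn1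
  have hn : (1 : ℝ) ≤ n := by exact_mod_cast hn1
  set X := Real.exp (c / 2 * n) with hX
  have hX20 : 20 ≤ X := by nlinarith
  have hXX : Real.exp (c * n) = X ^ 2 := by
    rw [hX, ← Real.exp_nat_mul]
    congr 1
    push_cast
    ring
  have hM : hermiteMoment o κ n
      ≤ Real.sqrt D * Real.exp ((2 * (n : ℝ) + 3) * (n + 1) + X) := by
    rw [hermiteMoment]
    refine (Real.sqrt_le_left (by positivity)).2 ?_
    rw [mul_pow, Real.sq_sqrt hD0]
    have e1 : ((((2 * n + 2 : ℕ) : ℝ) + 1) ^ (2 * n + 2))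
        ≤ Real.exp ((2 * (n : ℝ) + 3) * (2 * n + 2)) := by
      have : (((2 * n + 2 : ℕ) : ℝ) + 1) ≤ Real.exp (2 * n + 3) := by
        have := Real.add_one_le_exp (2 * (n : ℝ) + 3)
        push_cast
        linarith
      calc _ ≤ Real.exp (2 * n + 3) ^ (2 * n + 2) := pow_le_pow_left₀ (by positivity) this _
        _ = _ := by
          rw [← Real.exp_nat_mul]
          congr 1
          push_cast
          ring
    have e2 : Real.exp (2 * Real.exp (o 0)) + Real.exp (2 * Real.exp (o (2 * n + 2)))
        ≤ 2 * Real.exp (2 * Real.exp (o 0)) * Real.exp (2 * X) := by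
      have a1 : Real.exp (o (2 * n + 2)) ≤ X := Real.exp_le_exp.2 h1
      have a2 : Real.exp (2 * Real.exp (o (2 * n + 2))) ≤ Real.exp (2 * X) :=
        Real.exp_le_exp.2 (by linarith)
      have a3 : 1 ≤ Real.exp (2 * Real.exp (o 0)) := Real.one_le_exp (by positivity)
      have a4 : 1 ≤ Real.exp (2 * X) := Real.one_le_exp (by positivity)
      nlinarith
    calc _ ≤ S * (Real.exp ((2 * (n : ℝ) + 3) * (2 * n + 2)) *
          ((2 * Real.exp (2 * Real.exp (o 0)) * Real.exp (2 * X)) * J)) := by gcongr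
      _ = D * (Real.exp ((2 * (n : ℝ) + 3) * (2 * n + 2)) * Real.exp (2 * X)) := by
          rw [hD]; ring
      _ = _ := by
          rw [← Real.exp_add, ← Real.exp_nat_mul]
          congr 2
          push_cast
          ring
  have h4 : (4 : ℝ) ^ n ≤ Real.exp (2 * n) := by
    have : (4 : ℝ) ≤ Real.exp 2 := by
      have := Real.add_one_le_exp (1 : ℝ)
      calc (4 : ℝ) = (1 + 1) * (1 + 1) := by norm_num
        _ ≤ Real.exp 1 * Real.exp 1 := mul_le_mul this this (by norm_num) (Real.exp_pos _).le
        _ = _ := by rw [← Real.exp_add]; norm_num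
    calc (4 : ℝ) ^ n ≤ Real.exp 2 ^ n := pow_le_pow_left₀ (by norm_num) this n
      _ = _ := by
        rw [← Real.exp_nat_mul, mul_comm]
  have hm0 : 0 ≤ hermiteMoment o κ n := Real.sqrt_nonneg _
  rw [Real.norm_of_nonneg (by unfold chiSeq; positivity), chiSeq, hXX]
  calc Real.exp (-X ^ 2) * 4 ^ n * hermiteMoment o κ n
      ≤ Real.exp (-X ^ 2) * Real.exp (2 * n) *
        (Real.sqrt D * Real.exp ((2 * (n : ℝ) + 3) * (n + 1) + X)) := by gcongr
    _ = Real.sqrt D * Real.exp (-X ^ 2 + 2 * n + ((2 * (n : ℝ) + 3) * (n + 1) + X)) := by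
        rw [Real.exp_add (-X ^ 2 + 2 * n), Real.exp_add (-X ^ 2)]; ring
    _ ≤ Real.sqrt D * Real.exp (-(n : ℝ)) := by
        gcongr
        nlinarith

/-- The two facts on the Hermite coefficients that control the sum over `m`. -/
lemma GrowthAssumption.tsum_hermiteCoeff_ne_top (hF : GrowthAssumption F) :
    (∀ n : ℕ, ∑' m : ℕ, ENNReal.ofReal
      (|hermiteCoeff F m| / Real.sqrt (m ! : ℝ) * ((m : ℝ) + 1) ^ n) ≠ ⊤) ∧
    ∀ c : ℝ, 0 < c → ∑' m : ℕ, ENNReal.ofReal (|hermiteCoeff F m| / Real.sqrt (m ! : ℝ)) *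
      ∑' n : ℕ, ENNReal.ofReal (chiSeq c n * 4 ^ n * (m : ℝ) ^ n) ≠ ⊤ := by
  obtain ⟨hsm, κ, -, hκ, o, ho, hb⟩ := hF
  have h1 := tsum_abs_hermiteCoeff_le hsm hκ hb
  refine ⟨fun n => ne_top_of_le_ne_top ENNReal.ofReal_ne_top (h1 n), fun c hc => ?_⟩
  have hχ : ∀ n, 0 ≤ chiSeq c n := fun n => (Real.exp_pos _).le
  have hsum := summable_chiSeq_mul_hermiteMoment (κ := κ) hc ho
  refine ne_top_of_le_ne_top (ENNReal.ofReal_ne_top (r := ∑' n : ℕ,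
    chiSeq c n * 4 ^ n * hermiteMoment o κ n)) ?_
  have hm0 : ∀ n, 0 ≤ hermiteMoment o κ n := fun n => Real.sqrt_nonneg _
  rw [ENNReal.ofReal_tsum_of_nonneg (fun n => by have := hχ n; have := hm0 n; positivity) hsum]
  simp only [← ENNReal.tsum_mul_left]
  rw [ENNReal.tsum_comm]
  refine ENNReal.tsum_le_tsum fun n => ?_
  have hχn := hχ n
  rw [ENNReal.ofReal_mul (by positivity)]
  refine le_trans ?_ (mul_le_mul' le_rfl (h1 n))
  rw [← ENNReal.tsum_mul_left]
  refine ENNReal.tsum_le_tsum fun m => ?_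
  rw [← ENNReal.ofReal_mul (by positivity), ← ENNReal.ofReal_mul (by positivity)]
  refine ENNReal.ofReal_le_ofReal ?_
  calc |hermiteCoeff F m| / Real.sqrt (m ! : ℝ) * (chiSeq c n * 4 ^ n * (m : ℝ) ^ n)
      = chiSeq c n * 4 ^ n * (|hermiteCoeff F m| / Real.sqrt (m ! : ℝ) * (m : ℝ) ^ n) := by ring
    _ ≤ _ := by gcongr; linarith

end Growth

/-! ### Measurability, symmetry and locality in `m` of `𝒜^{τ,m} Φ` -/

lemma measurable_genA {ρ : Plane → ℝ} (hρ : IsMollifier ρ) (τ : ℝ) (m : ℕ) {Φ : FockSeq}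
    (hΦ : ∀ n, Measurable (Φ n)) (k : ℕ) : Measurable (genA ρ τ m Φ k) := by
  by_cases h : m = 1
  · have hT := continuous_Theta hρ τ
    have e : genA ρ τ m Φ k = genOne ρ τ (Φ k) := by
      funext p
      simp only [genA, if_pos h]
    rw [e]
    unfold genOne
    have h1 : Continuous fun p : Fin k → Plane =>
        τ ^ (1 / 2 : ℝ) * nu τ ^ (1 / 2 : ℝ) * ∑ i, p i 0 * (Theta ρ τ (p i) - 1) := by
      fun_prop
    exact ((Complex.continuous_ofReal.comp h1).measurable.const_mul _).mul (hΦ k)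
  · have e : genA ρ τ m Φ k = fun p => ∑ j ∈ Finset.range m,
        genComp ρ τ m j (k + 2 * j + 1 - m) k (Φ (k + 2 * j + 1 - m)) p := by
      funext p
      simp only [genA, if_neg h]
    rw [e]
    exact Finset.measurable_fun_sum _ fun j _ => measurable_genComp hρ τ m j _ k (hΦ _)

lemma sumOn_comp_perm {k : ℕ} (I : Finset (Fin k)) (p : Fin k → Plane) (σ : Equiv.Perm (Fin k)) :
    sumOn I (p ∘ σ) = sumOn (I.map σ.toEmbedding) p := by
  simp [sumOn, Finset.sum_map]

/-- A permutation of the output momenta acts on the input momenta as a permutation of the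
spectators. -/
lemma exists_assemble_comp_perm {j k n : ℕ} {I : Finset (Fin k)} (h : j + 1 + Iᶜ.card = n)
    (σ : Equiv.Perm (Fin k)) : ∃ π : Equiv.Perm (Fin n), ∀ r p,
      assemble n I r (p ∘ σ) = assemble (j := j) n (I.map σ.toEmbedding) r p ∘ π := by
  have hmem : ∀ a, a ∈ Iᶜ ↔ σ a ∈ (I.map σ.toEmbedding)ᶜ := by
    intro a
    simp
  have hcard : (I.map σ.toEmbedding)ᶜ.card = Iᶜ.card := by
    rw [Finset.card_compl, Finset.card_compl, Finset.card_map]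
  have h' : j + 1 + (I.map σ.toEmbedding)ᶜ.card = n := by rw [hcard, h]
  set e : Fin Iᶜ.card ≃ Fin (I.map σ.toEmbedding)ᶜ.card :=
    ((Iᶜ.orderIsoOfFin rfl).toEquiv.trans (σ.subtypeEquiv hmem)).trans
      ((I.map σ.toEmbedding)ᶜ.orderIsoOfFin rfl).symm.toEquiv with he
  have hval : ∀ a, (I.map σ.toEmbedding)ᶜ.orderEmbOfFin rfl (e a)
      = σ (Iᶜ.orderEmbOfFin rfl a) := by
    intro a
    rw [← Finset.coe_orderIsoOfFin_apply, ← Finset.coe_orderIsoOfFin_apply, he]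
    simp
  refine ⟨((inEquiv h).symm.trans (Equiv.sumCongr (Equiv.refl _) e)).trans (inEquiv h'),
    fun r p => ?_⟩
  rw [assemble_eq h, assemble_eq h']
  funext i
  obtain ⟨a, rfl⟩ := (inEquiv h).surjective i
  rcases a with a | a <;> simp [hval]

lemma genComp_comp_perm (ρ : Plane → ℝ) (τ : ℝ) {m j n k : ℕ} (hjm : j < m)
    {ψ : (Fin n → Plane) → ℂ} (hψ : ∀ (π : Equiv.Perm (Fin n)) p, ψ (p ∘ π) = ψ p)
    (σ : Equiv.Perm (Fin k)) (p : Fin k → Plane) :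
    genComp ρ τ m j n k ψ (p ∘ σ) = genComp ρ τ m j n k ψ p := by
  by_cases hc : j + 1 ≤ n ∧ n + m = k + 2 * j + 1
  swap
  · rw [genComp_of_not hc]
    rfl
  simp only [genComp, if_pos hc]
  congr 1
  refine Finset.sum_equiv σ.finsetCongr (fun I => ?_) fun I hI => ?_
  · simp [Finset.mem_powersetCard]
  · have hcard := (card_compl_of_mem hjm hc.2 hI).2
    obtain ⟨π, hπ⟩ := exists_assemble_comp_perm hcard σ
    rw [sumOn_comp_perm, Equiv.finsetCongr_apply]
    congr 1
    refine integral_congr_ae (Eventually.of_forall fun r => ?_)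
    simp only [collideIntegrand, sumOn_comp_perm, hπ, hψ]

lemma genA_comp_perm (ρ : Plane → ℝ) (τ : ℝ) (m : ℕ) {Φ : FockSeq}
    (hΦ : ∀ n (σ : Equiv.Perm (Fin n)) (p : Fin n → Plane), Φ n (p ∘ σ) = Φ n p) (k : ℕ)
    (σ : Equiv.Perm (Fin k)) (p : Fin k → Plane) :
    genA ρ τ m Φ k (p ∘ σ) = genA ρ τ m Φ k p := by
  by_cases h : m = 1
  · simp only [genA, if_pos h, genOne, hΦ, Function.comp_apply]
    rw [Equiv.sum_comp σ fun i => p i 0 * (Theta ρ τ (p i) - 1)]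
  · simp only [genA, if_neg h]
    exact Finset.sum_congr rfl fun j hj =>
      genComp_comp_perm ρ τ (Finset.mem_range.1 hj) (hΦ _) σ p

/-- On sequences with finitely many components, the `k`-th component of `𝒜^{τ,m} Φ` vanishes for
large `m`. -/
lemma genA_eq_zero_of_lt (ρ : Plane → ℝ) (τ : ℝ) {Φ : FockSeq} {N : ℕ}
    (hN : ∀ n, N ≤ n → Φ n = 0) {m k : ℕ} (h : k + N + 1 < m) : genA ρ τ m Φ k = 0 := by
  funext p
  have h1 : m ≠ 1 := by omega
  simp only [genA, if_neg h1, Pi.zero_apply]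
  refine Finset.sum_eq_zero fun j hj => ?_
  by_cases hc : j + 1 ≤ k + 2 * j + 1 - m ∧ k + 2 * j + 1 - m + m = k + 2 * j + 1
  · rw [hN _ (by omega)]
    simp [genComp, collideIntegrand]
  · rw [genComp_of_not hc, Pi.zero_apply]

lemma genTotal_term_eq_zero (ρ : Plane → ℝ) (τ : ℝ) (F : ℝ → ℝ) {Φ : FockSeq} {N : ℕ}
    (hN : ∀ n, N ≤ n → Φ n = 0) (k : ℕ) (p : Fin k → Plane) {m : ℕ}
    (hm : m ∉ Finset.range (k + N + 2)) :
    (hermiteCoeff F m : ℂ) * genA ρ τ m Φ k p = 0 := by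
  rw [genA_eq_zero_of_lt ρ τ hN (by rw [Finset.mem_range] at hm; omega), Pi.zero_apply, mul_zero]

lemma summable_genTotal (ρ : Plane → ℝ) (τ : ℝ) (F : ℝ → ℝ) {Φ : FockSeq} {N : ℕ}
    (hN : ∀ n, N ≤ n → Φ n = 0) (k : ℕ) (p : Fin k → Plane) :
    Summable fun m : ℕ => (hermiteCoeff F m : ℂ) * genA ρ τ m Φ k p :=
  summable_of_ne_finset_zero fun _ hm => genTotal_term_eq_zero ρ τ F hN k p hm

/-! ### The sum over `m` -/

/-- The term of order `m` of the series is dominated by the corresponding term of a convergent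
numerical series, if `𝒜^{τ,m} Φ` is, up to the factor `√m!`. -/
lemma fockSq_hermiteCoeff_smul_le {ρ : Plane → ℝ} {τ γ : ℝ} (F : ℝ → ℝ) (m : ℕ) {Ψ : FockSeq}
    {E Y : ℝ≥0∞} (h : (m ! : ℝ≥0∞) * fockSq ρ τ γ Ψ ≤ E ^ 2 * Y) :
    fockSq ρ τ γ ((hermiteCoeff F m : ℂ) • Ψ)
      ≤ (ENNReal.ofReal (|hermiteCoeff F m| / Real.sqrt (m ! : ℝ)) * E) ^ 2 * Y := by
  have h0 : (m ! : ℝ≥0∞) ≠ 0 := by exact_mod_cast m.factorial_ne_zero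
  have e : ENNReal.ofReal (|hermiteCoeff F m| / Real.sqrt (m ! : ℝ)) ^ 2 * (m ! : ℝ≥0∞)
      = ‖(hermiteCoeff F m : ℂ)‖ₑ ^ 2 := by
    rw [enorm_real_sq, ← ENNReal.ofReal_pow (by positivity), ← ENNReal.ofReal_natCast,
      ← ENNReal.ofReal_mul (by positivity), div_pow, sq_abs, Real.sq_sqrt (Nat.cast_nonneg _)]
    congr 1
    have : (m ! : ℝ) ≠ 0 := by positivity
    field_simp
  rw [fockSq_smul, ← e, mul_assoc, mul_pow, mul_assoc]
  exact mul_le_mul' le_rfl h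

/-- A summable sequence of positive weights above a given one. -/
lemma exists_weights {a : ℕ → ℝ≥0∞} (ha : ∑' m, a m ≠ ⊤) :
    ∃ b : ℕ → ℝ≥0∞, (∀ m, a m ≤ b m) ∧ (∀ m, b m ≠ 0) ∧ (∀ m, b m ≠ ⊤) ∧ ∑' m, b m ≠ ⊤ := by
  have hs : ∑' m, (a m + 2⁻¹ ^ m) ≠ ⊤ := by
    rw [ENNReal.tsum_add]
    refine ENNReal.add_ne_top.2 ⟨ha, ?_⟩
    rw [ENNReal.tsum_geometric]
    simp
  refine ⟨fun m => a m + 2⁻¹ ^ m, fun m => le_self_add, fun m => ?_,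
    fun m => ENNReal.ne_top_of_tsum_ne_top hs m, hs⟩
  have : (2⁻¹ : ℝ≥0∞) ^ m ≠ 0 := pow_ne_zero _ (by simp)
  exact fun h => this (add_eq_zero.1 h).2

/-- Convergence of the series in `ΓL²`. -/
lemma genTotal_convergence {ρ : Plane → ℝ} (hρ : IsMollifier ρ) {F : ℝ → ℝ}
    (hF : GrowthAssumption F) {τ : ℝ} (hτ : 0 < τ) {Φ : FockSeq} (hΦ : IsTest ρ τ Φ) {χ : ℕ → ℝ}
    (hs : ∀ n, 1 ≤ n → FourierSuppIn ρ τ Φ n {p | anisoSq τ p ≤ τ * χ n}) :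
    IsFock ρ τ (genTotal ρ τ F Φ) ∧
      Tendsto (fun M : ℕ => fockNorm ρ τ 0
          (genTotal ρ τ F Φ - ∑ m ∈ Finset.range M, (hermiteCoeff F m : ℂ) • genA ρ τ m Φ))
          atTop (𝓝 0) := by
  obtain ⟨N, hN⟩ := hΦ.finite
  have hm := hΦ.fock.measurable
  obtain ⟨Y, hY, hle⟩ := exists_fockSq_genA_crude hρ hτ hm
    (lintegral_lt_top_of_fockNorm hΦ.fock.norm_lt_top) hN hs
  obtain ⟨b, hab, hb0, hb1, hbs⟩ := exists_weights (hF.tsum_hermiteCoeff_ne_top.1 (N + 2))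
  have hmeas : ∀ m k, Measurable (((hermiteCoeff F m : ℂ) • genA ρ τ m Φ) k) := fun m k =>
    (measurable_genA hρ τ m hm k).const_mul _
  have hterm : ∀ m, fockSq ρ τ 0 ((hermiteCoeff F m : ℂ) • genA ρ τ m Φ) ≤ b m ^ 2 * Y := by
    intro m
    refine (fockSq_hermiteCoeff_smul_le F m (hle m)).trans ?_
    rw [← ENNReal.ofReal_mul (by positivity)]
    exact mul_le_mul' (pow_le_pow_left₀ zero_le (hab m) 2) le_rfl
  have htail : ∀ M : ℕ, fockSq ρ τ 0 (genTotal ρ τ F Φ -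
        ∑ m ∈ Finset.range M, (hermiteCoeff F m : ℂ) • genA ρ τ m Φ)
      ≤ (∑' i, b (i + M)) ^ 2 * Y := by
    intro M
    refine fockSq_le_of_enorm_le_tsum
      (x := fun i => (hermiteCoeff F (i + M) : ℂ) • genA ρ τ (i + M) Φ)
      (fun i k => hmeas _ k) (fun k p => ?_) (fun i => hb0 _) (fun i => hb1 _)
      (fun i => hterm _)
    have e : (genTotal ρ τ F Φ -
        ∑ m ∈ Finset.range M, (hermiteCoeff F m : ℂ) • genA ρ τ m Φ) k p
        = ∑' i : ℕ, ((hermiteCoeff F (i + M) : ℂ) • genA ρ τ (i + M) Φ) k p := by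
      have := (summable_genTotal ρ τ F hN k p).sum_add_tsum_nat_add M
      simp only [Pi.sub_apply, Finset.sum_apply, Pi.smul_apply, smul_eq_mul, genTotal]
      rw [← this]
      ring
    rw [e]
    exact enorm_tsum_le_tsum_enorm
  have h2 : (0 : ℝ) < 1 / 2 := by norm_num
  refine ⟨⟨fun k => ?_, fun k σ p => ?_, ?_⟩, ?_⟩
  · have e : genTotal ρ τ F Φ k = fun p => ∑ m ∈ Finset.range (k + N + 2),
        (hermiteCoeff F m : ℂ) * genA ρ τ m Φ k p := by
      funext p
      exact tsum_eq_sum fun m hm => genTotal_term_eq_zero ρ τ F hN k p hm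
    rw [e]
    exact Finset.measurable_fun_sum _ fun m _ => (measurable_genA hρ τ m hm k).const_mul _
  · simp only [genTotal, genA_comp_perm ρ τ _ hΦ.fock.symm]
  · have h := htail 0
    rw [Finset.range_zero, Finset.sum_empty, sub_zero] at h
    rw [fockNorm_eq, ENNReal.rpow_lt_top_iff_of_pos h2]
    refine h.trans_lt (ENNReal.mul_lt_top (ENNReal.pow_lt_top ?_) hY.lt_top)
    simpa only [add_zero] using hbs.lt_top
  · have hlim : Tendsto (fun M : ℕ => ((∑' i, b (i + M)) ^ 2 * Y) ^ (1 / 2 : ℝ)) atTop (𝓝 0) := by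
      have h3 := ENNReal.Tendsto.mul_const (b := Y)
        (ENNReal.Tendsto.pow (n := 2) (ENNReal.tendsto_sum_nat_add b hbs)) (Or.inr hY)
      have h4 := (ENNReal.continuous_rpow_const (y := (1 / 2 : ℝ))).tendsto _ |>.comp h3
      simpa [Function.comp_def] using h4
    refine tendsto_of_tendsto_of_tendsto_of_le_of_le tendsto_const_nhds hlim
      (fun _ => zero_le) fun M => ?_
    exact ENNReal.rpow_le_rpow (htail M) h2.le

/-- The estimate on the non-quadratic part. -/
theorem fockNorm_genNeTwo_le {ρ : Plane → ℝ} (hρ : IsMollifier ρ) {F : ℝ → ℝ}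
    (hF : GrowthAssumption F) {c α : ℝ} (hc : 0 < c) (h0 : 0 < α) (h1 : α < 1) :
    ∃ C : ℝ, 0 < C ∧ ∀ (τ : ℝ) (Φ : FockSeq), 0 < τ → IsTest ρ τ Φ →
      (∀ n, 1 ≤ n → FourierSuppIn ρ τ Φ n {p | anisoSq τ p ≤ τ * chiSeq c n}) →
        fockNorm ρ τ (-1) (genNeTwo ρ τ F Φ) ≤
          ENNReal.ofReal C * fockNorm ρ τ 0 (numberPow (3 / α) (anisoHalf τ Φ)) ^ α *
            fockNorm ρ τ 1 Φ ^ (1 - α) := by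
  obtain ⟨K, hK⟩ := exists_oneParticleBound hρ h0 h1
  obtain ⟨L, hL0, hL⟩ := hρ.exists_abs_mollSq_sub_one_le
  have hK1 := hK.one_le
  set Q := 16 * K ^ 5 + 4 * L ^ 2 with hQdef
  have hQ : 0 < Q := by positivity
  have hχ : ∀ n, 0 ≤ chiSeq c n := fun n => (Real.exp_pos _).le
  set D : ℕ → ℝ≥0∞ := fun m => ∑' n : ℕ, ENNReal.ofReal (chiSeq c n * 4 ^ n * (m : ℝ) ^ n)
    with hD
  set E : ℕ → ℝ≥0∞ := fun m => ENNReal.ofReal ((m : ℝ) ^ 3) + D m with hE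
  have hsum : ∑' m : ℕ, ENNReal.ofReal (|hermiteCoeff F m| / Real.sqrt (m ! : ℝ)) * E m ≠ ⊤ := by
    simp only [hE, mul_add]
    rw [ENNReal.tsum_add]
    refine ENNReal.add_ne_top.2 ⟨ne_top_of_le_ne_top (hF.tsum_hermiteCoeff_ne_top.1 3) ?_,
      hF.tsum_hermiteCoeff_ne_top.2 c hc⟩
    refine ENNReal.tsum_le_tsum fun m => ?_
    rw [← ENNReal.ofReal_mul (by positivity)]
    refine ENNReal.ofReal_le_ofReal ?_
    gcongr
    linarith
  obtain ⟨b, hab, hb0, hb1, hbs⟩ := exists_weights hsum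
  have hS0 : 0 < ∑' m, b m := lt_of_lt_of_le (pos_iff_ne_zero.2 (hb0 0)) (ENNReal.le_tsum 0)
  refine ⟨(∑' m, b m).toReal * Real.sqrt Q,
    mul_pos (ENNReal.toReal_pos hS0.ne' hbs) (Real.sqrt_pos.2 hQ), fun τ Φ hτ hΦ hs => ?_⟩
  obtain ⟨N, hN⟩ := hΦ.finite
  have hm := hΦ.fock.measurable
  set H := fockSq ρ τ 0 (numberPow (3 / α) (anisoHalf τ Φ)) ^ α * fockSq ρ τ 1 Φ ^ (1 - α) with hH
  have hterm : ∀ m, 1 ≤ m → m ≠ 2 →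
      (m ! : ℝ≥0∞) * fockSq ρ τ (-1) (genA ρ τ m Φ) ≤ E m ^ 2 * (ENNReal.ofReal Q * H) := by
    intro m hm1 hm2
    refine (fockSq_genA_le hρ hK hL h0 h1 hτ hm1 hm2 hm hχ hs
      (g := fun n => ENNReal.ofReal ((n : ℝ) ^ 3) * E m) fun n hn => ?_).trans ?_
    · have hn1 : (1 : ℝ) ≤ (n : ℝ) ^ 3 := one_le_pow₀ (by exact_mod_cast hn)
      have hχn := hχ n
      rw [ENNReal.ofReal_add (by positivity) (by positivity), ENNReal.ofReal_mul (by positivity),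
        mul_add]
      refine add_le_add le_rfl ?_
      calc _ ≤ D m := ENNReal.le_tsum (f := fun n : ℕ =>
            ENNReal.ofReal (chiSeq c n * 4 ^ n * (m : ℝ) ^ n)) n
        _ = 1 * D m := (one_mul _).symm
        _ ≤ _ := by
          refine mul_le_mul' ?_ le_rfl
          rw [← ENNReal.ofReal_one]
          exact ENNReal.ofReal_le_ofReal hn1
    · have h3 := tsum_interpEnergy_le (ρ := ρ) (τ := τ) (3 / α) h0.le h1.le hm
      have e : ∀ n : ℕ, ENNReal.ofReal ((((n : ℝ) ^ (3 / α)) ^ 2) ^ α)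
          = ENNReal.ofReal ((n : ℝ) ^ 3) ^ 2 := by
        intro n
        have hn : (0 : ℝ) ≤ n := Nat.cast_nonneg n
        rw [← ENNReal.ofReal_pow (by positivity), ← Real.rpow_natCast, ← Real.rpow_mul hn,
          ← Real.rpow_mul hn, ← pow_mul, ← Real.rpow_natCast]
        congr 2
        push_cast
        field_simp
        norm_num
      simp only [e] at h3
      simp only [mul_pow, mul_right_comm _ (E m ^ 2)]
      rw [ENNReal.tsum_mul_right]
      calc _ = E m ^ 2 * (ENNReal.ofReal Q * ∑' n : ℕ, ENNReal.ofReal ((n : ℝ) ^ 3) ^ 2 *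
            interpEnergy ρ τ α Φ n) := by ring
        _ ≤ _ := mul_le_mul' le_rfl (mul_le_mul' le_rfl h3)
  -- the terms of the series for `𝒜^{τ,≠2}`: the one with `m = 2` is dropped
  set x : ℕ → FockSeq := fun m => if m = 2 then 0 else (hermiteCoeff F m : ℂ) • genA ρ τ m Φ
    with hx
  have hxle : ∀ m, fockSq ρ τ (-1) (x m) ≤ b m ^ 2 * (ENNReal.ofReal Q * H) := by
    intro m
    by_cases hm2 : m = 2
    · simp [hx, hm2, fockSq]
    · have hxm : x m = (hermiteCoeff F m : ℂ) • genA ρ τ m Φ := by simp only [hx, if_neg hm2]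
      rw [hxm]
      rcases Nat.eq_zero_or_pos m with rfl | hm1
      · have : genA ρ τ 0 Φ = 0 := by
          funext k p
          simp [genA]
        simp [this, fockSq]
      · refine (fockSq_hermiteCoeff_smul_le F m (hterm m hm1 hm2)).trans ?_
        exact mul_le_mul' (pow_le_pow_left₀ zero_le (hab m) 2) le_rfl
  have hxsum : ∀ k p, genNeTwo ρ τ F Φ k p = ∑' m, x m k p := by
    intro k p
    have h := (summable_genTotal ρ τ F hN k p).tsum_eq_add_tsum_ite 2
    have e : ∀ m, x m k p
        = if m = 2 then 0 else (hermiteCoeff F m : ℂ) * genA ρ τ m Φ k p := by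
      intro m
      by_cases hm2 : m = 2
      · simp [hx, hm2]
      · simp [hx, hm2]
    simp only [e, genNeTwo, genTotal, Pi.sub_apply, Pi.smul_apply, smul_eq_mul]
    rw [h]
    ring
  have hfin := fockSq_le_of_enorm_le_tsum (ρ := ρ) (τ := τ) (γ := -1) (Φ := genNeTwo ρ τ F Φ)
    (x := x) (fun m k => by
      by_cases hm2 : m = 2
      · simp only [hx, if_pos hm2]
        exact measurable_const
      · simp only [hx, if_neg hm2]
        exact (measurable_genA hρ τ m hm k).const_mul (hermiteCoeff F m : ℂ))
    (fun k p => by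
      rw [hxsum]
      exact enorm_tsum_le_tsum_enorm) hb0 hb1 hxle
  refine fockNorm_le_of_fockSq_le (hfin.trans (le_of_eq ?_))
  rw [ENNReal.ofReal_mul ENNReal.toReal_nonneg, ENNReal.ofReal_toReal hbs, mul_pow,
    ← ENNReal.ofReal_pow (Real.sqrt_nonneg _), Real.sq_sqrt hQ.le, mul_assoc]

end SBE


theorem propositionp (ρ : Plane → ℝ) (hρ : IsMollifier ρ) :
    -- the estimate on each `𝒜^{τ,m}`, `m ≠ 2`, on a fixed chaos
    (∀ α : ℝ, 0 < α → α < 1 → ∃ C : ℝ, 0 < C ∧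
      ∀ (τ : ℝ) (m n : ℕ) (χ : ℝ) (Φ : FockSeq),
        0 < τ → 1 ≤ m → m ≠ 2 → 0 ≤ χ → χ ≤ 1 →
        IsFock ρ τ Φ → (∀ k, k ≠ n → Φ k = 0) →
        FourierSuppIn ρ τ Φ n {p | anisoSq τ p ≤ τ * χ} →
        GenConverges ρ τ m Φ ∧
        fockNorm ρ τ (-1) ((Real.sqrt (m ! : ℝ) : ℂ) • genA ρ τ m Φ) ≤
          ENNReal.ofReal (C * ((n : ℝ) ^ 3 * (m : ℝ) ^ 3 + χ * 4 ^ n * (m : ℝ) ^ n)) *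
            fockNorm ρ τ 0 (anisoHalf τ Φ) ^ α * fockNorm ρ τ 1 Φ ^ (1 - α)) ∧
    -- the estimate on the whole non-quadratic part
    (∀ F : ℝ → ℝ, GrowthAssumption F → ∀ c α : ℝ, 0 < c → 0 < α → α < 1 →
      ∃ C : ℝ, 0 < C ∧
      ∀ (τ : ℝ) (Φ : FockSeq),
        0 < τ → IsTest ρ τ Φ →
        (∀ n, 1 ≤ n → FourierSuppIn ρ τ Φ n {p | anisoSq τ p ≤ τ * chiSeq c n}) →
        (∀ m, GenConverges ρ τ m Φ) ∧
        -- the series over `m` that defines `𝒜^τ Φ` converges in the Fock space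
        IsFock ρ τ (genTotal ρ τ F Φ) ∧
        Tendsto (fun M : ℕ => fockNorm ρ τ 0
          (genTotal ρ τ F Φ - ∑ m ∈ Finset.range M, (hermiteCoeff F m : ℂ) • genA ρ τ m Φ))
          atTop (𝓝 0) ∧
        fockNorm ρ τ (-1) (genNeTwo ρ τ F Φ) ≤
          ENNReal.ofReal C *
            fockNorm ρ τ 0 (numberPow (3 / α) (anisoHalf τ Φ)) ^ α *
            fockNorm ρ τ 1 Φ ^ (1 - α)) := by
  refine ⟨fun α h0 h1 => fockNorm_genA_le_of_single hρ h0 h1, fun F hF c α hc h0 h1 => ?_⟩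
  obtain ⟨C, hC, hle⟩ := fockNorm_genNeTwo_le hρ hF hc h0 h1
  refine ⟨C, hC, fun τ Φ hτ hΦ hs => ⟨fun m => ?_, ?_⟩⟩
  · exact genConverges_of_lintegral_lt_top hρ hτ hΦ.fock.measurable
      (lintegral_lt_top_of_fockNorm hΦ.fock.norm_lt_top) m
  · obtain ⟨h2, h3⟩ := genTotal_convergence hρ hF hτ hΦ hs
    exact ⟨h2, h3, hle τ Φ hτ hΦ hs⟩
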